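/- Setting. Let $V_1,\dots,V_k$ be finite sets and let $\mu$ be a probability measure on $V_1\times\cdots\times V_k$. For $S\subseteq[k]$ let $\mu_S$ be the projection of $\mu$ to the coordinates in $S$ and $V_S$ its support. For $x\in V_S$ the link $(V_x,\mu_x)$ is the conditional distribution of the remaining coordinates given that the coordinates in $S$ equal $x$. A probability measure on a product of two sets, with marginals $\mu_1,\mu_2$, is $\epsilon$-pseudorandom if $|\mathbb E[f_1(x_1)f_2(x_2)]-\mathbb E[f_1(x_1)]\,\mathbb E[f_2(x_2)]|\le\epsilon\sqrt{\mathrm{Var}_{\mu_1}[f_1]\,\mathrm{Var}_{\mu_2}[f_2]}$ for all real functions $f_1,f_2$. For $\epsilon\ge 0$, $\mu$ is $\epsilon$-product if for all $|S|\le k-2$ and $x\in V_S$ all projections of the link $\mu_x$ to two distinct coordinates outside $S$ are $\epsilon$-pseudorandom. (A weighted complex that is an $\epsilon$-high-dimensional expander is regarded as such a measure.) For $f\colon V_{[k]}\to\mathbb R$ put $A_Sf(x)=\mathbb E_{y\sim\mu}[f(y)\mid y_S=x_S]$, $f^{=S}=\sum_{T\subseteq S}(-1)^{|S\setminus T|}A_Tf$,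 $f^{\le d}=\sum_{|S|\le d}f^{=S}$, $L_T^{\le d}[f]=\sum_{S\supseteq T,\,|S|\le d}f^{=S}$ and, for $x\in V_T$, $I_{T,x}^{\le d}[f]=\|L_T^{\le d}[f](x,\cdot)\|_{L^2(V_x,\mu_x)}^2$. The function $f$ is $(d,\delta)$-global if $\|f(x,\cdot)\|_{L^2(V_x,\mu_x)}\le\delta$ for all $|S|\le d$ and $x\in V_S$. Norms of $f$ and $f^{\le d}$ are those of $L^p(\mu)$, and $0^0=1$. Theorem. (1) For every $k$ there is a constant $C=C(k)$ such that, if $\mu$ is $\epsilon$-product and $f$ is $(d,\delta)$-global, then $$\|f^{\le d}\|_4^4\le 20^{d+1}\sum_{|S|\le d}(4d)^{|S|}\,\mathbb E_{x\sim\mu_S}\big[I_{S,x}^{\le d}[f]^2\big]+C\,\epsilon^2\delta^2\,\|f\|_2^2 .$$ (2) For every $k$ there are $\epsilon_0=\epsilon_0(k)>0$ and $C=C(k)$ such that, if $\mu$ is $\epsilon$-product with $\epsilon\le\epsilon_0$ and $f$ is $(d,\delta)$-global, then $$\|f^{\le d}\|_4^4\le(100d)^d\,\delta^2\,\|f^{\le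 d}\|_2^2+C\,\delta^2\epsilon^2\,\|f\|_2^2 .$$ (3) For every $\zeta>0$ and every $d$ there is $\delta_0=\delta_0(\zeta,d)>0$ such that for every $k$ there is $\epsilon_0=\epsilon_0(\zeta,d,k)>0$ with the following property: if $\mu$ is $\epsilon$-product with $\epsilon\le\epsilon_0$ and $f$ is $(d,\delta)$-global with $\delta\le\delta_0$, then $$\|f^{\le d}\|_4^4\le\zeta\,\|f\|_2^2 .$$ -/

import Mathlib

universe u

noncomputable section

namespace EpsProduct

/-- Expectation `E_{x ∼ μ}[f x]`, for a weight function `μ` on a finite set. -/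
def expect {Ω : Type*} [Fintype Ω] (μ f : Ω → ℝ) : ℝ := ∑ x, μ x * f x

/-- Variance of `f` under `μ`. -/
def variance {Ω : Type*} [Fintype Ω] (μ f : Ω → ℝ) : ℝ :=
  expect μ (fun x => (f x - expect μ f) ^ 2)

/-- The norm of `L^p(μ)`, for a natural number `p ≥ 1`. -/
def lpNorm {Ω : Type*} [Fintype Ω] (p : ℕ) (μ f : Ω → ℝ) : ℝ :=
  (expect μ (fun x => |f x| ^ p)) ^ (1 / (p : ℝ))

/-- `μ_S(x_S)`: the mass that the projection of `μ` to the coordinates in `S` gives to the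
restriction of `x` to `S`.  The point `x_S` lies in the support `V_S` of `μ_S` exactly when this
is positive. A point of `V_S` is represented by any point `x` of the full product extending it. -/
def marginal {k : ℕ} {V : Fin k → Type*} [∀ i, Fintype (V i)]
    (μ : (∀ i, V i) → ℝ) (S : Finset (Fin k)) (x : ∀ i, V i) : ℝ :=
  ∑ y : ∀ i, V i, {y : ∀ i, V i | ∀ i ∈ S, y i = x i}.indicator μ y

/-- The link `μ_{x_S}`, that is, `μ` conditioned on `y_S = x_S`. The conditional law of the
remaining coordinates is regarded as a law on the full product in which the coordinates in `S`
are frozen to those of `x`. -/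
def link {k : ℕ} {V : Fin k → Type*} [∀ i, Fintype (V i)]
    (μ : (∀ i, V i) → ℝ) (S : Finset (Fin k)) (x : ∀ i, V i) : (∀ i, V i) → ℝ :=
  fun y => {y : ∀ i, V i | ∀ i ∈ S, y i = x i}.indicator μ y / marginal μ S x

/-- The `(i, j)`-skeleton of `ν` (the law of `(x i, x j)` for `x ∼ ν`) is `ε`-pseudorandom. -/
def PseudorandomSkeleton {k : ℕ} {V : Fin k → Type*} [∀ i, Fintype (V i)]
    (ε : ℝ) (ν : (∀ i, V i) → ℝ) (i j : Fin k) : Prop :=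
  ∀ (f₁ : V i → ℝ) (f₂ : V j → ℝ),
    |expect ν (fun x => f₁ (x i) * f₂ (x j))
        - expect ν (fun x => f₁ (x i)) * expect ν (fun x => f₂ (x j))|
      ≤ ε * √(variance ν (fun x => f₁ (x i)) * variance ν (fun x => f₂ (x j)))

/-- `μ` is `ε`-product: for all `S` with `|S| ≤ k - 2` and all `x_S ∈ V_S`, every two-dimensional
skeleton of the link of `x_S` is `ε`-pseudorandom. -/
def IsEpsProduct {k : ℕ} {V : Fin k → Type*} [∀ i, Fintype (V i)]
    (ε : ℝ) (μ : (∀ i, V i) → ℝ) : Prop :=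
  ∀ S : Finset (Fin k), S.card + 2 ≤ k → ∀ x : ∀ i, V i, 0 < marginal μ S x →
    ∀ i j : Fin k, i ∉ S → j ∉ S → i ≠ j → PseudorandomSkeleton ε (link μ S x) i j

/-- The averaging operator `A_S f (x) = E_{y ∼ μ}[f y | y_S = x_S]`. -/
def avg {k : ℕ} {V : Fin k → Type*} [∀ i, Fintype (V i)]
    (μ : (∀ i, V i) → ℝ) (S : Finset (Fin k)) (f : (∀ i, V i) → ℝ) : (∀ i, V i) → ℝ :=
  fun x => expect (link μ S x) f

/-- The Efron--Stein component `f^{=S} = ∑_{T ⊆ S} (-1)^{|S \ T|} A_T f`. -/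
def component {k : ℕ} {V : Fin k → Type*} [∀ i, Fintype (V i)]
    (μ : (∀ i, V i) → ℝ) (S : Finset (Fin k)) (f : (∀ i, V i) → ℝ) : (∀ i, V i) → ℝ :=
  fun x => ∑ T ∈ S.powerset, (-1 : ℝ) ^ (S \ T).card * avg μ T f x

/-- The low degree Laplacian `L_T^{≤ d}[f] = ∑_{S ⊇ T, |S| ≤ d} f^{=S}`. -/
def lowLaplacian {k : ℕ} {V : Fin k → Type*} [∀ i, Fintype (V i)]
    (μ : (∀ i, V i) → ℝ) (d : ℕ) (T : Finset (Fin k)) (f : (∀ i, V i) → ℝ) :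
    (∀ i, V i) → ℝ :=
  fun x => ∑ S : Finset (Fin k) with T ⊆ S ∧ S.card ≤ d, component μ S f x

/-- The low degree part `f^{≤ d} = ∑_{|S| ≤ d} f^{=S}`. -/
def lowDegree {k : ℕ} {V : Fin k → Type*} [∀ i, Fintype (V i)]
    (μ : (∀ i, V i) → ℝ) (d : ℕ) (f : (∀ i, V i) → ℝ) : (∀ i, V i) → ℝ :=
  fun x => ∑ S : Finset (Fin k) with S.card ≤ d, component μ S f x

/-- The low degree influence `I_{T,x}^{≤ d}[f] = ‖L_T^{≤ d}[f](x, ·)‖²`, the norm being that of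
`L²` of the link of `x_T`. It depends on `x` only through `x_T`. -/
def lowInfluence {k : ℕ} {V : Fin k → Type*} [∀ i, Fintype (V i)]
    (μ : (∀ i, V i) → ℝ) (d : ℕ) (T : Finset (Fin k)) (f : (∀ i, V i) → ℝ)
    (x : ∀ i, V i) : ℝ :=
  lpNorm 2 (link μ T x) (lowLaplacian μ d T f) ^ 2

/-- `f` is `(d, δ)`-global: `‖f(x, ·)‖ ≤ δ` in `L²` of the link of `x`, for all `|S| ≤ d` and
`x ∈ V_S`. -/
def IsGlobal {k : ℕ} {V : Fin k → Type*} [∀ i, Fintype (V i)]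
    (μ : (∀ i, V i) → ℝ) (d : ℕ) (δ : ℝ) (f : (∀ i, V i) → ℝ) : Prop :=
  ∀ S : Finset (Fin k), S.card ≤ d → ∀ x : ∀ i, V i, 0 < marginal μ S x →
    lpNorm 2 (link μ S x) f ≤ δ

end EpsProduct

end

/-!
The theorem is proved on the support of `μ`, where all masses are positive, the averaging
operators `A_S` are genuine conditional expectations, and no equation holds only almost everywhere
(`CoordSpace`, `ofMeasure`).

*The space is almost a product.* The covariance of a function of the coordinates in `B` and a
function of the coordinates in `C` splits, on conditioning on one further coordinate, into an
average of conditional covariances and a covariance of conditional expectations (`cov_step`). By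
induction it is at most `|B| |C| ε` times the product of the standard deviations (`Pseudo.cov`),
and hence `‖A_S A_T f - A_{S ∩ T} f‖₂ ≤ κ ‖f‖₂` with `κ = k² ε` (`Pseudo.near`). So the
Efron--Stein components behave, up to `O(κ)`, as in a product space: they are almost orthogonal
(`Near.abs_E_rcomp_mul_rcomp_le`), `(f^{≤ d})^{=U}` is close to `f^{=U}` for `|U| ≤ d`
(`Near.nrm_comp_low_sub_le`), and a Bessel inequality holds in every link
(`Near.sum_A_rcomp_sq_le`).

*The fourth moment.* Write `h = f^{≤ d}`, so that `‖h‖₄⁴ = ‖h²‖₂² ≈ ∑_S ‖(h²)^{=S}‖₂²`. In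
`h² = ∑ f^{=U} f^{=U'}` only the pairs with `U ∆ U' ⊆ S ⊆ U ∪ U'` matter for the component at `S`
(`Glob.nrm_comp_mul_le`); they have the form `U = B ∪ R`, `U' = C ∪ R` with `B ∪ C = S` and `R`
disjoint from `S`. Cauchy--Schwarz over `R`, and then over `(B, C)` with weights `q^{|B ∩ C|}`,
whose inverses sum to `(2 + 1/q)^{|S|}`, bounds `‖h‖₄⁴` by a weighted sum over `T = B ∩ C` of the
second moments of the energies `∑_{U ⊇ T} A_T (f^{=U})²` (`sum_nrm_A_mainPart_sq_le`,
`Glob.E_low_pow_four_le`). The error terms are of two kinds. Those of size `κ² δ² ‖f‖₂²` are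
admissible. Those of size `κ ‖f^{=U}‖₄⁴` are only linear in `κ`, but `‖f^{=U}‖₄⁴` is at most a
constant times `‖h‖₄⁴ + κ² δ² ‖f‖₂²` (`Glob.E_comp_pow_four_le`), so for small `κ` they are
absorbed into the left-hand side; for large `κ` the crude bound `|h| ≤ 4^k δ` is enough.

*Conclusion.* The energy at `T` is close in `L²` to the influence (`Glob.E_energy_sq_le`), which
gives the first part. For global `f` it is at most `4^{|T|} δ²` up to a small error
(`Glob.exists_energy_le`), because `f^{=U}` is almost an alternating sum of `2^{|T|}` averages of
the component of `f` at `U` relative to `T`, to which the Bessel inequality in the link applies;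
its second moment is then bounded by its first (`Glob.E_energy_sq_le_mul`), and the choice
`q = 2 d` gives the constant `(100 d)^d` of the second part (`wt_const_le`). The third part follows from
the second and `‖f^{≤ d}‖₂² ≤ 2 ‖f‖₂²`.
-/

/-! ### Finite probability spaces with coordinates -/

noncomputable section

namespace EpsProduct

open Finset

/-- A finite probability space all of whose points have positive mass, together with `k`
coordinates. A coordinate is recorded only through the equivalence relation "equal in the `i`-th
coordinate"; jointly the coordinates separate points. -/
structure CoordSpace (k : ℕ) (Ω : Type*) [Fintype Ω] where
  /-- the mass of a point -/
  w : Ω → ℝ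
  pos : ∀ x, 0 < w x
  sum_one : ∑ x, w x = 1
  /-- equality in the `i`-th coordinate -/
  same : Fin k → Ω → Ω → Prop
  equiv : ∀ i, Equivalence (same i)
  sep : ∀ x y, (∀ i, same i x y) → x = y

namespace CoordSpace

variable {k : ℕ} {Ω : Type*} [Fintype Ω] (P : CoordSpace k Ω)

/-- `x` and `y` agree in all coordinates from `S`. -/
def Rel (S : Finset (Fin k)) (x y : Ω) : Prop := ∀ i ∈ S, P.same i x y

variable {P} in
lemma Rel.symm {S : Finset (Fin k)} {x y : Ω} (h : P.Rel S x y) : P.Rel S y x :=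
  fun i hi => (P.equiv i).symm (h i hi)

variable {P} in
lemma Rel.trans {S : Finset (Fin k)} {x y z : Ω} (h : P.Rel S x y) (h' : P.Rel S y z) :
    P.Rel S x z :=
  fun i hi => (P.equiv i).trans (h i hi) (h' i hi)

lemma Rel.refl (S : Finset (Fin k)) (x : Ω) : P.Rel S x x := fun i _ => (P.equiv i).refl x

/-- A function is `S`-measurable if it depends only on the coordinates in `S`. -/
def Meas (S : Finset (Fin k)) (f : Ω → ℝ) : Prop := ∀ x y, P.Rel S x y → f x = f y

/-- Expectation, as a linear functional. -/
def E : (Ω → ℝ) →ₗ[ℝ] ℝ where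
  toFun f := ∑ x, P.w x * f x
  map_add' f g := by simp [mul_add, sum_add_distrib]
  map_smul' c f := by simp [mul_sum, mul_left_comm]

lemma E_apply (f : Ω → ℝ) : P.E f = ∑ x, P.w x * f x := rfl

open Classical in
/-- The mass of the set of points agreeing with `x` in the coordinates from `S`. -/
def mass (S : Finset (Fin k)) (x : Ω) : ℝ := ∑ y, if P.Rel S x y then P.w y else 0

open Classical in
/-- The conditional probability of `y` given the coordinates of `x` in `S`. -/
def ker (S : Finset (Fin k)) (x y : Ω) : ℝ := (if P.Rel S x y then P.w y else 0) / P.mass S x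

/-- The averaging operator `A_S`: conditional expectation given the coordinates in `S`. -/
def A (S : Finset (Fin k)) : (Ω → ℝ) →ₗ[ℝ] (Ω → ℝ) where
  toFun f x := ∑ y, P.ker S x y * f y
  map_add' f g := by ext x; simp [mul_add, sum_add_distrib]
  map_smul' c f := by ext x; simp [mul_sum, mul_left_comm]

lemma A_apply (S : Finset (Fin k)) (f : Ω → ℝ) (x : Ω) : P.A S f x = ∑ y, P.ker S x y * f y := rfl

lemma mass_pos (S : Finset (Fin k)) (x : Ω) : 0 < P.mass S x := by
  classical
  refine sum_pos' (fun y _ => ?_) ⟨x, mem_univ _, ?_⟩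
  · split_ifs
    exacts [(P.pos y).le, le_rfl]
  · rw [if_pos (Rel.refl P S x)]
    exact P.pos x

lemma ker_nonneg (S : Finset (Fin k)) (x y : Ω) : 0 ≤ P.ker S x y := by
  unfold ker
  refine div_nonneg ?_ (P.mass_pos S x).le
  split_ifs
  exacts [(P.pos y).le, le_rfl]

lemma sum_ker (S : Finset (Fin k)) (x : Ω) : ∑ y, P.ker S x y = 1 := by
  classical
  unfold ker
  rw [← sum_div]
  exact div_self (P.mass_pos S x).ne'

lemma ker_eq_zero {S : Finset (Fin k)} {x y : Ω} (h : ¬ P.Rel S x y) : P.ker S x y = 0 := by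
  simp [ker, h]

variable {P} in
lemma Rel.iff_of {S : Finset (Fin k)} {x x' : Ω} (h : P.Rel S x x') (y : Ω) :
    P.Rel S x y ↔ P.Rel S x' y :=
  ⟨fun h' => h.symm.trans h', fun h' => h.trans h'⟩

variable {P} in
lemma Rel.mass_eq {S : Finset (Fin k)} {x x' : Ω} (h : P.Rel S x x') :
    P.mass S x = P.mass S x' := by
  classical
  unfold mass
  exact sum_congr rfl fun y _ => if_congr (h.iff_of y) rfl rfl

variable {P} in
lemma Rel.ker_eq {S : Finset (Fin k)} {x x' : Ω} (h : P.Rel S x x') (y : Ω) :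
    P.ker S x y = P.ker S x' y := by
  classical
  unfold ker
  rw [h.mass_eq, if_congr (h.iff_of y) rfl rfl]

lemma w_mul_ker (S : Finset (Fin k)) (x y : Ω) :
    P.w x * P.ker S x y = P.w y * P.ker S y x := by
  by_cases h : P.Rel S x y
  · simp only [ker, h, h.symm, if_true, h.mass_eq]
    ring
  · rw [P.ker_eq_zero h, P.ker_eq_zero (fun h' => h h'.symm)]
    simp

lemma meas_A (S : Finset (Fin k)) (f : Ω → ℝ) : P.Meas S (P.A S f) := by
  intro x y h
  simp only [A_apply, h.ker_eq]

variable {P}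

lemma Meas.mono {S T : Finset (Fin k)} {f : Ω → ℝ} (h : P.Meas S f) (hST : S ⊆ T) : P.Meas T f :=
  fun x y hxy => h x y fun i hi => hxy i (hST hi)

lemma Meas.mul {S : Finset (Fin k)} {f g : Ω → ℝ} (hf : P.Meas S f) (hg : P.Meas S g) :
    P.Meas S (f * g) := fun x y h => by simp [hf x y h, hg x y h]

lemma Meas.sub {S : Finset (Fin k)} {f g : Ω → ℝ} (hf : P.Meas S f) (hg : P.Meas S g) :
    P.Meas S (f - g) := fun x y h => by simp [hf x y h, hg x y h]

lemma Meas.smul {S : Finset (Fin k)} {f : Ω → ℝ} (c : ℝ) (hf : P.Meas S f) :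
    P.Meas S (c • f) := fun x y h => by simp [hf x y h]

lemma Meas.sum {ι : Type*} {S : Finset (Fin k)} {s : Finset ι} {f : ι → Ω → ℝ}
    (hf : ∀ i ∈ s, P.Meas S (f i)) : P.Meas S (∑ i ∈ s, f i) := fun x y h => by
  simp only [Finset.sum_apply]
  exact sum_congr rfl fun i hi => hf i hi x y h

lemma meas_univ (f : Ω → ℝ) : P.Meas univ f := fun x y h => by
  rw [P.sep x y fun i => h i (mem_univ i)]

/-- Measurable factors can be pulled out of a conditional expectation. -/
lemma Meas.A_mul {S : Finset (Fin k)} {u : Ω → ℝ} (hu : P.Meas S u) (v : Ω → ℝ) :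
    P.A S (u * v) = u * P.A S v := by
  ext x
  simp only [A_apply, Pi.mul_apply, mul_sum]
  refine sum_congr rfl fun y _ => ?_
  by_cases h : P.Rel S x y
  · rw [hu x y h]; ring
  · rw [P.ker_eq_zero h]; ring

variable (P)

lemma A_one (S : Finset (Fin k)) : P.A S 1 = 1 := by
  ext x
  simp [A_apply, P.sum_ker]

variable {P} in
lemma Meas.A_eq {S : Finset (Fin k)} {u : Ω → ℝ} (hu : P.Meas S u) : P.A S u = u := by
  simpa [P.A_one] using hu.A_mul 1

lemma A_mono (S : Finset (Fin k)) {f g : Ω → ℝ} (h : f ≤ g) : P.A S f ≤ P.A S g :=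
  fun x => sum_le_sum fun y _ => mul_le_mul_of_nonneg_left (h y) (P.ker_nonneg S x y)

lemma A_nonneg (S : Finset (Fin k)) {f : Ω → ℝ} (h : 0 ≤ f) : 0 ≤ P.A S f := by
  simpa using P.A_mono S h

lemma A_le_const (S : Finset (Fin k)) {f : Ω → ℝ} {c : ℝ} (h : ∀ x, f x ≤ c) (x : Ω) :
    P.A S f x ≤ c := by
  have : f ≤ c • (1 : Ω → ℝ) := fun x => by simpa using h x
  simpa [P.A_one] using P.A_mono S this x

lemma abs_A_le_const (S : Finset (Fin k)) {f : Ω → ℝ} {c : ℝ} (h : ∀ x, |f x| ≤ c) (x : Ω) :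
    |P.A S f x| ≤ c := by
  refine abs_le.2 ⟨?_, P.A_le_const S (fun x => (abs_le.1 (h x)).2) x⟩
  have := P.A_le_const S (f := -f) (c := c) (fun x => by simpa using neg_le.1 (abs_le.1 (h x)).1) x
  simp only [map_neg, Pi.neg_apply] at this
  linarith

lemma E_A_mul (S : Finset (Fin k)) (f g : Ω → ℝ) : P.E (P.A S f * g) = P.E (f * P.A S g) := by
  simp only [E_apply, A_apply, Pi.mul_apply, mul_sum, sum_mul]
  rw [sum_comm]
  refine sum_congr rfl fun y _ => sum_congr rfl fun x _ => ?_
  have := P.w_mul_ker S x y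
  linear_combination (f y * g x) * this

lemma E_A (S : Finset (Fin k)) (f : Ω → ℝ) : P.E (P.A S f) = P.E f := by
  simpa [P.A_one] using P.E_A_mul S f 1

lemma E_mono {f g : Ω → ℝ} (h : f ≤ g) : P.E f ≤ P.E g :=
  sum_le_sum fun x _ => mul_le_mul_of_nonneg_left (h x) (P.pos x).le

lemma E_nonneg {f : Ω → ℝ} (h : 0 ≤ f) : 0 ≤ P.E f := by
  simpa using P.E_mono h

lemma E_sq_nonneg (f : Ω → ℝ) : 0 ≤ P.E (f ^ 2) := P.E_nonneg fun x => sq_nonneg (f x)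

lemma ext_of_E_mul {f g : Ω → ℝ} (h : ∀ u : Ω → ℝ, P.E (u * f) = P.E (u * g)) : f = g := by
  classical
  ext x
  have := h (Pi.single x 1)
  simp only [E_apply, Pi.mul_apply, Pi.single_apply, ite_mul, one_mul, zero_mul, mul_ite,
    mul_zero, sum_ite_eq', mem_univ, if_true] at this
  exact mul_left_cancel₀ (P.pos x).ne' this

lemma A_A_of_superset {S T : Finset (Fin k)} (h : S ⊆ T) (f : Ω → ℝ) :
    P.A T (P.A S f) = P.A S f :=
  ((P.meas_A S f).mono h).A_eq

/-- The tower property. -/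
lemma A_A_of_subset {S T : Finset (Fin k)} (h : S ⊆ T) (f : Ω → ℝ) :
    P.A S (P.A T f) = P.A S f := by
  refine P.ext_of_E_mul fun u => ?_
  rw [← P.E_A_mul, ← P.E_A_mul, P.A_A_of_superset h, P.E_A_mul]

lemma A_univ (f : Ω → ℝ) : P.A univ f = f := (meas_univ f).A_eq

/-- Cauchy--Schwarz for conditional expectations. -/
lemma A_mul_sq_le (S : Finset (Fin k)) (f g : Ω → ℝ) (x : Ω) :
    (P.A S (f * g) x) ^ 2 ≤ P.A S (f ^ 2) x * P.A S (g ^ 2) x := by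
  have := sum_sq_le_sum_mul_sum_of_sq_le_mul univ (r := fun y => P.ker S x y * (f y * g y))
    (f := fun y => P.ker S x y * f y ^ 2) (g := fun y => P.ker S x y * g y ^ 2)
    (fun y _ => mul_nonneg (P.ker_nonneg S x y) (sq_nonneg _))
    (fun y _ => mul_nonneg (P.ker_nonneg S x y) (sq_nonneg _)) (fun y _ => le_of_eq (by ring))
  simpa [A_apply] using this

lemma A_sq_le (S : Finset (Fin k)) (f : Ω → ℝ) : (P.A S f) ^ 2 ≤ P.A S (f ^ 2) := fun x => by
  simpa [P.A_one] using P.A_mul_sq_le S f 1 x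

/-- The `L²` norm. -/
def nrm (f : Ω → ℝ) : ℝ := √(P.E (f ^ 2))

lemma nrm_nonneg (f : Ω → ℝ) : 0 ≤ P.nrm f := Real.sqrt_nonneg _

lemma nrm_sq (f : Ω → ℝ) : P.nrm f ^ 2 = P.E (f ^ 2) := Real.sq_sqrt (P.E_sq_nonneg f)

lemma E_mul_le (f g : Ω → ℝ) : P.E (f * g) ^ 2 ≤ P.E (f ^ 2) * P.E (g ^ 2) := by
  have := sum_sq_le_sum_mul_sum_of_sq_le_mul univ (r := fun y => P.w y * (f y * g y))
    (f := fun y => P.w y * f y ^ 2) (g := fun y => P.w y * g y ^ 2)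
    (fun y _ => mul_nonneg (P.pos y).le (sq_nonneg _))
    (fun y _ => mul_nonneg (P.pos y).le (sq_nonneg _)) (fun y _ => le_of_eq (by ring))
  simpa [E_apply] using this

lemma abs_E_mul_le (f g : Ω → ℝ) : |P.E (f * g)| ≤ P.nrm f * P.nrm g := by
  refine abs_le_of_sq_le_sq ?_ (mul_nonneg (P.nrm_nonneg f) (P.nrm_nonneg g))
  rw [mul_pow, P.nrm_sq, P.nrm_sq]
  exact P.E_mul_le f g

lemma nrm_le_of_sq_le {f : Ω → ℝ} {c : ℝ} (hc : 0 ≤ c) (h : P.E (f ^ 2) ≤ c ^ 2) :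
    P.nrm f ≤ c := Real.sqrt_le_iff.2 ⟨hc, h⟩

lemma nrm_mono {f g : Ω → ℝ} (h : ∀ x, |f x| ≤ |g x|) : P.nrm f ≤ P.nrm g :=
  Real.sqrt_le_sqrt (P.E_mono fun x => sq_le_sq.2 (h x))

lemma nrm_smul (c : ℝ) (f : Ω → ℝ) : P.nrm (c • f) = |c| * P.nrm f := by
  unfold nrm
  rw [smul_pow, map_smul, smul_eq_mul, Real.sqrt_mul (sq_nonneg c), Real.sqrt_sq_eq_abs]

lemma nrm_neg (f : Ω → ℝ) : P.nrm (-f) = P.nrm f := by simp [nrm]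

lemma nrm_zero : P.nrm 0 = 0 := by simp [nrm]

lemma nrm_add_le (f g : Ω → ℝ) : P.nrm (f + g) ≤ P.nrm f + P.nrm g := by
  refine P.nrm_le_of_sq_le (add_nonneg (P.nrm_nonneg f) (P.nrm_nonneg g)) ?_
  have h1 : (f + g) ^ 2 = f ^ 2 + (2 : ℝ) • (f * g) + g ^ 2 := by
    ext x; simp; ring
  have h2 := (abs_le.1 (P.abs_E_mul_le f g)).2
  rw [h1, map_add, map_add, map_smul, smul_eq_mul, ← P.nrm_sq, ← P.nrm_sq]
  nlinarith

lemma nrm_sum_le {ι : Type*} (s : Finset ι) (f : ι → Ω → ℝ) :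
    P.nrm (∑ i ∈ s, f i) ≤ ∑ i ∈ s, P.nrm (f i) :=
  le_sum_of_subadditive P.nrm P.nrm_zero.le P.nrm_add_le s f

lemma nrm_sum_le_card {ι : Type*} (s : Finset ι) (f : ι → Ω → ℝ) {c n : ℝ} (hc : 0 ≤ c)
    (hn : (s.card : ℝ) ≤ n) (h : ∀ i ∈ s, P.nrm (f i) ≤ c) : P.nrm (∑ i ∈ s, f i) ≤ n * c := by
  refine (P.nrm_sum_le s f).trans ((sum_le_card_nsmul s _ c h).trans ?_)
  rw [nsmul_eq_mul]
  exact mul_le_mul_of_nonneg_right hn hc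

lemma nrm_A_le (S : Finset (Fin k)) (f : Ω → ℝ) : P.nrm (P.A S f) ≤ P.nrm f := by
  refine Real.sqrt_le_sqrt ?_
  rw [← P.E_A S (f ^ 2)]
  exact P.E_mono (P.A_sq_le S f)

lemma nrm_mul_le {f : Ω → ℝ} {c : ℝ} (h : ∀ x, |f x| ≤ c) (g : Ω → ℝ) :
    P.nrm (f * g) ≤ c * P.nrm g := by
  obtain hΩ | ⟨⟨x0⟩⟩ := isEmpty_or_nonempty Ω
  · simp [nrm, E_apply]
  have hc : 0 ≤ c := (abs_nonneg _).trans (h x0)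
  rw [← abs_of_nonneg hc, ← P.nrm_smul]
  refine P.nrm_mono fun x => ?_
  simp only [Pi.mul_apply, Pi.smul_apply, smul_eq_mul, abs_mul, abs_of_nonneg hc]
  exact mul_le_mul_of_nonneg_right (h x) (abs_nonneg _)

/-- `‖f - A_S f‖` is the distance of `f` to the `S`-measurable functions. -/
lemma nrm_sub_A_le {S : Finset (Fin k)} {u : Ω → ℝ} (hu : P.Meas S u) (f : Ω → ℝ) :
    P.nrm (f - P.A S f) ≤ P.nrm (f - u) := by
  refine Real.sqrt_le_sqrt ?_
  have h1 : (f - u) ^ 2 = (f - P.A S f) ^ 2 + (2 : ℝ) • ((f - P.A S f) * (P.A S f - u))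
      + (P.A S f - u) ^ 2 := by
    ext x; simp; ring
  have h2 : P.E ((f - P.A S f) * (P.A S f - u)) = 0 := by
    have hm : P.Meas S (P.A S f - u) := (P.meas_A S f).sub hu
    rw [← hm.A_eq, ← P.E_A_mul, map_sub, P.A_A_of_subset (subset_refl S)]
    simp
  rw [h1, map_add, map_add, map_smul, h2]
  have := P.E_sq_nonneg (P.A S f - u)
  simpa using this

end CoordSpace
end EpsProduct
end

/-! ### Averaging operators almost multiply -/

noncomputable section

namespace EpsProduct
namespace CoordSpace
open Finset

variable {k : ℕ} {Ω : Type*} [Fintype Ω] (P : CoordSpace k Ω)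

/-- Conditionally on the coordinates in `S`, functions of two different further coordinates are
`ε`-uncorrelated. -/
def Pseudo (ε : ℝ) : Prop :=
  ∀ (S : Finset (Fin k)) (i j : Fin k), i ∉ S → j ∉ S → i ≠ j → ∀ u v : Ω → ℝ,
    P.Meas (insert i S) u → P.Meas (insert j S) v → ∀ x,
      |P.A S (u * v) x - P.A S u x * P.A S v x|
        ≤ ε * √(P.A S ((u - P.A S u) ^ 2) x * P.A S ((v - P.A S v) ^ 2) x)

/-- The averaging operators multiply, up to `κ` in operator norm, as in a product space. -/
def Near (κ : ℝ) : Prop :=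
  ∀ (S T : Finset (Fin k)) (f : Ω → ℝ),
    P.nrm (P.A S (P.A T f) - P.A (S ∩ T) f) ≤ κ * P.nrm f

variable {P}

lemma Pseudo.cov_single {ε : ℝ} (hP : P.Pseudo ε) (hε : 0 ≤ ε) {S : Finset (Fin k)} {i j : Fin k}
    (hi : i ∉ S) (hj : j ∉ S) (hij : i ≠ j) {u v : Ω → ℝ}
    (hu : P.Meas (insert i S) u) (hv : P.Meas (insert j S) v) :
    |P.E (u * v) - P.E (P.A S u * P.A S v)|
      ≤ ε * (P.nrm (u - P.A S u) * P.nrm (v - P.A S v)) := by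
  set a : Ω → ℝ := P.A S ((u - P.A S u) ^ 2) with ha
  set b : Ω → ℝ := P.A S ((v - P.A S v) ^ 2) with hb
  have ha0 : 0 ≤ a := P.A_nonneg S fun x => sq_nonneg _
  have hb0 : 0 ≤ b := P.A_nonneg S fun x => sq_nonneg _
  set r : Ω → ℝ := fun x => √(a x) with hr
  set s : Ω → ℝ := fun x => √(b x) with hs
  have hrn : P.nrm r = P.nrm (u - P.A S u) := by
    have : r ^ 2 = a := by ext x; simp [hr, Real.sq_sqrt (ha0 x)]
    rw [nrm, this, ha, P.E_A, nrm]
  have hsn : P.nrm s = P.nrm (v - P.A S v) := by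
    have : s ^ 2 = b := by ext x; simp [hs, Real.sq_sqrt (hb0 x)]
    rw [nrm, this, hb, P.E_A, nrm]
  have key : ∀ x, |(P.A S (u * v) - P.A S u * P.A S v) x| ≤ (ε • (r * s)) x := fun x => by
    have := hP S i j hi hj hij u v hu hv x
    rw [← ha, ← hb, Real.sqrt_mul (ha0 x)] at this
    exact this
  have h1 : P.E (P.A S (u * v) - P.A S u * P.A S v) ≤ P.E (ε • (r * s)) :=
    P.E_mono fun x => (abs_le.1 (key x)).2
  have h2 : P.E (-(ε • (r * s))) ≤ P.E (P.A S (u * v) - P.A S u * P.A S v) :=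
    P.E_mono fun x => (abs_le.1 (key x)).1
  rw [map_sub, P.E_A, map_smul, smul_eq_mul] at h1
  rw [map_neg, map_sub, P.E_A, map_smul, smul_eq_mul] at h2
  rw [← hrn, ← hsn]
  have h3 := mul_le_mul_of_nonneg_left ((le_abs_self _).trans (P.abs_E_mul_le r s)) hε
  exact abs_le.2 ⟨by linarith, by linarith⟩

variable (P) in
/-- The covariance splits, by conditioning on a further set `S'` of coordinates, into the average
conditional covariance and the covariance of the conditional expectations. -/
lemma cov_step {S S' : Finset (Fin k)} (hS : S ⊆ S') {u v : Ω → ℝ} {c₁ c₂ : ℝ}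
    (hc₁ : 0 ≤ c₁) (hc₂ : 0 ≤ c₂)
    (h₁ : |P.E (u * v) - P.E (P.A S' u * P.A S' v)|
      ≤ c₁ * (P.nrm (u - P.A S' u) * P.nrm (v - P.A S' v)))
    (h₂ : |P.E (P.A S' u * v) - P.E (P.A S (P.A S' u) * P.A S v)|
      ≤ c₂ * (P.nrm (P.A S' u - P.A S (P.A S' u)) * P.nrm (v - P.A S v))) :
    |P.E (u * v) - P.E (P.A S u * P.A S v)|
      ≤ (c₁ + c₂) * (P.nrm (u - P.A S u) * P.nrm (v - P.A S v)) := by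
  have e1 : P.E (P.A S' u * P.A S' v) = P.E (P.A S' u * v) := by
    rw [← P.E_A_mul, P.A_A_of_superset (subset_refl S')]
  rw [P.A_A_of_subset hS] at h₂
  rw [e1] at h₁
  have n1 := P.nrm_sub_A_le ((P.meas_A S u).mono hS) u
  have n2 := P.nrm_sub_A_le ((P.meas_A S v).mono hS) v
  have n3 : P.nrm (P.A S' u - P.A S u) ≤ P.nrm (u - P.A S u) := by
    have := P.nrm_A_le S' (u - P.A S u)
    rwa [map_sub, P.A_A_of_superset hS] at this
  have t1 := h₁.trans (mul_le_mul_of_nonneg_left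
    (mul_le_mul n1 n2 (P.nrm_nonneg _) (P.nrm_nonneg _)) hc₁)
  have t2 := h₂.trans (mul_le_mul_of_nonneg_left
    (mul_le_mul_of_nonneg_right n3 (P.nrm_nonneg _)) hc₂)
  have := abs_sub_le (P.E (u * v)) (P.E (P.A S' u * v)) (P.E (P.A S u * P.A S v))
  linarith

lemma Pseudo.cov_one {ε : ℝ} (hP : P.Pseudo ε) (hε : 0 ≤ ε) (i : Fin k) (B : Finset (Fin k)) :
    ∀ S : Finset (Fin k), i ∉ S → i ∉ B → Disjoint B S → ∀ u v : Ω → ℝ,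
      P.Meas (S ∪ {i}) u → P.Meas (S ∪ B) v →
      |P.E (u * v) - P.E (P.A S u * P.A S v)|
        ≤ (B.card * ε) * (P.nrm (u - P.A S u) * P.nrm (v - P.A S v)) := by
  induction B using Finset.induction_on with
  | empty =>
    intro S _ _ _ u v _ hv
    rw [union_empty] at hv
    rw [hv.A_eq, P.E_A_mul, hv.A_eq]
    simp
  | insert j B hj ih =>
    intro S hiS hiB hBS u v hu hv
    rw [mem_insert, not_or] at hiB
    rw [disjoint_insert_left] at hBS
    rw [mul_comm u v, mul_comm (P.A S u), mul_comm (P.nrm _)]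
    have hcard : ((insert j B).card * ε : ℝ) = B.card * ε + 1 * ε := by
      rw [card_insert_of_notMem hj]; push_cast; ring
    rw [hcard]
    refine P.cov_step (subset_insert j S) (by positivity) (by positivity) ?_ ?_
    · rw [mul_comm v u, mul_comm (P.A _ v), mul_comm (P.nrm _)]
      refine ih (insert j S) ?_ hiB.2 ?_ u v (hu.mono ?_) (hv.mono ?_)
      · simp [hiB.1, hiS]
      · rw [disjoint_insert_right]; exact ⟨hj, hBS.2⟩
      · exact union_subset_union (subset_insert _ _) subset_rfl
      · intro x; simp only [mem_union, mem_insert]; tauto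
    · rw [one_mul]
      refine hP.cov_single hε hBS.1 hiS (Ne.symm hiB.1) (P.meas_A _ v) (hu.mono ?_)
      intro x; simp only [mem_union, mem_insert, mem_singleton]; tauto

/-- Pseudorandomness of the two-dimensional skeletons of links propagates to functions of disjoint
sets of coordinates. -/
lemma Pseudo.cov {ε : ℝ} (hP : P.Pseudo ε) (hε : 0 ≤ ε) (B C : Finset (Fin k)) :
    ∀ S : Finset (Fin k), Disjoint B S → Disjoint C S → Disjoint B C → ∀ u v : Ω → ℝ,
      P.Meas (S ∪ B) u → P.Meas (S ∪ C) v →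
      |P.E (u * v) - P.E (P.A S u * P.A S v)|
        ≤ (B.card * (C.card * ε)) * (P.nrm (u - P.A S u) * P.nrm (v - P.A S v)) := by
  induction B using Finset.induction_on with
  | empty =>
    intro S _ _ _ u v hu _
    rw [union_empty] at hu
    rw [hu.A_eq, ← P.E_A_mul, hu.A_eq]
    simp
  | insert i B hi ih =>
    intro S hBS hCS hBC u v hu hv
    rw [disjoint_insert_left] at hBS hBC
    have hcard : ((insert i B).card * (C.card * ε) : ℝ) = B.card * (C.card * ε) + C.card * ε := by
      rw [card_insert_of_notMem hi]; push_cast; ring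
    rw [hcard]
    refine P.cov_step (subset_insert i S) (by positivity) (by positivity) ?_ ?_
    · refine ih (insert i S) ?_ ?_ hBC.2 u v (hu.mono ?_) (hv.mono ?_)
      · rw [disjoint_insert_right]; exact ⟨hi, hBS.2⟩
      · rw [disjoint_insert_right]; exact ⟨hBC.1, hCS⟩
      · intro x; simp only [mem_union, mem_insert]; tauto
      · exact union_subset_union (subset_insert _ _) subset_rfl
    · refine hP.cov_one hε i C S hBS.1 hBC.1 hCS _ v ((P.meas_A _ u).mono ?_) hv
      intro x; simp only [mem_union, mem_insert, mem_singleton]; tauto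

/-- The averaging operators almost multiply: `A_S A_T` is close to `A_{S ∩ T}`. -/
theorem Pseudo.near {ε : ℝ} (hP : P.Pseudo ε) (hε : 0 ≤ ε) : P.Near ((k : ℝ) ^ 2 * ε) := by
  intro S T f
  set g := P.A T f with hg
  set w := P.A S g - P.A (S ∩ T) f with hw
  have hTg : P.A (S ∩ T) g = P.A (S ∩ T) f := P.A_A_of_subset inter_subset_right f
  have hwS : P.Meas S w := (P.meas_A S g).sub ((P.meas_A _ f).mono inter_subset_left)
  have hw0 : P.A (S ∩ T) w = 0 := by
    rw [hw, map_sub, P.A_A_of_subset inter_subset_left, hTg, P.A_A_of_subset subset_rfl, sub_self]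
  have hcov := hP.cov hε (S \ T) (T \ S) (S ∩ T)
    (disjoint_left.2 fun x => by simp only [mem_sdiff, mem_inter]; tauto)
    (disjoint_left.2 fun x => by simp only [mem_sdiff, mem_inter]; tauto)
    (disjoint_left.2 fun x => by simp only [mem_sdiff]; tauto) w g
    (hwS.mono fun x => by simp only [mem_union, mem_inter, mem_sdiff]; tauto)
    ((P.meas_A T f).mono fun x => by simp only [mem_union, mem_inter, mem_sdiff]; tauto)
  rw [hw0, zero_mul, map_zero, sub_zero, sub_zero] at hcov
  have hww : P.nrm w ^ 2 = P.E (w * g) := by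
    have e1 : w ^ 2 = w * P.A S g - w * P.A (S ∩ T) f := by rw [← mul_sub, sq]
    rw [P.nrm_sq, e1, map_sub, ← P.E_A_mul S w g, ← P.E_A_mul (S ∩ T) w f, hwS.A_eq, hw0]
    simp
  have hgn : P.nrm (g - P.A (S ∩ T) g) ≤ P.nrm f := by
    have h0 : P.Meas (S ∩ T) 0 := fun _ _ _ => rfl
    have := P.nrm_sub_A_le h0 g
    rw [sub_zero] at this
    exact this.trans (P.nrm_A_le T f)
  have hc : ((S \ T).card * ((T \ S).card * ε) : ℝ) ≤ (k : ℝ) ^ 2 * ε := by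
    have h1 : ((S \ T).card : ℝ) ≤ k := by exact_mod_cast (card_le_univ _).trans_eq (by simp)
    have h2 : ((T \ S).card : ℝ) ≤ k := by exact_mod_cast (card_le_univ _).trans_eq (by simp)
    rw [← mul_assoc, sq]
    gcongr
  have h : P.nrm w * P.nrm w ≤ ((k : ℝ) ^ 2 * ε * P.nrm f) * P.nrm w := by
    calc P.nrm w * P.nrm w = P.E (w * g) := by rw [← sq, hww]
      _ ≤ _ := (le_abs_self _).trans hcov
      _ ≤ ((k : ℝ) ^ 2 * ε) * (P.nrm w * P.nrm f) :=
        mul_le_mul hc (mul_le_mul_of_nonneg_left hgn (P.nrm_nonneg _))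
          (mul_nonneg (P.nrm_nonneg _) (P.nrm_nonneg _)) (by positivity)
      _ = _ := by ring
  rcases (P.nrm_nonneg w).eq_or_lt with h0 | h0
  · rw [← h0]
    have := P.nrm_nonneg f
    positivity
  · exact le_of_mul_le_mul_right h h0

end CoordSpace
end EpsProduct
end

/-! ### Efron--Stein components -/

noncomputable section

namespace EpsProduct
namespace CoordSpace
open Finset

/-- The number of subsets of the set of coordinates; error terms are bounded by powers of it. -/
def N (k : ℕ) : ℝ := 2 ^ k

lemma one_le_N (k : ℕ) : 1 ≤ N k := one_le_pow₀ one_le_two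

lemma N_pos (k : ℕ) : 0 < N k := zero_lt_one.trans_le (one_le_N k)

variable {k : ℕ} {Ω : Type*} [Fintype Ω] (P : CoordSpace k Ω)

lemma card_le_N (s : Finset (Finset (Fin k))) : (s.card : ℝ) ≤ N k := by
  have : s.card ≤ 2 ^ k := s.card_le_univ.trans_eq (by simp)
  unfold N
  exact_mod_cast this

/-- The Efron--Stein component of `f` at `U` relative to `T`, that is, of the restrictions of `f`
to the fibres of the coordinates in `T`. For `T = ∅` this is the usual component. -/
def rcomp (T U : Finset (Fin k)) : (Ω → ℝ) →ₗ[ℝ] (Ω → ℝ) :=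
  ∑ V ∈ Icc T U, (-1 : ℝ) ^ (U \ V).card • P.A V

lemma rcomp_apply (T U : Finset (Fin k)) (f : Ω → ℝ) :
    P.rcomp T U f = ∑ V ∈ Icc T U, (-1 : ℝ) ^ (U \ V).card • P.A V f := by
  simp [rcomp, LinearMap.sum_apply]

/-- Inclusion-exclusion cancellation: pair `V` with `V ∆ {i}`. -/
lemma alternating_sum_eq_zero {M : Type*} [AddCommGroup M] [Module ℝ M] (φ : Finset (Fin k) → M)
    {T U W : Finset (Fin k)} {i : Fin k} (hiU : i ∈ U) (hiT : i ∉ T) (hiW : i ∉ W) :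
    ∑ V ∈ Icc T U, (-1 : ℝ) ^ (U \ V).card • φ (V ∩ W) = 0 := by
  have key : ∀ V : Finset (Fin k), i ∉ V → (-1 : ℝ) ^ (U \ V).card • φ (V ∩ W) +
      (-1 : ℝ) ^ (U \ insert i V).card • φ (insert i V ∩ W) = 0 := by
    intro V hV
    have h1 : U \ V = insert i (U \ insert i V) := by
      ext x; simp only [mem_sdiff, mem_insert]
      by_cases hx : x = i
      · subst hx; simp [hiU, hV]
      · simp [hx]
    have h2 : insert i V ∩ W = V ∩ W := by
      rw [insert_inter_of_notMem hiW]
    rw [h2, h1, card_insert_of_notMem (by simp), pow_succ]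
    simp
  refine sum_involution (fun V _ => if i ∈ V then V.erase i else insert i V) ?_ ?_ ?_ ?_
  · intro V _
    split_ifs with h
    · have := key (V.erase i) (by simp)
      rw [insert_erase h] at this
      rwa [add_comm]
    · exact key V h
  · intro V _ _
    split_ifs with h
    · exact fun he => (notMem_erase i V) (by rw [he]; exact h)
    · exact fun he => h (by rw [← he]; exact mem_insert_self i V)
  · intro V hV
    rw [mem_Icc] at hV ⊢
    split_ifs with h
    · exact ⟨fun x hx => mem_erase.2 ⟨fun e => hiT (e ▸ hx), hV.1 hx⟩,
        (erase_subset i V).trans hV.2⟩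
    · exact ⟨hV.1.trans (subset_insert i V), insert_subset hiU hV.2⟩
  · intro V _
    by_cases h : i ∈ V
    · simp [h]
    · simp [h]

lemma nrm_sign_smul (n : ℕ) (f : Ω → ℝ) : P.nrm ((-1 : ℝ) ^ n • f) = P.nrm f := by
  rw [nrm_smul, abs_pow, abs_neg, abs_one, one_pow, one_mul]

lemma nrm_rcomp_le (T U : Finset (Fin k)) (f : Ω → ℝ) : P.nrm (P.rcomp T U f) ≤ N k * P.nrm f := by
  rw [rcomp_apply]
  refine P.nrm_sum_le_card _ _ (P.nrm_nonneg f) (card_le_N _) fun V _ => ?_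
  rw [nrm_sign_smul]
  exact P.nrm_A_le V f

lemma abs_rcomp_le {T U : Finset (Fin k)} {f : Ω → ℝ} {c : ℝ} (hc : 0 ≤ c)
    (h : ∀ V, T ⊆ V → V ⊆ U → ∀ x, |P.A V f x| ≤ c) (x : Ω) : |P.rcomp T U f x| ≤ N k * c := by
  rw [rcomp_apply, Finset.sum_apply]
  refine (abs_sum_le_sum_abs _ _).trans ((sum_le_card_nsmul _ _ c fun V hV => ?_).trans ?_)
  · rw [Pi.smul_apply, smul_eq_mul, abs_mul, abs_pow, abs_neg, abs_one, one_pow, one_mul]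
    rw [mem_Icc] at hV
    exact h V hV.1 hV.2 x
  · rw [nsmul_eq_mul]
    exact mul_le_mul_of_nonneg_right (card_le_N _) hc

lemma meas_rcomp (T U : Finset (Fin k)) (f : Ω → ℝ) : P.Meas U (P.rcomp T U f) := by
  rw [rcomp_apply]
  exact Meas.sum fun V hV => ((P.meas_A V f).mono (mem_Icc.1 hV).2).smul _

variable {P}

lemma Near.nrm_A_rcomp_le {κ : ℝ} (hP : P.Near κ) (hκ : 0 ≤ κ) {T U W : Finset (Fin k)} {i : Fin k}
    (hiU : i ∈ U) (hiT : i ∉ T) (hiW : i ∉ W) (f : Ω → ℝ) :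
    P.nrm (P.A W (P.rcomp T U f)) ≤ N k * (κ * P.nrm f) := by
  have h0 := alternating_sum_eq_zero (fun V => P.A V f) hiU hiT hiW
  rw [rcomp_apply, map_sum, ← sub_zero (∑ V ∈ _, _), ← h0, ← sum_sub_distrib]
  refine P.nrm_sum_le_card _ _ (mul_nonneg hκ (P.nrm_nonneg f)) (card_le_N _) fun V _ => ?_
  rw [map_smul, ← smul_sub, nrm_sign_smul, inter_comm]
  exact hP W V f

lemma Near.nrm_rcomp_le_of_meas {κ : ℝ} (hP : P.Near κ) (hκ : 0 ≤ κ) {T U W : Finset (Fin k)}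
    {i : Fin k} (hiU : i ∈ U) (hiT : i ∉ T) (hiW : i ∉ W) {f : Ω → ℝ} (hf : P.Meas W f) :
    P.nrm (P.rcomp T U f) ≤ N k * (κ * P.nrm f) := by
  have h0 := alternating_sum_eq_zero (fun V => P.A V f) hiU hiT hiW
  rw [rcomp_apply, ← sub_zero (∑ V ∈ _, _), ← h0, ← sum_sub_distrib]
  refine P.nrm_sum_le_card _ _ (mul_nonneg hκ (P.nrm_nonneg f)) (card_le_N _) fun V _ => ?_
  rw [← smul_sub, nrm_sign_smul]
  have := hP V W f
  rwa [hf.A_eq] at this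

/-- Different Efron--Stein components are almost orthogonal. -/
lemma Near.abs_E_rcomp_mul_rcomp_le {κ : ℝ} (hP : P.Near κ) (hκ : 0 ≤ κ) {T U U' : Finset (Fin k)}
    (hU : T ⊆ U) (hU' : T ⊆ U') (hne : U ≠ U') (f : Ω → ℝ) :
    |P.E (P.rcomp T U f * P.rcomp T U' f)| ≤ N k ^ 2 * κ * P.nrm f ^ 2 := by
  wlog h : ¬ U ⊆ U' generalizing U U'
  · rw [mul_comm]
    exact this hU' hU hne.symm fun h' => hne (subset_antisymm (not_not.1 h) h')
  obtain ⟨i, hi, hi'⟩ := not_subset.1 h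
  have hiT : i ∉ T := fun h => hi' (hU' h)
  rw [← (P.meas_rcomp T U' f).A_eq, ← P.E_A_mul]
  have h1 := hP.nrm_A_rcomp_le hκ hi hiT hi' f
  have h2 := P.nrm_rcomp_le T U' f
  calc _ ≤ _ := P.abs_E_mul_le _ _
    _ ≤ (N k * (κ * P.nrm f)) * (N k * P.nrm f) :=
      mul_le_mul h1 h2 (P.nrm_nonneg _) ((P.nrm_nonneg _).trans h1)
    _ = _ := by ring

lemma E_sum_sq {ι : Type*} [DecidableEq ι] (s : Finset ι) (F : ι → Ω → ℝ) :
    P.E ((∑ i ∈ s, F i) ^ 2) = ∑ i ∈ s, P.E (F i ^ 2) +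
      ∑ p ∈ s.offDiag, P.E (F p.1 * F p.2) := by
  rw [sq, sum_mul_sum, ← sum_product', map_sum, ← diag_union_offDiag,
    sum_union (disjoint_diag_offDiag s), sum_diag]
  simp only [sq]

lemma card_offDiag_le (s : Finset (Finset (Fin k))) : (s.offDiag.card : ℝ) ≤ N k ^ 2 := by
  have h1 : s.offDiag.card ≤ s.card * s.card := by rw [offDiag_card]; omega
  have h2 : (s.offDiag.card : ℝ) ≤ s.card * s.card := by exact_mod_cast h1
  have := card_le_N s
  rw [sq]
  exact h2.trans (mul_le_mul this this (Nat.cast_nonneg _) (N_pos k).le)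

lemma Near.abs_nrm_sum_rcomp_sq_sub_le {κ : ℝ} (hP : P.Near κ) (hκ : 0 ≤ κ) {T : Finset (Fin k)}
    {s : Finset (Finset (Fin k))} (hs : ∀ U ∈ s, T ⊆ U) (f : Ω → ℝ) :
    |P.nrm (∑ U ∈ s, P.rcomp T U f) ^ 2 - ∑ U ∈ s, P.nrm (P.rcomp T U f) ^ 2|
      ≤ N k ^ 4 * κ * P.nrm f ^ 2 := by
  simp only [nrm_sq]
  rw [E_sum_sq, add_sub_cancel_left]
  refine (abs_sum_le_sum_abs _ _).trans ((sum_le_card_nsmul _ _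
    (N k ^ 2 * κ * P.nrm f ^ 2) fun p hp => ?_).trans ?_)
  · rw [mem_offDiag] at hp
    exact hP.abs_E_rcomp_mul_rcomp_le hκ (hs _ hp.1) (hs _ hp.2.1) hp.2.2 f
  · rw [nsmul_eq_mul, ← nrm_sq]
    calc _ ≤ N k ^ 2 * (N k ^ 2 * κ * P.nrm f ^ 2) :=
          mul_le_mul_of_nonneg_right (card_offDiag_le s) (by have := N_pos k; positivity)
      _ = _ := by ring

variable (P)

/-- Möbius inversion: a function is the sum of its (relative) Efron--Stein components. -/
lemma sum_rcomp (T : Finset (Fin k)) (f : Ω → ℝ) : ∑ U ∈ Icc T univ, P.rcomp T U f = f := by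
  simp only [rcomp_apply]
  have hswap : ∑ U ∈ Icc T univ, ∑ V ∈ Icc T U, (-1 : ℝ) ^ (U \ V).card • P.A V f =
      ∑ V ∈ Icc T univ, ∑ U ∈ Icc V univ, (-1 : ℝ) ^ (U \ V).card • P.A V f := by
    refine sum_comm' fun U V => ?_
    simp only [mem_Icc, subset_univ, and_true]
    exact ⟨fun h => ⟨h.2.2, h.2.1⟩, fun h => ⟨h.2.trans h.1, h.2, h.1⟩⟩
  rw [hswap, sum_eq_single univ]
  · simp [P.A_univ]
  · intro V _ hV
    obtain ⟨i, hi⟩ : ∃ i, i ∉ V := by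
      by_contra h
      push Not at h
      exact hV (eq_univ_of_forall h)
    have h0 := alternating_sum_eq_zero (fun _ => (1 : ℝ)) (mem_univ i) hi (notMem_empty i)
    have h1 : ∀ U ∈ Icc V univ, (-1 : ℝ) ^ (U \ V).card
        = (-1) ^ (univ \ V).card * ((-1 : ℝ) ^ (univ \ U).card • 1) := by
      intro U hU
      have hVU : V ⊆ U := (mem_Icc.1 hU).1
      have h2 : (univ \ V).card = (univ \ U).card + (U \ V).card := by
        rw [← card_union_of_disjoint]
        · congr 1
          ext x
          simp only [mem_sdiff, mem_univ, true_and, mem_union]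
          have := @hVU x
          tauto
        · exact disjoint_left.2 fun x => by simp only [mem_sdiff]; tauto
      rw [h2, pow_add, smul_eq_mul, mul_one]
      have h3 : ((-1 : ℝ) ^ (univ \ U).card) * (-1) ^ (univ \ U).card = 1 := by
        rw [← mul_pow]; simp
      linear_combination (-(-1 : ℝ) ^ (U \ V).card) * h3
    rw [← sum_smul, sum_congr rfl h1, ← mul_sum, h0]
    simp
  · simp

variable {P}

lemma Near.abs_nrm_sq_sub_le {κ : ℝ} (hP : P.Near κ) (hκ : 0 ≤ κ) (T : Finset (Fin k))
    (f : Ω → ℝ) :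
    |P.nrm f ^ 2 - ∑ U ∈ Icc T univ, P.nrm (P.rcomp T U f) ^ 2| ≤ N k ^ 4 * κ * P.nrm f ^ 2 := by
  have := hP.abs_nrm_sum_rcomp_sq_sub_le hκ (s := Icc T univ) (fun U hU => (mem_Icc.1 hU).1) f
  rwa [sum_rcomp] at this

/-- The relative Bessel inequality, up to a factor `1 + O(κ)`, in conditional form. -/
lemma Near.sum_A_rcomp_sq_le {κ : ℝ} (hP : P.Near κ) (hκ : 0 ≤ κ) (T : Finset (Fin k))
    (f : Ω → ℝ) (x : Ω) :
    ∑ U ∈ Icc T univ, P.A T (P.rcomp T U f ^ 2) x ≤ (1 + N k ^ 4 * κ) * P.A T (f ^ 2) x := by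
  classical
  -- localize the global inequality by multiplying `f` with the indicator of the fibre of `x`
  set g : Ω → ℝ := fun y => if P.Rel T x y then 1 else 0 with hg
  have hgm : P.Meas T g := fun y z h => by
    simp only [hg]
    exact if_congr ⟨fun h' => h'.trans h, fun h' => h'.trans h.symm⟩ rfl rfl
  have hloc : ∀ u : Ω → ℝ, P.nrm (g * u) ^ 2 = P.mass T x * P.A T (u ^ 2) x := by
    intro u
    rw [P.nrm_sq, E_apply, A_apply, mul_sum]
    refine sum_congr rfl fun y _ => ?_
    have := (P.mass_pos T x).ne'
    by_cases h : P.Rel T x y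
    · simp only [hg, ker, h, if_true, Pi.pow_apply, Pi.mul_apply]
      field_simp
    · simp [hg, ker, h]
  have hr : ∀ U ∈ Icc T univ, P.rcomp T U (g * f) = g * P.rcomp T U f := by
    intro U _
    simp only [rcomp_apply, mul_sum]
    refine sum_congr rfl fun V hV => ?_
    rw [(hgm.mono (mem_Icc.1 hV).1).A_mul, mul_smul_comm]
  have h := (abs_le.1 (hP.abs_nrm_sq_sub_le hκ T (g * f))).1
  rw [sum_congr rfl (fun U hU => by rw [hr U hU, hloc]), hloc, ← mul_sum] at h
  refine le_of_mul_le_mul_left ?_ (P.mass_pos T x)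
  linarith

variable (P)

/-- The Efron--Stein component of `f` at `U`. -/
abbrev comp (U : Finset (Fin k)) : (Ω → ℝ) →ₗ[ℝ] (Ω → ℝ) := P.rcomp ∅ U

/-- The part of `f` of degree at most `d`. -/
def low (d : ℕ) (f : Ω → ℝ) : Ω → ℝ := ∑ U : Finset (Fin k) with U.card ≤ d, P.comp U f

variable {P}

lemma Near.abs_nrm_sq_sub_sum_comp_le {κ : ℝ} (hP : P.Near κ) (hκ : 0 ≤ κ) (f : Ω → ℝ) :
    |P.nrm f ^ 2 - ∑ U, P.nrm (P.comp U f) ^ 2| ≤ N k ^ 4 * κ * P.nrm f ^ 2 := by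
  have := hP.abs_nrm_sq_sub_le hκ ∅ f
  rwa [show Icc (∅ : Finset (Fin k)) univ = univ from by ext; simp] at this

lemma Near.nrm_low_sq_le {κ : ℝ} (hP : P.Near κ) (hκ : 0 ≤ κ) (d : ℕ) (f : Ω → ℝ) :
    P.nrm (P.low d f) ^ 2 ≤ (1 + 2 * (N k ^ 4 * κ)) * P.nrm f ^ 2 := by
  have h1 := (abs_le.1 (hP.abs_nrm_sum_rcomp_sq_sub_le hκ (T := ∅)
    (s := {U : Finset (Fin k) | U.card ≤ d}) (fun U _ => empty_subset U) f)).2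
  have h2 := (abs_le.1 (hP.abs_nrm_sq_sub_sum_comp_le hκ f)).1
  have h3 : ∑ U : Finset (Fin k) with U.card ≤ d, P.nrm (P.comp U f) ^ 2
      ≤ ∑ U, P.nrm (P.comp U f) ^ 2 :=
    sum_le_sum_of_subset_of_nonneg (subset_univ _) fun U _ _ => sq_nonneg _
  unfold low
  linarith

lemma Near.nrm_comp_sq_le {κ : ℝ} (hP : P.Near κ) (hκ : 0 ≤ κ) (S : Finset (Fin k)) (f : Ω → ℝ) :
    P.nrm (P.comp S f) ^ 2 ≤ (1 + N k ^ 4 * κ) * P.nrm (P.A S f) ^ 2 := by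
  have h1 : P.comp S f = P.comp S (P.A S f) := by
    simp only [comp, rcomp_apply]
    exact sum_congr rfl fun V hV => by rw [P.A_A_of_subset (mem_Icc.1 hV).2]
  have h2 := (abs_le.1 (hP.abs_nrm_sq_sub_sum_comp_le hκ (P.A S f))).1
  have h3 := single_le_sum (f := fun U => P.nrm (P.comp U (P.A S f)) ^ 2)
    (fun U _ => sq_nonneg _) (mem_univ S)
  rw [h1]
  linarith

lemma Near.nrm_comp_comp_le {κ : ℝ} (hP : P.Near κ) (hκ : 0 ≤ κ) {U U' : Finset (Fin k)}
    (h : U ≠ U') (f : Ω → ℝ) : P.nrm (P.comp U (P.comp U' f)) ≤ N k ^ 2 * κ * P.nrm f := by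
  by_cases hs : U ⊆ U'
  · obtain ⟨i, hi', hi⟩ := not_subset.1 fun h' => h (subset_antisymm hs h')
    unfold comp
    rw [P.rcomp_apply ∅ U]
    refine (P.nrm_sum_le_card _ _ (c := N k * (κ * P.nrm f)) ?_ (card_le_N _)
      fun V hV => ?_).trans_eq (by ring)
    · have := N_pos k
      have := P.nrm_nonneg f
      positivity
    · rw [nrm_sign_smul]
      exact hP.nrm_A_rcomp_le hκ hi' (notMem_empty i) (fun hiV => hi ((mem_Icc.1 hV).2 hiV)) f
  · obtain ⟨i, hi, hi'⟩ := not_subset.1 hs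
    refine (hP.nrm_rcomp_le_of_meas hκ hi (notMem_empty i) hi' (P.meas_rcomp ∅ U' f)).trans ?_
    calc _ ≤ N k * (κ * (N k * P.nrm f)) := by
          have := N_pos k
          gcongr
          exact P.nrm_rcomp_le ∅ U' f
      _ = _ := by ring

lemma Near.nrm_comp_self_sub_le {κ : ℝ} (hP : P.Near κ) (hκ : 0 ≤ κ) (U : Finset (Fin k))
    (f : Ω → ℝ) : P.nrm (P.comp U (P.comp U f) - P.comp U f) ≤ N k ^ 2 * κ * P.nrm f := by
  have h1 : P.comp U (P.comp U f) - P.comp U f =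
      ∑ V ∈ (Icc ∅ U).erase U, (-1 : ℝ) ^ (U \ V).card • P.A V (P.comp U f) := by
    conv_lhs => unfold comp
    rw [P.rcomp_apply ∅ U (P.rcomp ∅ U f), ← sum_erase_add _ _ (a := U) (by simp),
      (P.meas_rcomp ∅ U f).A_eq]
    simp
  rw [h1]
  refine (P.nrm_sum_le_card _ _ (c := N k * (κ * P.nrm f)) ?_ (card_le_N _)
      fun V hV => ?_).trans_eq (by ring)
  · have := N_pos k
    have := P.nrm_nonneg f
    positivity
  · rw [nrm_sign_smul]
    rw [mem_erase, mem_Icc] at hV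
    obtain ⟨i, hi', hi⟩ := not_subset.1 fun h' => hV.1 (subset_antisymm hV.2.2 h')
    exact hP.nrm_A_rcomp_le hκ hi' (notMem_empty i) hi f

/-- Taking the low degree part hardly changes the components of low degree. -/
lemma Near.nrm_comp_low_sub_le {κ : ℝ} (hP : P.Near κ) (hκ : 0 ≤ κ) {d : ℕ} {U : Finset (Fin k)}
    (hU : U.card ≤ d) (f : Ω → ℝ) :
    P.nrm (P.comp U (P.low d f) - P.comp U f) ≤ N k ^ 3 * κ * P.nrm f := by
  have hU' : U ∈ ({U : Finset (Fin k) | U.card ≤ d} : Finset _) := by simpa using hU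
  have h1 : P.comp U (P.low d f) - P.comp U f = ∑ U' : Finset (Fin k) with U'.card ≤ d,
      (if U' = U then P.comp U (P.comp U f) - P.comp U f else P.comp U (P.comp U' f)) := by
    rw [low, map_sum, ← sum_erase_add _ _ hU', ← sum_erase_add _ _ hU', if_pos rfl, add_sub_assoc]
    congr 1
    exact sum_congr rfl fun U' h => by rw [if_neg (ne_of_mem_erase h)]
  rw [h1]
  refine (P.nrm_sum_le_card _ _ (c := N k ^ 2 * κ * P.nrm f) ?_ (card_le_N _)
      fun V hV => ?_).trans_eq (by ring)
  · have := N_pos k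
    have := P.nrm_nonneg f
    positivity
  · split_ifs with h
    · exact hP.nrm_comp_self_sub_le hκ U f
    · exact hP.nrm_comp_comp_le hκ (Ne.symm h) f

end CoordSpace
end EpsProduct
end

/-! ### Global functions and fourth moments of components -/

noncomputable section

namespace EpsProduct
namespace CoordSpace
open Finset

variable {k : ℕ} {Ω : Type*} [Fintype Ω] (P : CoordSpace k Ω)

/-- `f` is `(d, δ)`-global: its conditional second moments given at most `d` coordinates are at
most `δ²`. -/
def Glob (d : ℕ) (δ : ℝ) (f : Ω → ℝ) : Prop :=
  ∀ S : Finset (Fin k), S.card ≤ d → ∀ x, P.A S (f ^ 2) x ≤ δ ^ 2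

variable {P}
variable {d : ℕ} {δ κ : ℝ} {f : Ω → ℝ}

lemma Glob.abs_A_le (hf : P.Glob d δ f) (hδ : 0 ≤ δ) {S : Finset (Fin k)} (hS : S.card ≤ d)
    (x : Ω) : |P.A S f x| ≤ δ :=
  abs_le_of_sq_le_sq ((P.A_sq_le S f x).trans (hf S hS x)) hδ

lemma Glob.abs_rcomp_le (hf : P.Glob d δ f) (hδ : 0 ≤ δ) (T : Finset (Fin k))
    {U : Finset (Fin k)} (hU : U.card ≤ d) (x : Ω) : |P.rcomp T U f x| ≤ N k * δ :=
  P.abs_rcomp_le hδ (fun _ _ hV => hf.abs_A_le hδ ((card_le_card hV).trans hU)) x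

lemma Glob.abs_low_le (hf : P.Glob d δ f) (hδ : 0 ≤ δ) (x : Ω) : |P.low d f x| ≤ N k ^ 2 * δ := by
  have hN := N_pos k
  rw [low, Finset.sum_apply]
  refine (abs_sum_le_sum_abs _ _).trans ((sum_le_card_nsmul _ _ (N k * δ) fun U hU => ?_).trans ?_)
  · exact hf.abs_rcomp_le hδ ∅ (mem_filter.1 hU).2 x
  · rw [nsmul_eq_mul, sq, mul_assoc]
    exact mul_le_mul_of_nonneg_right (card_le_N _) (by positivity)

lemma Glob.nrm_comp_mul_comp_le (hf : P.Glob d δ f) (hδ : 0 ≤ δ) {U : Finset (Fin k)}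
    (hU : U.card ≤ d) (U' : Finset (Fin k)) :
    P.nrm (P.comp U f * P.comp U' f) ≤ N k ^ 2 * (δ * P.nrm f) := by
  have hN := N_pos k
  calc _ ≤ N k * δ * P.nrm (P.comp U' f) := P.nrm_mul_le (hf.abs_rcomp_le hδ ∅ hU) _
    _ ≤ N k * δ * (N k * P.nrm f) := by gcongr; exact P.nrm_rcomp_le ∅ U' f
    _ = _ := by ring

/-- If `i ∈ U`, `i ∉ U'`, `i ∉ T`, averaging out the coordinate `i` almost kills the first factor
and fixes the second. -/
lemma Glob.nrm_A_mul_le (hf : P.Glob d δ f) (hδ : 0 ≤ δ) (hP : P.Near κ) (hκ : 0 ≤ κ)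
    {U U' T : Finset (Fin k)} {i : Fin k} (hi : i ∈ U) (hi' : i ∉ U') (hiT : i ∉ T)
    (hU' : U'.card ≤ d) :
    P.nrm (P.A T (P.comp U f * P.comp U' f)) ≤ N k ^ 2 * (κ * δ * P.nrm f) := by
  have hN := N_pos k
  have h1 : P.A (univ.erase i) (P.comp U f * P.comp U' f)
      = P.comp U' f * P.A (univ.erase i) (P.comp U f) := by
    rw [mul_comm, Meas.A_mul]
    exact (P.meas_rcomp ∅ U' f).mono fun j hj => by
      rw [mem_erase]; exact ⟨fun h => hi' (h ▸ hj), mem_univ j⟩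
  have h2 : T ⊆ univ.erase i := fun j hj => by
    rw [mem_erase]; exact ⟨fun h => hiT (h ▸ hj), mem_univ j⟩
  rw [← P.A_A_of_subset h2, h1]
  calc _ ≤ _ := P.nrm_A_le _ _
    _ ≤ N k * δ * P.nrm (P.A (univ.erase i) (P.comp U f)) :=
      P.nrm_mul_le (hf.abs_rcomp_le hδ ∅ hU') _
    _ ≤ N k * δ * (N k * (κ * P.nrm f)) := by
      gcongr
      exact hP.nrm_A_rcomp_le hκ hi (notMem_empty i) (notMem_erase i _) f
    _ = _ := by ring

lemma Glob.nrm_comp_mul_le_of_mem (hf : P.Glob d δ f) (hδ : 0 ≤ δ) (hP : P.Near κ) (hκ : 0 ≤ κ)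
    {U U' S : Finset (Fin k)} {i : Fin k} (hi : i ∈ U) (hi' : i ∉ U') (hiS : i ∉ S)
    (hU' : U'.card ≤ d) :
    P.nrm (P.comp S (P.comp U f * P.comp U' f)) ≤ N k ^ 3 * (κ * δ * P.nrm f) := by
  have hN := N_pos k
  have := P.nrm_nonneg f
  rw [comp, rcomp_apply]
  refine (P.nrm_sum_le_card _ _ (c := N k ^ 2 * (κ * δ * P.nrm f)) (by positivity) (card_le_N _)
    fun V hV => ?_).trans_eq (by ring)
  rw [nrm_sign_smul]
  exact hf.nrm_A_mul_le hδ hP hκ hi hi' (fun h => hiS ((mem_Icc.1 hV).2 h)) hU'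

lemma Glob.nrm_comp_mul_le_of_notMem (hf : P.Glob d δ f) (hδ : 0 ≤ δ) (hP : P.Near κ) (hκ : 0 ≤ κ)
    {U U' S : Finset (Fin k)} {i : Fin k} (hi : i ∈ S) (hiU : i ∉ U) (hiU' : i ∉ U')
    (hU : U.card ≤ d) :
    P.nrm (P.comp S (P.comp U f * P.comp U' f)) ≤ N k ^ 3 * (κ * δ * P.nrm f) := by
  have hN := N_pos k
  have hm : P.Meas (U ∪ U') (P.comp U f * P.comp U' f) :=
    ((P.meas_rcomp ∅ U f).mono subset_union_left).mul
      ((P.meas_rcomp ∅ U' f).mono subset_union_right)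
  refine (hP.nrm_rcomp_le_of_meas hκ hi (notMem_empty i) (by simp [hiU, hiU']) hm).trans ?_
  calc _ ≤ N k * (κ * (N k ^ 2 * (δ * P.nrm f))) := by
        gcongr
        exact hf.nrm_comp_mul_comp_le hδ hU U'
    _ = _ := by ring

/-- The components of the square of `h = ∑ f^{=U}` at `S` come essentially from the pairs
`(U, U')` with `U ∆ U' ⊆ S ⊆ U ∪ U'`. -/
lemma Glob.nrm_comp_mul_le (hf : P.Glob d δ f) (hδ : 0 ≤ δ) (hP : P.Near κ) (hκ : 0 ≤ κ)
    {U U' S : Finset (Fin k)} (hU : U.card ≤ d) (hU' : U'.card ≤ d)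
    (h : ¬ (U \ S = U' \ S ∧ U ∩ S ∪ U' ∩ S = S)) :
    P.nrm (P.comp S (P.comp U f * P.comp U' f)) ≤ N k ^ 3 * (κ * δ * P.nrm f) := by
  by_cases h1 : ∃ i, i ∈ U ∧ i ∉ U' ∧ i ∉ S
  · obtain ⟨i, hi, hi', hiS⟩ := h1
    exact hf.nrm_comp_mul_le_of_mem hδ hP hκ hi hi' hiS hU'
  by_cases h2 : ∃ i, i ∈ U' ∧ i ∉ U ∧ i ∉ S
  · obtain ⟨i, hi, hi', hiS⟩ := h2
    rw [mul_comm]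
    exact hf.nrm_comp_mul_le_of_mem hδ hP hκ hi hi' hiS hU
  by_cases h3 : ∃ i, i ∈ S ∧ i ∉ U ∧ i ∉ U'
  · obtain ⟨i, hi, hi', hiS⟩ := h3
    exact hf.nrm_comp_mul_le_of_notMem hδ hP hκ hi hi' hiS hU
  · push Not at h1 h2 h3
    refine absurd ⟨?_, ?_⟩ h
    · ext i
      have := h1 i
      have := h2 i
      simp only [mem_sdiff]
      tauto
    · ext i
      have := h3 i
      simp only [mem_union, mem_inter]
      tauto

variable (P) in
lemma E_A_pow_four_le (S : Finset (Fin k)) (f : Ω → ℝ) : P.E (P.A S f ^ 4) ≤ P.E (f ^ 4) := by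
  rw [← P.E_A S (f ^ 4)]
  refine P.E_mono fun x => ?_
  have h1 := P.A_sq_le S f x
  have h2 := P.A_sq_le S (f ^ 2) x
  rw [show (f ^ 2) ^ 2 = f ^ 4 from by ring] at h2
  simp only [Pi.pow_apply] at h1 h2 ⊢
  calc (P.A S f x) ^ 4 = ((P.A S f x) ^ 2) ^ 2 := by ring
    _ ≤ (P.A S (f ^ 2) x) ^ 2 := by gcongr
    _ ≤ _ := h2

lemma sum_pow_four_le {ι : Type*} (s : Finset ι) (a : ι → ℝ) {n : ℝ} (hn : (s.card : ℝ) ≤ n) :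
    (∑ i ∈ s, a i) ^ 4 ≤ n ^ 3 * ∑ i ∈ s, a i ^ 4 := by
  have h1 := sq_sum_le_card_mul_sum_sq (s := s) (f := a)
  have h2 := sq_sum_le_card_mul_sum_sq (s := s) (f := fun i => a i ^ 2)
  have h0 : (0 : ℝ) ≤ s.card := Nat.cast_nonneg _
  have h4 : 0 ≤ ∑ i ∈ s, a i ^ 4 := sum_nonneg fun i _ => by positivity
  have e : ∑ i ∈ s, (a i ^ 2) ^ 2 = ∑ i ∈ s, a i ^ 4 := sum_congr rfl fun i _ => by ring
  rw [e] at h2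
  calc (∑ i ∈ s, a i) ^ 4 = ((∑ i ∈ s, a i) ^ 2) ^ 2 := by ring
    _ ≤ (s.card * ∑ i ∈ s, a i ^ 2) ^ 2 := by gcongr
    _ = s.card ^ 2 * (∑ i ∈ s, a i ^ 2) ^ 2 := by ring
    _ ≤ s.card ^ 2 * (s.card * ∑ i ∈ s, a i ^ 4) := by gcongr
    _ = s.card ^ 3 * ∑ i ∈ s, a i ^ 4 := by ring
    _ ≤ n ^ 3 * ∑ i ∈ s, a i ^ 4 := by gcongr

variable (P) in
lemma E_comp_pow_four_le (U : Finset (Fin k)) (f : Ω → ℝ) :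
    P.E (P.comp U f ^ 4) ≤ N k ^ 4 * P.E (f ^ 4) := by
  have h1 : P.comp U f ^ 4 ≤ N k ^ 3 • ∑ V ∈ Icc ∅ U, P.A V f ^ 4 := fun x => by
    have := sum_pow_four_le (Icc ∅ U) (fun V => (-1 : ℝ) ^ (U \ V).card * P.A V f x) (card_le_N _)
    have e : ∀ V : Finset (Fin k), ((-1 : ℝ) ^ (U \ V).card * P.A V f x) ^ 4 = P.A V f x ^ 4 :=
      fun V => by
        rw [mul_pow, ← pow_mul, mul_comm _ 4, pow_mul]; norm_num
    simp only [e] at this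
    rw [comp, rcomp_apply]
    simpa [Finset.sum_apply] using this
  have hN := N_pos k
  have h4 : 0 ≤ P.E (f ^ 4) := P.E_nonneg fun x => by simp only [Pi.pow_apply]; positivity
  refine (P.E_mono h1).trans ?_
  rw [map_smul, map_sum, smul_eq_mul]
  calc _ ≤ N k ^ 3 * ((Icc ∅ U).card • P.E (f ^ 4)) := by
        gcongr
        exact sum_le_card_nsmul _ _ _ fun V _ => P.E_A_pow_four_le V f
    _ ≤ N k ^ 3 * (N k * P.E (f ^ 4)) := by
        rw [nsmul_eq_mul]
        gcongr
        exact card_le_N _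
    _ = _ := by ring

/-- The fourth moments of the low degree components of `f` are controlled by that of `f^{≤ d}`. -/
lemma Glob.E_comp_pow_four_le (hf : P.Glob d δ f) (hδ : 0 ≤ δ) (hP : P.Near κ) (hκ : 0 ≤ κ)
    {U : Finset (Fin k)} (hU : U.card ≤ d) :
    P.E (P.comp U f ^ 4) ≤ 8 * N k ^ 4 * P.E (P.low d f ^ 4)
      + 32 * N k ^ 12 * (κ * δ * P.nrm f) ^ 2 := by
  have hN := N_pos k
  set e := P.comp U (P.low d f) - P.comp U f with he
  have hb : ∀ x, |e x| ≤ 2 * N k ^ 3 * δ := fun x => by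
    have h1 := P.abs_rcomp_le (T := ∅) (U := U) (f := P.low d f) (c := N k ^ 2 * δ) (by positivity)
      (fun V _ _ => P.abs_A_le_const V (hf.abs_low_le hδ)) x
    have h2 := hf.abs_rcomp_le hδ ∅ hU x
    have h3 : N k * δ ≤ N k ^ 3 * δ := by
      gcongr
      exact le_self_pow₀ (one_le_N k) (by norm_num)
    calc |e x| ≤ |P.comp U (P.low d f) x| + |P.comp U f x| := abs_sub _ _
      _ ≤ N k * (N k ^ 2 * δ) + N k ^ 3 * δ := add_le_add h1 (h2.trans h3)
      _ = _ := by ring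
  have h4 : P.E (e ^ 4) ≤ (2 * N k ^ 3 * δ) ^ 2 * P.E (e ^ 2) := by
    rw [← smul_eq_mul, ← map_smul]
    refine P.E_mono fun x => ?_
    have : e x ^ 2 ≤ (2 * N k ^ 3 * δ) ^ 2 := sq_le_sq' (abs_le.1 (hb x)).1 (abs_le.1 (hb x)).2
    simp only [Pi.pow_apply, Pi.smul_apply, smul_eq_mul]
    calc e x ^ 4 = e x ^ 2 * e x ^ 2 := by ring
      _ ≤ _ := by gcongr
  have h5 : P.E (e ^ 2) ≤ (N k ^ 3 * κ * P.nrm f) ^ 2 := by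
    rw [← P.nrm_sq]
    exact pow_le_pow_left₀ (P.nrm_nonneg _) (hP.nrm_comp_low_sub_le hκ hU f) 2
  have h6 : P.comp U f ^ 4 ≤ (8 : ℝ) • (P.comp U (P.low d f) ^ 4 + e ^ 4) := fun x => by
    have : P.comp U f x = P.comp U (P.low d f) x - e x := by simp [he]
    simp only [Pi.pow_apply, Pi.smul_apply, Pi.add_apply, smul_eq_mul, this]
    generalize P.comp U (P.low d f) x = a
    generalize e x = b
    have h7 : (a - b) ^ 2 ≤ 2 * (a ^ 2 + b ^ 2) := by nlinarith [sq_nonneg (a + b)]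
    calc (a - b) ^ 4 = ((a - b) ^ 2) ^ 2 := by ring
      _ ≤ (2 * (a ^ 2 + b ^ 2)) ^ 2 := by gcongr
      _ ≤ 8 * (a ^ 4 + b ^ 4) := by nlinarith [sq_nonneg (a ^ 2 - b ^ 2)]
  have h8 := P.E_mono h6
  rw [map_smul, map_add, smul_eq_mul] at h8
  have h9 := P.E_comp_pow_four_le U (P.low d f)
  have h10 : (2 * N k ^ 3 * δ) ^ 2 * P.E (e ^ 2)
      ≤ (2 * N k ^ 3 * δ) ^ 2 * (N k ^ 3 * κ * P.nrm f) ^ 2 := by gcongr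
  calc _ ≤ _ := h8
    _ ≤ 8 * (N k ^ 4 * P.E (P.low d f ^ 4)
        + (2 * N k ^ 3 * δ) ^ 2 * (N k ^ 3 * κ * P.nrm f) ^ 2) := by linarith
    _ = _ := by ring

end CoordSpace
end EpsProduct
end

/-! ### The main part of the square of the low degree part -/

noncomputable section

namespace EpsProduct
namespace CoordSpace
open Finset

variable {k : ℕ} {Ω : Type*} [Fintype Ω] {P : CoordSpace k Ω}
variable {d : ℕ} {δ κ : ℝ} {f : Ω → ℝ}

/-- For `u`, `v` measurable with respect to `U`, `U'`, the correlation of the averages over `S` is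
almost that of the averages over `S ∩ U ∩ U'`. -/
lemma Near.E_A_mul_A_le (hP : P.Near κ) (hκ : 0 ≤ κ) {S U U' : Finset (Fin k)} {u v : Ω → ℝ}
    (hu : P.Meas U u) (hv : P.Meas U' v) :
    P.E (P.A S u * P.A S v) ≤ P.E (P.A ((U ∩ S) ∩ (U' ∩ S)) u * P.A ((U ∩ S) ∩ (U' ∩ S)) v)
      + 3 * κ * (P.nrm u * P.nrm v) := by
  set B := U ∩ S
  set C := U' ∩ S
  have nu := P.nrm_nonneg u
  have nv := P.nrm_nonneg v
  have h1 : P.nrm (P.A S u - P.A B u) ≤ κ * P.nrm u := by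
    have := hP S U u
    rwa [hu.A_eq, inter_comm] at this
  have h2 : P.nrm (P.A S v - P.A C v) ≤ κ * P.nrm v := by
    have := hP S U' v
    rwa [hv.A_eq, inter_comm] at this
  have h3 := hP B C v
  have e : P.A S u * P.A S v = (P.A S u - P.A B u) * P.A S v + P.A B u * (P.A S v - P.A C v)
      + P.A B u * P.A C v := by ring
  have e2 : P.E (P.A B u * P.A C v) = P.E (u * (P.A B (P.A C v) - P.A (B ∩ C) v))
      + P.E (P.A (B ∩ C) u * P.A (B ∩ C) v) := by
    rw [mul_sub, map_sub, ← P.E_A_mul B, P.E_A_mul (B ∩ C) u, P.A_A_of_subset subset_rfl]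
    ring
  have t1 := (le_abs_self _).trans (P.abs_E_mul_le (P.A S u - P.A B u) (P.A S v))
  have t2 := (le_abs_self _).trans (P.abs_E_mul_le (P.A B u) (P.A S v - P.A C v))
  have t3 := (le_abs_self _).trans (P.abs_E_mul_le u (P.A B (P.A C v) - P.A (B ∩ C) v))
  have s1 := mul_le_mul h1 (P.nrm_A_le S v) (P.nrm_nonneg _) (mul_nonneg hκ nu)
  have s2 := mul_le_mul (P.nrm_A_le B u) h2 (P.nrm_nonneg _) nu
  have s3 := mul_le_mul_of_nonneg_left h3 nu
  rw [e, map_add, map_add, e2]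
  linarith

/-- `∑_{B ∪ C = S} q^{|B ∩ C|} = (2 + q)^{|S|}`: each element of `S` lies in `B` only, in `C` only,
or in both. -/
lemma sum_union_eq_pow (S : Finset (Fin k)) (q : ℝ) :
    ∑ p : Finset (Fin k) × Finset (Fin k) with p.1 ∪ p.2 = S, q ^ (p.1 ∩ p.2).card
      = (2 + q) ^ S.card := by
  have h1 : ∑ p : Finset (Fin k) × Finset (Fin k) with p.1 ∪ p.2 = S, q ^ (p.1 ∩ p.2).card
      = ∑ p ∈ S.powerset.sigma fun B => B.powerset, q ^ p.2.card := by
    refine sum_bij' (fun p _ => ⟨p.1, p.1 ∩ p.2⟩) (fun p _ => (p.1, p.2 ∪ (S \ p.1))) ?_ ?_ ?_ ?_ ?_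
    · intro p hp
      simp only [mem_filter, mem_univ, true_and] at hp
      simp only [mem_sigma, mem_powerset]
      exact ⟨hp ▸ subset_union_left, inter_subset_left⟩
    · rintro ⟨B, T⟩ hp
      simp only [mem_sigma, mem_powerset] at hp
      simp only [mem_filter, mem_univ, true_and]
      ext x
      have := @hp.1 x
      have := @hp.2 x
      simp only [mem_union, mem_sdiff]
      tauto
    · rintro ⟨B, C⟩ hp
      simp only [mem_filter, mem_univ, true_and] at hp
      subst hp
      simp only [Prod.mk.injEq, true_and]
      ext x
      simp only [mem_union, mem_sdiff, mem_inter]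
      tauto
    · rintro ⟨B, T⟩ hp
      simp only [mem_sigma, mem_powerset] at hp
      have : B ∩ (T ∪ S \ B) = T := by
        ext x
        have := @hp.2 x
        simp only [mem_union, mem_sdiff, mem_inter]
        tauto
      simp only [this]
    · intro p _
      rfl
  have h2 : ∀ B : Finset (Fin k), ∑ T ∈ B.powerset, q ^ T.card = (q + 1) ^ B.card := fun B => by
    simpa using sum_pow_mul_eq_add_pow q 1 B
  rw [h1, sum_sigma, sum_congr rfl fun B _ => h2 B]
  have := sum_pow_mul_eq_add_pow (q + 1) 1 S
  simp only [one_pow, mul_one] at this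
  rw [this]
  ring

/-- The part of the square of `∑_U g_U` contributing to its component at `S`. -/
def mainPart {α : Type*} (g : Finset (Fin k) → α → ℝ) (S : Finset (Fin k)) : α → ℝ :=
  ∑ p : Finset (Fin k) × Finset (Fin k) with p.1 ∪ p.2 = S,
    ∑ R ∈ Sᶜ.powerset, g (p.1 ∪ R) * g (p.2 ∪ R)

lemma mainPart_eq {α : Type*} (g : Finset (Fin k) → α → ℝ) (S : Finset (Fin k)) :
    mainPart g S = ∑ p : Finset (Fin k) × Finset (Fin k)
      with p.1 \ S = p.2 \ S ∧ p.1 ∩ S ∪ p.2 ∩ S = S, g p.1 * g p.2 := by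
  rw [mainPart, ← sum_product']
  refine sum_bij' (fun p _ => (p.1.1 ∪ p.2, p.1.2 ∪ p.2))
    (fun p _ => ((p.1 ∩ S, p.2 ∩ S), p.1 \ S)) ?_ ?_ ?_ ?_ ?_
  · rintro ⟨⟨B, C⟩, R⟩ hp
    simp only [mem_product, mem_filter, mem_univ, true_and, mem_powerset] at hp
    simp only [mem_filter, mem_univ, true_and]
    obtain ⟨rfl, hR⟩ := hp
    constructor
    · ext x
      simp only [mem_sdiff, mem_union]
      tauto
    · ext x
      have := @hR x
      simp only [mem_compl, mem_union, mem_inter] at this ⊢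
      tauto
  · rintro ⟨U, U'⟩ hp
    simp only [mem_filter, mem_univ, true_and] at hp
    simp only [mem_product, mem_filter, mem_univ, true_and, mem_powerset]
    refine ⟨hp.2, fun x hx => ?_⟩
    rw [mem_sdiff] at hx
    exact mem_compl.2 hx.2
  · rintro ⟨⟨B, C⟩, R⟩ hp
    simp only [mem_product, mem_filter, mem_univ, true_and, mem_powerset] at hp
    obtain ⟨rfl, hR⟩ := hp
    simp only [Prod.mk.injEq]
    refine ⟨⟨?_, ?_⟩, ?_⟩ <;>
    · ext x
      have := @hR x
      simp only [mem_compl, mem_union, mem_inter, mem_sdiff] at this ⊢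
      tauto
  · rintro ⟨U, U'⟩ hp
    simp only [mem_filter, mem_univ, true_and] at hp
    simp only [Prod.mk.injEq]
    refine ⟨?_, ?_⟩
    · ext x
      simp only [mem_union, mem_inter, mem_sdiff]
      tauto
    · rw [hp.1]
      ext x
      simp only [mem_union, mem_inter, mem_sdiff]
      tauto
  · intro p _
    rfl

section
variable {g : Finset (Fin k) → Ω → ℝ} {q m : ℝ}

lemma A_sum_mul_sq_le (S B C : Finset (Fin k)) (x : Ω) :
    (P.A S (∑ R ∈ Sᶜ.powerset, g (B ∪ R) * g (C ∪ R)) x) ^ 2 ≤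
      (∑ R ∈ Sᶜ.powerset, P.A S (g (B ∪ R) ^ 2) x) *
        ∑ R ∈ Sᶜ.powerset, P.A S (g (C ∪ R) ^ 2) x := by
  rw [map_sum, Finset.sum_apply]
  exact sum_sq_le_sum_mul_sum_of_sq_le_mul _
    (fun R _ => P.A_nonneg S (fun y => sq_nonneg _) x)
    (fun R _ => P.A_nonneg S (fun y => sq_nonneg _) x) fun R _ => P.A_mul_sq_le S _ _ x

/-- Cauchy--Schwarz, first over `R` and then over the pairs `(B, C)` with weights
`q^{|B ∩ C|}`. -/
lemma nrm_A_mainPart_sq_le (hq : 0 < q) (hg : ∀ U, d < U.card → g U = 0) (S : Finset (Fin k)) :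
    P.nrm (P.A S (mainPart g S)) ^ 2 ≤ (2 + 1 / q) ^ (2 * d) *
      ∑ p : Finset (Fin k) × Finset (Fin k) with p.1 ∪ p.2 = S, q ^ (p.1 ∩ p.2).card *
        P.E ((∑ R ∈ Sᶜ.powerset, P.A S (g (p.1 ∪ R) ^ 2)) *
          ∑ R ∈ Sᶜ.powerset, P.A S (g (p.2 ∪ R) ^ 2)) := by
  have hnn : ∀ B : Finset (Fin k), 0 ≤ ∑ R ∈ Sᶜ.powerset, P.A S (g (B ∪ R) ^ 2) := fun B =>
    sum_nonneg fun R _ => P.A_nonneg S fun y => sq_nonneg _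
  by_cases hS : S.card ≤ 2 * d
  · have hpt : P.A S (mainPart g S) ^ 2 ≤ (2 + 1 / q) ^ (2 * d) •
        ∑ p : Finset (Fin k) × Finset (Fin k) with p.1 ∪ p.2 = S, q ^ (p.1 ∩ p.2).card •
          ((∑ R ∈ Sᶜ.powerset, P.A S (g (p.1 ∪ R) ^ 2)) *
            ∑ R ∈ Sᶜ.powerset, P.A S (g (p.2 ∪ R) ^ 2)) := fun x => by
      have h1 := sum_sq_le_sum_mul_sum_of_sq_le_mul
        ({p | p.1 ∪ p.2 = S} : Finset (Finset (Fin k) × Finset (Fin k)))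
        (r := fun p => P.A S (∑ R ∈ Sᶜ.powerset, g (p.1 ∪ R) * g (p.2 ∪ R)) x)
        (f := fun p => (1 / q) ^ (p.1 ∩ p.2).card)
        (g := fun p => q ^ (p.1 ∩ p.2).card * ((∑ R ∈ Sᶜ.powerset, P.A S (g (p.1 ∪ R) ^ 2) x) *
            ∑ R ∈ Sᶜ.powerset, P.A S (g (p.2 ∪ R) ^ 2) x))
        (fun p _ => by positivity)
        (fun p _ => mul_nonneg (by positivity) (mul_nonneg
          (by simpa using hnn p.1 x) (by simpa using hnn p.2 x)))
        (fun p _ => by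
          rw [← mul_assoc, ← mul_pow, one_div_mul_cancel hq.ne', one_pow, one_mul]
          exact A_sum_mul_sq_le S p.1 p.2 x)
      rw [sum_union_eq_pow] at h1
      have h2 : (2 + 1 / q) ^ S.card ≤ (2 + 1 / q) ^ (2 * d) := by
        refine pow_le_pow_right₀ ?_ hS
        have : 0 < 1 / q := by positivity
        linarith
      have h3 : 0 ≤ ∑ p : Finset (Fin k) × Finset (Fin k) with p.1 ∪ p.2 = S,
          q ^ (p.1 ∩ p.2).card * ((∑ R ∈ Sᶜ.powerset, P.A S (g (p.1 ∪ R) ^ 2) x) *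
            ∑ R ∈ Sᶜ.powerset, P.A S (g (p.2 ∪ R) ^ 2) x) :=
        sum_nonneg fun p _ => mul_nonneg (by positivity) (mul_nonneg
          (by simpa using hnn p.1 x) (by simpa using hnn p.2 x))
      have h4 := h1.trans (mul_le_mul_of_nonneg_right h2 h3)
      rw [mainPart, map_sum]
      simpa only [Pi.pow_apply, Finset.sum_apply, Pi.smul_apply, Pi.mul_apply, smul_eq_mul]
        using h4
    have := P.E_mono hpt
    rw [P.nrm_sq]
    simpa only [map_smul, map_sum, smul_eq_mul] using this
  · -- one of two sets with union `S` has more than `d` elements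
    have h0 : mainPart g S = 0 := by
      refine sum_eq_zero fun p hp => sum_eq_zero fun R _ => ?_
      have hp' : p.1 ∪ p.2 = S := (mem_filter.1 hp).2
      have h1 : S.card ≤ p.1.card + p.2.card := hp' ▸ card_union_le _ _
      by_cases h2 : d < p.1.card
      · rw [hg _ (h2.trans_le (card_le_card subset_union_left)), zero_mul]
      · have h3 : d < p.2.card := by omega
        rw [hg (p.2 ∪ R) (h3.trans_le (card_le_card subset_union_left)), mul_zero]
    rw [h0, map_zero, nrm_zero]
    refine (by norm_num : (0 : ℝ) ^ 2 = 0).trans_le ?_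
    refine mul_nonneg (by positivity) (sum_nonneg fun p _ => mul_nonneg (by positivity)
      (P.E_nonneg (mul_nonneg (hnn _) (hnn _))))

variable (P) in
/-- The conditional expectation, given the coordinates in `T`, of the sum of the squares of the
`g_U` with `U ⊇ T`. -/
def energy (g : Finset (Fin k) → Ω → ℝ) (T : Finset (Fin k)) : Ω → ℝ :=
  P.A T (∑ U ∈ Icc T univ, g U ^ 2)

lemma energy_nonneg (T : Finset (Fin k)) : 0 ≤ P.energy g T :=
  P.A_nonneg T (sum_nonneg fun _ _ _ => sq_nonneg _)

lemma sum_energy_sq_le (hg : ∀ U, d < U.card → g U = 0) (T : Finset (Fin k)) :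
    P.E ((P.A T (∑ B ∈ Icc T univ, ∑ U ∈ Icc B univ, g U ^ 2)) ^ 2)
      ≤ 4 ^ (d - T.card) * P.E (P.energy g T ^ 2) := by
  have h1 : ∑ B ∈ Icc T univ, ∑ U ∈ Icc B univ, g U ^ 2
      = ∑ U ∈ Icc T univ, ∑ _B ∈ Icc T U, g U ^ 2 := by
    refine sum_comm' fun B U => ?_
    simp only [mem_Icc, subset_univ, and_true]
    exact ⟨fun h => ⟨⟨h.1, h.2⟩, h.1.trans h.2⟩, fun h => h.1⟩
  have h2 : ∑ B ∈ Icc T univ, ∑ U ∈ Icc B univ, g U ^ 2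
      ≤ (2 : ℝ) ^ (d - T.card) • ∑ U ∈ Icc T univ, g U ^ 2 := by
    rw [h1, smul_sum]
    refine sum_le_sum fun U hU => ?_
    rw [sum_const, card_Icc_finset (mem_Icc.1 hU).1]
    by_cases hUd : d < U.card
    · rw [hg U hUd]
      simp
    · intro x
      simp only [Pi.smul_apply, Pi.pow_apply, nsmul_eq_mul, smul_eq_mul]
      refine mul_le_mul_of_nonneg_right ?_ (sq_nonneg _)
      push_cast
      exact pow_le_pow_right₀ one_le_two (by omega)
  have h3 := P.A_mono T h2
  have h0 : 0 ≤ P.A T (∑ B ∈ Icc T univ, ∑ U ∈ Icc B univ, g U ^ 2) :=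
    P.A_nonneg T (sum_nonneg fun B _ => sum_nonneg fun U _ y => sq_nonneg _)
  rw [map_smul] at h3
  rw [show (4 : ℝ) = 2 ^ 2 by norm_num, ← pow_mul, mul_comm 2, pow_mul, ← smul_eq_mul (_ ^ 2),
    ← map_smul, ← smul_pow]
  exact P.E_mono fun x => pow_le_pow_left₀ (h0 x) (h3 x) 2

/-- Sum the Cauchy--Schwarz bound for all `S`: the pair `(B, C)` determines `S = B ∪ C`, and the
averages over `S` may be replaced by averages over `B ∩ C`. -/
lemma sum_nrm_A_mainPart_sq_le (hP : P.Near κ) (hκ : 0 ≤ κ) (hq : 1 ≤ q)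
    (hg : ∀ U, d < U.card → g U = 0) (hgm : ∀ U, P.Meas U (g U))
    (hm : ∀ U, P.nrm (g U ^ 2) ≤ m) :
    ∑ S, P.nrm (P.A S (mainPart g S)) ^ 2 ≤ (2 + 1 / q) ^ (2 * d) *
      (∑ T : Finset (Fin k) with T.card ≤ d,
          q ^ T.card * (4 ^ (d - T.card) * P.E (P.energy g T ^ 2))
        + 3 * N k ^ 4 * q ^ k * κ * m ^ 2) := by
  have hN := N_pos k
  have hq0 : 0 < q := zero_lt_one.trans_le hq
  have hm0 : 0 ≤ m := (P.nrm_nonneg _).trans (hm ∅)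
  -- the weighted pair term, with averages over `B ∩ C`
  set F : Finset (Fin k) → Finset (Fin k) → Finset (Fin k) → ℝ := fun T B C =>
    q ^ T.card * P.E (P.A T (∑ U ∈ Icc B univ, g U ^ 2) * P.A T (∑ U ∈ Icc C univ, g U ^ 2)) with hF
  have hnn : ∀ T B : Finset (Fin k), 0 ≤ P.A T (∑ U ∈ Icc B univ, g U ^ 2) := fun T B =>
    P.A_nonneg T (sum_nonneg fun _ _ _ => sq_nonneg _)
  have hF0 : ∀ T B C, 0 ≤ F T B C := fun T B C =>
    mul_nonneg (by positivity) (P.E_nonneg (mul_nonneg (hnn _ _) (hnn _ _)))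
  have hpair : ∀ (S : Finset (Fin k)) (p : Finset (Fin k) × Finset (Fin k)), p.1 ∪ p.2 = S →
      q ^ (p.1 ∩ p.2).card *
        P.E ((∑ R ∈ Sᶜ.powerset, P.A S (g (p.1 ∪ R) ^ 2)) *
          ∑ R ∈ Sᶜ.powerset, P.A S (g (p.2 ∪ R) ^ 2)) ≤
      F (p.1 ∩ p.2) p.1 p.2 + q ^ k * (N k ^ 2 * (3 * κ * m ^ 2)) := by
    rintro S ⟨B, C⟩ rfl
    set S := B ∪ C with hS
    set T := B ∩ C with hT
    have hterm : ∀ R ∈ Sᶜ.powerset, ∀ R' ∈ Sᶜ.powerset,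
        P.E (P.A S (g (B ∪ R) ^ 2) * P.A S (g (C ∪ R') ^ 2)) ≤
          P.E (P.A T (g (B ∪ R) ^ 2) * P.A T (g (C ∪ R') ^ 2)) + 3 * κ * m ^ 2 := by
      intro R hR R' hR'
      rw [mem_powerset] at hR hR'
      have e : ((B ∪ R) ∩ S) ∩ ((C ∪ R') ∩ S) = T := by
        ext x
        have := @hR x
        have := @hR' x
        simp only [hS, hT, mem_compl, mem_union, mem_inter] at *
        tauto
      have hsq : ∀ U, P.Meas U (g U ^ 2) := fun U => by rw [sq]; exact (hgm U).mul (hgm U)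
      have := hP.E_A_mul_A_le hκ (S := S) (hsq (B ∪ R)) (hsq (C ∪ R'))
      rw [e] at this
      refine this.trans ?_
      have := mul_le_mul (hm (B ∪ R)) (hm (C ∪ R')) (P.nrm_nonneg _) hm0
      rw [sq m]
      gcongr
    have hsub : ∀ D ⊆ S, ∑ R ∈ Sᶜ.powerset, P.A T (g (D ∪ R) ^ 2)
        ≤ P.A T (∑ U ∈ Icc D univ, g U ^ 2) := by
      intro D hD
      rw [map_sum]
      have hinj : Set.InjOn (fun R => D ∪ R) (Sᶜ.powerset : Set (Finset (Fin k))) := by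
        intro R hR R' hR' h
        simp only [mem_coe, mem_powerset] at hR hR'
        simp only at h
        ext x
        have h1 := @hR x
        have h2 := @hR' x
        have h3 := @hD x
        have h4 : x ∈ D ∪ R ↔ x ∈ D ∪ R' := by rw [h]
        simp only [mem_compl, mem_union] at h1 h2 h3 h4
        tauto
      rw [← sum_image (f := fun U => P.A T (g U ^ 2)) hinj]
      refine sum_le_sum_of_subset_of_nonneg ?_ fun U _ _ => P.A_nonneg T fun y => sq_nonneg _
      intro U hU
      obtain ⟨R, _, rfl⟩ := mem_image.1 hU
      exact mem_Icc.2 ⟨subset_union_left, subset_univ _⟩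
    have hcard : (#(Sᶜ.powerset) : ℝ) ≤ N k := card_le_N _
    have h1 : P.E ((∑ R ∈ Sᶜ.powerset, P.A S (g (B ∪ R) ^ 2)) *
        ∑ R ∈ Sᶜ.powerset, P.A S (g (C ∪ R) ^ 2)) ≤
        P.E ((∑ R ∈ Sᶜ.powerset, P.A T (g (B ∪ R) ^ 2)) *
          ∑ R ∈ Sᶜ.powerset, P.A T (g (C ∪ R) ^ 2)) + N k ^ 2 * (3 * κ * m ^ 2) := by
      simp only [sum_mul_sum, map_sum]
      refine (sum_le_sum fun R hR => sum_le_sum fun R' hR' => hterm R hR R' hR').trans ?_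
      simp only [sum_add_distrib, sum_const, nsmul_eq_mul]
      rw [← mul_assoc, sq (N k)]
      gcongr
    have h2 : P.E ((∑ R ∈ Sᶜ.powerset, P.A T (g (B ∪ R) ^ 2)) *
          ∑ R ∈ Sᶜ.powerset, P.A T (g (C ∪ R) ^ 2)) ≤
        P.E (P.A T (∑ U ∈ Icc B univ, g U ^ 2) * P.A T (∑ U ∈ Icc C univ, g U ^ 2)) := by
      refine P.E_mono fun x => mul_le_mul (hsub B subset_union_left x) (hsub C subset_union_right x)
        ?_ (hnn _ _ x)
      exact (sum_nonneg fun R _ => P.A_nonneg T fun y => sq_nonneg _ :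
        0 ≤ ∑ R ∈ Sᶜ.powerset, P.A T (g (C ∪ R) ^ 2)) x
    have h3 : q ^ T.card ≤ q ^ k := pow_le_pow_right₀ hq (by simpa using card_le_univ T)
    calc _ ≤ q ^ T.card * (P.E (P.A T (∑ U ∈ Icc B univ, g U ^ 2) *
          P.A T (∑ U ∈ Icc C univ, g U ^ 2)) + N k ^ 2 * (3 * κ * m ^ 2)) := by
          gcongr
          exact h1.trans (by gcongr)
      _ = F T B C + q ^ T.card * (N k ^ 2 * (3 * κ * m ^ 2)) := by rw [hF]; ring
      _ ≤ _ := by gcongr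
  have hfib : ∑ S : Finset (Fin k), ∑ p : Finset (Fin k) × Finset (Fin k) with p.1 ∪ p.2 = S,
        (F (p.1 ∩ p.2) p.1 p.2 + q ^ k * (N k ^ 2 * (3 * κ * m ^ 2)))
      = ∑ p : Finset (Fin k) × Finset (Fin k),
        (F (p.1 ∩ p.2) p.1 p.2 + q ^ k * (N k ^ 2 * (3 * κ * m ^ 2))) :=
    sum_fiberwise _ _ _
  have hcardP : (#(univ : Finset (Finset (Fin k) × Finset (Fin k))) : ℝ) = N k ^ 2 := by
    simp [N, sq]
  have hT : ∑ p : Finset (Fin k) × Finset (Fin k), F (p.1 ∩ p.2) p.1 p.2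
      ≤ ∑ T : Finset (Fin k) with T.card ≤ d,
          q ^ T.card * (4 ^ (d - T.card) * P.E (P.energy g T ^ 2)) := by
    rw [← sum_fiberwise univ (fun p : Finset (Fin k) × Finset (Fin k) => p.1 ∩ p.2)]
    have h1 : ∀ T : Finset (Fin k),
        ∑ p : Finset (Fin k) × Finset (Fin k) with p.1 ∩ p.2 = T, F (p.1 ∩ p.2) p.1 p.2
          ≤ q ^ T.card * P.E ((P.A T (∑ B ∈ Icc T univ, ∑ U ∈ Icc B univ, g U ^ 2)) ^ 2) := by
      intro T
      have e : q ^ T.card * P.E ((P.A T (∑ B ∈ Icc T univ, ∑ U ∈ Icc B univ, g U ^ 2)) ^ 2)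
          = ∑ p ∈ Icc T univ ×ˢ Icc T univ, F T p.1 p.2 := by
        rw [map_sum (P.A T), sq, sum_mul_sum, map_sum, mul_sum, sum_product]
        simp only [map_sum P.E, mul_sum, hF]
      rw [e]
      calc _ = ∑ p : Finset (Fin k) × Finset (Fin k) with p.1 ∩ p.2 = T, F T p.1 p.2 :=
            sum_congr rfl fun p hp => by rw [(mem_filter.1 hp).2]
        _ ≤ _ := by
            refine sum_le_sum_of_subset_of_nonneg ?_ fun p _ _ => hF0 _ _ _
            intro p hp
            obtain rfl := (mem_filter.1 hp).2
            simp [inter_subset_left, inter_subset_right]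
    refine (sum_le_sum fun T _ => h1 T).trans ?_
    rw [← sum_filter_add_sum_filter_not univ (fun T : Finset (Fin k) => T.card ≤ d)]
    have h2 : ∑ T : Finset (Fin k) with ¬ T.card ≤ d,
        q ^ T.card * P.E ((P.A T (∑ B ∈ Icc T univ, ∑ U ∈ Icc B univ, g U ^ 2)) ^ 2) = 0 := by
      refine sum_eq_zero fun T hT => ?_
      have hT' : d < T.card := not_le.1 (mem_filter.1 hT).2
      have : ∑ B ∈ Icc T univ, ∑ U ∈ Icc B univ, g U ^ 2 = 0 := by
        refine sum_eq_zero fun B hB => sum_eq_zero fun U hU => ?_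
        rw [hg U (hT'.trans_le (card_le_card ((mem_Icc.1 hB).1.trans (mem_Icc.1 hU).1)))]
        simp
      rw [this]
      simp
    rw [h2, add_zero]
    refine sum_le_sum fun T _ => ?_
    gcongr
    exact sum_energy_sq_le hg T
  calc ∑ S, P.nrm (P.A S (mainPart g S)) ^ 2
      ≤ ∑ S : Finset (Fin k), (2 + 1 / q) ^ (2 * d) *
        ∑ p : Finset (Fin k) × Finset (Fin k) with p.1 ∪ p.2 = S,
          (F (p.1 ∩ p.2) p.1 p.2 + q ^ k * (N k ^ 2 * (3 * κ * m ^ 2))) := by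
        refine sum_le_sum fun S _ => (nrm_A_mainPart_sq_le hq0 hg S).trans ?_
        gcongr with p hp
        exact hpair S p (mem_filter.1 hp).2
    _ = (2 + 1 / q) ^ (2 * d) * (∑ p : Finset (Fin k) × Finset (Fin k), F (p.1 ∩ p.2) p.1 p.2
        + 3 * N k ^ 4 * q ^ k * κ * m ^ 2) := by
        rw [← mul_sum, hfib, sum_add_distrib, sum_const, nsmul_eq_mul, hcardP]
        ring
    _ ≤ _ := by gcongr

end

end CoordSpace
end EpsProduct
end

/-! ### Bounding the fourth moment by energies and influences -/

noncomputable section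

namespace EpsProduct
namespace CoordSpace
open Finset

variable {k : ℕ} {Ω : Type*} [Fintype Ω] (P : CoordSpace k Ω)

/-- The components of `f` of degree at most `d`, the others being replaced by `0`. -/
def lowComp (d : ℕ) (f : Ω → ℝ) (U : Finset (Fin k)) : Ω → ℝ :=
  if U.card ≤ d then P.comp U f else 0

variable {P}
variable {d : ℕ} {δ κ q : ℝ} {f : Ω → ℝ}

lemma lowComp_of_lt (U : Finset (Fin k)) (hU : d < U.card) : P.lowComp d f U = 0 :=
  if_neg hU.not_ge

lemma lowComp_of_le {U : Finset (Fin k)} (hU : U.card ≤ d) : P.lowComp d f U = P.comp U f :=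
  if_pos hU

lemma meas_lowComp (U : Finset (Fin k)) : P.Meas U (P.lowComp d f U) := by
  unfold lowComp
  split_ifs
  exacts [P.meas_rcomp ∅ U f, fun _ _ _ => rfl]

lemma low_eq_sum_lowComp : P.low d f = ∑ U, P.lowComp d f U := by
  simp only [low, lowComp, sum_filter]

lemma nrm_pow_two_sq (g : Ω → ℝ) : P.nrm (g ^ 2) ^ 2 = P.E (g ^ 4) := by
  rw [P.nrm_sq, ← pow_mul]

lemma nrm_add_sq_le (a b : Ω → ℝ) :
    P.nrm (a + b) ^ 2 ≤ 101 / 100 * P.nrm a ^ 2 + 101 * P.nrm b ^ 2 := by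
  have h1 := pow_le_pow_left₀ (P.nrm_nonneg _) (P.nrm_add_le a b) 2
  nlinarith [sq_nonneg (P.nrm a - 100 * P.nrm b)]

/-- Up to a small error, only the main part of the square of `f^{≤ d}` contributes to its component
at `S`. -/
lemma Glob.nrm_comp_low_sq_le (hf : P.Glob d δ f) (hδ : 0 ≤ δ) (hP : P.Near κ) (hκ : 0 ≤ κ)
    (S : Finset (Fin k)) :
    P.nrm (P.comp S (P.low d f ^ 2)) ^ 2 ≤
      101 / 100 * ((1 + N k ^ 4 * κ) * P.nrm (P.A S (mainPart (P.lowComp d f) S)) ^ 2)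
        + 101 * N k ^ 10 * (κ * δ * P.nrm f) ^ 2 := by
  have hN := N_pos k
  have hf0 := P.nrm_nonneg f
  set g := P.lowComp d f with hg
  set good : Finset (Finset (Fin k) × Finset (Fin k)) :=
    {p | p.1 \ S = p.2 \ S ∧ p.1 ∩ S ∪ p.2 ∩ S = S} with hgood
  set b : Ω → ℝ := ∑ p ∈ goodᶜ, P.comp S (g p.1 * g p.2) with hb
  have h1 : P.comp S (P.low d f ^ 2) = P.comp S (mainPart g S) + b := by
    rw [low_eq_sum_lowComp, sq, sum_mul_sum, ← sum_product', univ_product_univ,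
      ← sum_add_sum_compl good, map_add, mainPart_eq, hb, map_sum _ _ goodᶜ]
  have h2 : P.nrm b ≤ N k ^ 2 * (N k ^ 3 * (κ * δ * P.nrm f)) := by
    refine P.nrm_sum_le_card _ _ (by positivity) ?_ fun p hp => ?_
    · have : goodᶜ.card ≤ (2 ^ k) ^ 2 := (card_le_univ _).trans_eq (by simp [sq])
      unfold N
      exact_mod_cast this
    · have hp' : ¬ (p.1 \ S = p.2 \ S ∧ p.1 ∩ S ∪ p.2 ∩ S = S) := by
        simpa [hgood] using hp
      by_cases hU : p.1.card ≤ d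
      · by_cases hU' : p.2.card ≤ d
        · rw [hg, lowComp_of_le hU, lowComp_of_le hU']
          exact hf.nrm_comp_mul_le hδ hP hκ hU hU' hp'
        · rw [hg, lowComp_of_lt p.2 (not_le.1 hU'), mul_zero, map_zero, nrm_zero]
          positivity
      · rw [hg, lowComp_of_lt p.1 (not_le.1 hU), zero_mul, map_zero, nrm_zero]
        positivity
  have h3 := hP.nrm_comp_sq_le hκ S (mainPart g S)
  have h4 := P.nrm_add_sq_le (P.comp S (mainPart g S)) b
  have h5 := pow_le_pow_left₀ (P.nrm_nonneg _) h2 2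
  rw [h1]
  refine h4.trans ?_
  have h6 : (N k ^ 2 * (N k ^ 3 * (κ * δ * P.nrm f))) ^ 2
      = N k ^ 10 * (κ * δ * P.nrm f) ^ 2 := by ring
  rw [h6] at h5
  linarith

/-- The fourth moment of `f^{≤ d}` is bounded by the second moments of the conditional energies.
The error terms proportional to the fourth moment itself are absorbed. -/
theorem Glob.E_low_pow_four_le (hf : P.Glob d δ f) (hδ : 0 ≤ δ) (hP : P.Near κ) (hκ : 0 ≤ κ)
    (hq : 1 ≤ q) (hsmall : 2400 * N k ^ 8 * (2 + 1 / q) ^ (2 * d) * q ^ k * κ ≤ 1) :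
    P.E (P.low d f ^ 4) ≤ 21 / 20 * ((2 + 1 / q) ^ (2 * d) *
      ∑ T : Finset (Fin k) with T.card ≤ d,
        q ^ T.card * (4 ^ (d - T.card) * P.E (P.energy (P.lowComp d f) T ^ 2)))
      + 110 * N k ^ 11 * (κ * δ * P.nrm f) ^ 2 := by
  have hN := N_pos k
  have hN1 := one_le_N k
  set M := (2 + 1 / q) ^ (2 * d) with hM
  set Y := ∑ T : Finset (Fin k) with T.card ≤ d,
        q ^ T.card * (4 ^ (d - T.card) * P.E (P.energy (P.lowComp d f) T ^ 2)) with hY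
  set X := P.E (P.low d f ^ 4) with hX
  set e := (κ * δ * P.nrm f) ^ 2 with he
  have he0 : 0 ≤ e := sq_nonneg _
  have hX0 : 0 ≤ X := by rw [hX, ← nrm_pow_two_sq]; exact sq_nonneg _
  have hM1 : 1 ≤ M := by
    have : 0 < 1 / q := by positivity
    exact one_le_pow₀ (by linarith)
  have hQ1 : 1 ≤ q ^ k := one_le_pow₀ hq
  have hY0 : 0 ≤ Y := sum_nonneg fun T _ =>
    mul_nonneg (by positivity) (mul_nonneg (by positivity) (P.E_sq_nonneg _))
  set D := 8 * N k ^ 4 * X + 32 * N k ^ 12 * e with hD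
  have hD0 : 0 ≤ D := by positivity
  have hm : ∀ U, P.nrm (P.lowComp d f U ^ 2) ≤ √D := by
    intro U
    refine Real.le_sqrt_of_sq_le ?_
    rw [nrm_pow_two_sq]
    by_cases hU : U.card ≤ d
    · rw [lowComp_of_le hU]
      exact hf.E_comp_pow_four_le hδ hP hκ hU
    · rw [lowComp_of_lt U (not_le.1 hU)]
      simpa using hD0
  have h1 := sum_nrm_A_mainPart_sq_le hP hκ hq (lowComp_of_lt (P := P) (d := d) (f := f))
    meas_lowComp hm
  rw [Real.sq_sqrt hD0, ← hM, ← hY] at h1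
  have h2 := (abs_le.1 (hP.abs_nrm_sq_sub_sum_comp_le hκ (P.low d f ^ 2))).2
  rw [nrm_pow_two_sq, ← hX] at h2
  set W := ∑ S, P.nrm (P.A S (mainPart (P.lowComp d f) S)) ^ 2 with hS1
  have h3 : ∑ S, P.nrm (P.comp S (P.low d f ^ 2)) ^ 2
      ≤ 101 / 100 * ((1 + N k ^ 4 * κ) * W) + 101 * N k ^ 11 * e := by
    refine (sum_le_sum fun S _ => hf.nrm_comp_low_sq_le hδ hP hκ S).trans ?_
    rw [sum_add_distrib, ← mul_sum, ← mul_sum, sum_const, nsmul_eq_mul]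
    have hc : (#(univ : Finset (Finset (Fin k))) : ℝ) = N k := by simp [N]
    rw [hc]
    exact le_of_eq (by ring)
  -- the two consequences of the smallness of `κ`
  have k1 : N k ^ 4 * κ ≤ 1 / 100 := by
    have : N k ^ 4 * κ ≤ N k ^ 8 * M * q ^ k * κ := by
      gcongr
      calc N k ^ 4 ≤ N k ^ 8 := pow_le_pow_right₀ hN1 (by norm_num)
        _ = N k ^ 8 * 1 * 1 := by ring
        _ ≤ _ := by gcongr
    linarith
  have k2 : M * (3 * N k ^ 4 * q ^ k * κ * D) ≤ 1 / 100 * X + 4 / 100 * N k ^ 8 * e := by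
    have e1 : M * (3 * N k ^ 4 * q ^ k * κ * D)
        = (2400 * N k ^ 8 * M * q ^ k * κ) * (1 / 100 * X + 4 / 100 * N k ^ 8 * e) := by
      rw [hD]; ring
    rw [e1]
    exact mul_le_of_le_one_left (by positivity) hsmall
  have k3 : N k ^ 8 ≤ N k ^ 11 := pow_le_pow_right₀ hN1 (by norm_num)
  have k4 : N k ^ 8 * e ≤ N k ^ 11 * e := by gcongr
  have hS0 : 0 ≤ W := sum_nonneg fun S _ => sq_nonneg _
  have k5 : (1 + N k ^ 4 * κ) * W ≤ 101 / 100 * W := by gcongr; linarith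
  have k6 : N k ^ 4 * κ * X ≤ 1 / 100 * X := by gcongr
  have k7 : W ≤ M * Y + (1 / 100 * X + 4 / 100 * N k ^ 8 * e) := by
    rw [mul_add] at h1
    exact h1.trans (add_le_add_right k2 _)
  have hMY : 0 ≤ M * Y := mul_nonneg (zero_le_one.trans hM1) hY0
  have hNe : 0 ≤ N k ^ 11 * e := mul_nonneg (by positivity) he0
  clear_value X Y W M e
  linarith

/-- The energy is almost the influence: the cross terms in the square of the Laplacian are
conditionally almost orthogonal. -/
lemma Glob.E_energy_sq_le (hf : P.Glob d δ f) (hδ : 0 ≤ δ) (hP : P.Near κ) (hκ : 0 ≤ κ)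
    (T : Finset (Fin k)) :
    P.E (P.energy (P.lowComp d f) T ^ 2) ≤
      2 * P.E (P.A T ((∑ U ∈ Icc T univ, P.lowComp d f U) ^ 2) ^ 2)
        + 2 * N k ^ 8 * (κ * δ * P.nrm f) ^ 2 := by
  have hN := N_pos k
  have hf0 := P.nrm_nonneg f
  set g := P.lowComp d f with hg
  set b : Ω → ℝ := ∑ p ∈ (Icc T univ).offDiag, P.A T (g p.1 * g p.2) with hb
  set I : Ω → ℝ := P.A T ((∑ U ∈ Icc T univ, g U) ^ 2) with hI
  have h1 : P.energy g T = I + -b := by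
    have e : I = P.energy g T + b := by
      rw [hI, hb, energy, ← map_sum, ← map_add]
      congr 1
      rw [sq, sum_mul_sum, ← sum_product', ← diag_union_offDiag,
        sum_union (disjoint_diag_offDiag _), sum_diag]
      simp only [sq]
    rw [e]; abel
  have h2 : P.nrm b ≤ N k ^ 2 * (N k ^ 2 * (κ * δ * P.nrm f)) := by
    refine P.nrm_sum_le_card _ _ (by positivity) (card_offDiag_le _) fun p hp => ?_
    rw [mem_offDiag, mem_Icc, mem_Icc] at hp
    by_cases hU : p.1.card ≤ d
    · by_cases hU' : p.2.card ≤ d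
      · rw [hg, lowComp_of_le hU, lowComp_of_le hU']
        by_cases h : p.1 ⊆ p.2
        · obtain ⟨i, hi, hi'⟩ := not_subset.1 fun h' => hp.2.2 (subset_antisymm h h')
          rw [mul_comm (P.comp _ f)]
          exact hf.nrm_A_mul_le hδ hP hκ hi hi' (fun h => hi' (hp.1.1 h)) hU
        · obtain ⟨i, hi, hi'⟩ := not_subset.1 h
          exact hf.nrm_A_mul_le hδ hP hκ hi hi' (fun h => hi' (hp.2.1.1 h)) hU'
      · rw [hg, lowComp_of_lt p.2 (not_le.1 hU'), mul_zero, map_zero, nrm_zero]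
        positivity
    · rw [hg, lowComp_of_lt p.1 (not_le.1 hU), zero_mul, map_zero, nrm_zero]
      positivity
  have h3 := pow_le_pow_left₀ (P.nrm_nonneg _) (P.nrm_add_le I (-b)) 2
  have h4 := pow_le_pow_left₀ (P.nrm_nonneg _) h2 2
  rw [nrm_neg] at h3
  rw [h1, ← P.nrm_sq, ← P.nrm_sq]
  have h5 : (N k ^ 2 * (N k ^ 2 * (κ * δ * P.nrm f))) ^ 2
      = N k ^ 8 * (κ * δ * P.nrm f) ^ 2 := by ring
  rw [h5] at h4
  nlinarith [sq_nonneg (P.nrm I - P.nrm b)]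

/-- A crude bound on the fourth moment, used when `κ` is not small. -/
lemma Glob.E_low_pow_four_le_crude (hf : P.Glob d δ f) (hδ : 0 ≤ δ) :
    P.E (P.low d f ^ 4) ≤ N k ^ 8 * (δ * P.nrm f) ^ 2 := by
  have hN := N_pos k
  have h1 : P.nrm (P.low d f) ≤ N k * (N k * P.nrm f) :=
    P.nrm_sum_le_card _ _ (mul_nonneg hN.le (P.nrm_nonneg f)) (card_le_N _) fun U _ =>
      P.nrm_rcomp_le ∅ U f
  have h2 := P.nrm_mul_le (hf.abs_low_le hδ) (P.low d f)
  rw [← nrm_pow_two_sq, sq (P.low d f)]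
  calc _ ≤ (N k ^ 2 * δ * (N k * (N k * P.nrm f))) ^ 2 := by
        refine pow_le_pow_left₀ (P.nrm_nonneg _) (h2.trans ?_) 2
        gcongr
    _ = _ := by ring

/-- The parameter `q` of the weights `q^{|B ∩ C|}` in degree `d`. It has to be at least `1`, also for
`d = 0`. -/
def wt (d : ℕ) : ℝ := max (2 * d) 1

lemma one_le_wt (d : ℕ) : 1 ≤ wt d := le_max_right _ _

lemma wt_eq (hd : 1 ≤ d) : wt d = 2 * d := by
  have : (1 : ℝ) ≤ d := by exact_mod_cast hd
  exact max_eq_left (by linarith)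

lemma wt_pow_le (hd : d ≤ k) : wt d ^ k ≤ (2 * k + 1) ^ k := by
  have : (d : ℝ) ≤ k := by exact_mod_cast hd
  have h0 : (0 : ℝ) ≤ k := Nat.cast_nonneg k
  exact pow_le_pow_left₀ (zero_le_one.trans (one_le_wt d)) (max_le (by linarith) (by linarith)) k

lemma two_add_inv_wt_pow_le (hd : 1 ≤ d) :
    (2 + 1 / wt d) ^ (2 * d) ≤ 4 ^ d * Real.exp (1 / 2) := by
  have hd' : (0 : ℝ) < d := by exact_mod_cast hd
  have h1 : 2 + 1 / wt d = 2 * (1 / (4 * d) + 1) := by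
    rw [wt_eq hd]; field_simp; ring
  have h2 : (1 / (4 * (d : ℝ)) + 1) ^ (2 * d) ≤ Real.exp (1 / 2) := by
    calc _ ≤ Real.exp (1 / (4 * d)) ^ (2 * d) := by
          gcongr
          exact Real.add_one_le_exp _
      _ = Real.exp (1 / 2) := by
          rw [← Real.exp_nat_mul]
          congr 1
          push_cast
          field_simp
          norm_num
  rw [h1, mul_pow, pow_mul, show (2 : ℝ) ^ 2 = 4 by norm_num]
  gcongr

lemma exp_half_le : Real.exp (1 / 2) ≤ 2 := by
  have h1 : Real.exp (1 / 2) ^ 2 = Real.exp 1 := by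
    rw [← Real.exp_nat_mul]; norm_num
  have h2 := Real.exp_one_lt_d9
  have h3 := Real.exp_pos (1 / 2)
  nlinarith

lemma two_add_inv_wt_pow_le_two_mul (d : ℕ) : (2 + 1 / wt d) ^ (2 * d) ≤ 2 * 4 ^ d := by
  rcases Nat.eq_zero_or_pos d with rfl | hd
  · simp
  · refine (two_add_inv_wt_pow_le hd).trans ?_
    rw [mul_comm]
    gcongr
    exact exp_half_le

lemma four_pow_le_N (hd : d ≤ k) : (4 : ℝ) ^ d ≤ N k ^ 2 := by
  rw [N, ← pow_mul, mul_comm, pow_mul]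
  norm_num
  exact pow_le_pow_right₀ (by norm_num) hd

lemma wt_pow_mul_le {t : ℕ} (ht : t ≤ d) :
    21 / 20 * ((2 + 1 / wt d) ^ (2 * d) * (wt d ^ t * (4 ^ (d - t) * 2))) ≤
      20 ^ (d + 1) * (4 * (d : ℝ)) ^ t := by
  have h1 := two_add_inv_wt_pow_le_two_mul d
  have h2 : wt d ^ t ≤ (4 * (d : ℝ)) ^ t := by
    rcases Nat.eq_zero_or_pos d with rfl | hd
    · obtain rfl : t = 0 := by omega
      simp
    · rw [wt_eq hd]
      gcongr
      norm_num
  have h3 : (4 : ℝ) ^ (d - t) ≤ 4 ^ d := pow_le_pow_right₀ (by norm_num) (by omega)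
  have hw : 0 < wt d := zero_lt_one.trans_le (one_le_wt d)
  calc _ ≤ 21 / 20 * (2 * 4 ^ d * ((4 * (d : ℝ)) ^ t * (4 ^ d * 2))) := by gcongr
    _ = 21 / 5 * (16 ^ d * (4 * (d : ℝ)) ^ t) := by
        have h4 : (4 : ℝ) ^ d * 4 ^ d = 16 ^ d := by rw [← mul_pow]; norm_num
        linear_combination (21 / 5 * (4 * (d : ℝ)) ^ t) * h4
    _ ≤ 20 * (20 ^ d * (4 * (d : ℝ)) ^ t) := by gcongr <;> norm_num
    _ = _ := by ring

/-- The smallness threshold for `κ` is the inverse of this number. -/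
def thr (k : ℕ) : ℝ := 4800 * N k ^ 10 * (2 * k + 1) ^ k

lemma thr_pos (k : ℕ) : 0 < thr k := by
  have := N_pos k
  unfold thr
  positivity

lemma small_of_thr (hκ : 0 ≤ κ) (hd : d ≤ k) (h : thr k * κ ≤ 1) :
    2400 * N k ^ 8 * (2 + 1 / wt d) ^ (2 * d) * wt d ^ k * κ ≤ 1 := by
  have hN := N_pos k
  have hw : 0 < wt d := zero_lt_one.trans_le (one_le_wt d)
  refine le_trans ?_ h
  have h1 : (2 + 1 / wt d) ^ (2 * d) ≤ 2 * N k ^ 2 :=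
    (two_add_inv_wt_pow_le_two_mul d).trans (by gcongr; exact four_pow_le_N hd)
  have h2 := wt_pow_le hd
  calc _ ≤ 2400 * N k ^ 8 * (2 * N k ^ 2) * (2 * k + 1) ^ k * κ := by gcongr
    _ = _ := by rw [thr]; ring

/-- The constant in front of the error term in the bound by influences. -/
def const₁ (k : ℕ) : ℝ := 5 * N k ^ 13 * (2 * k + 1) ^ k + 110 * N k ^ 11 + N k ^ 8 * thr k ^ 2

lemma const₁_nonneg (k : ℕ) : 0 ≤ const₁ k := by
  have := N_pos k
  unfold const₁
  positivity

/-- The hypercontractive inequality for global functions. -/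
theorem Glob.E_low_pow_four_le_influence_of_le (hf : P.Glob d δ f) (hδ : 0 ≤ δ) (hP : P.Near κ)
    (hκ : 0 ≤ κ) (hd : d ≤ k) :
    P.E (P.low d f ^ 4) ≤ 20 ^ (d + 1) * ∑ T : Finset (Fin k) with T.card ≤ d,
      (4 * (d : ℝ)) ^ T.card * P.E (P.A T ((∑ U ∈ Icc T univ, P.lowComp d f U) ^ 2) ^ 2)
      + const₁ k * (κ * δ * P.nrm f) ^ 2 := by
  have hN := N_pos k
  have hf0 := P.nrm_nonneg f
  have ht := thr_pos k
  set I : Finset (Fin k) → ℝ := fun T =>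
    P.E (P.A T ((∑ U ∈ Icc T univ, P.lowComp d f U) ^ 2) ^ 2) with hI
  set e := (κ * δ * P.nrm f) ^ 2 with he
  have he0 : 0 ≤ e := sq_nonneg _
  have hI0 : ∀ T, 0 ≤ I T := fun T => P.E_sq_nonneg _
  have hsum0 : 0 ≤ ∑ T : Finset (Fin k) with T.card ≤ d, (4 * (d : ℝ)) ^ T.card * I T :=
    sum_nonneg fun T _ => mul_nonneg (by positivity) (hI0 T)
  by_cases hsm : thr k * κ ≤ 1
  · have h1 := hf.E_low_pow_four_le hδ hP hκ (one_le_wt d) (small_of_thr hκ hd hsm)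
    have hw : 0 < wt d := zero_lt_one.trans_le (one_le_wt d)
    have hterm : ∀ T ∈ ({T | T.card ≤ d} : Finset (Finset (Fin k))),
        21 / 20 * ((2 + 1 / wt d) ^ (2 * d) * (wt d ^ T.card * (4 ^ (d - T.card) *
          P.E (P.energy (P.lowComp d f) T ^ 2)))) ≤
        20 ^ (d + 1) * ((4 * (d : ℝ)) ^ T.card * I T)
          + 5 * N k ^ 12 * (2 * k + 1) ^ k * e := by
      intro T hT
      have hTd : T.card ≤ d := (mem_filter.1 hT).2
      have h2 := hf.E_energy_sq_le hδ hP hκ T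
      have h3 := mul_le_mul_of_nonneg_right (wt_pow_mul_le hTd) (hI0 T)
      have h4 : (2 + 1 / wt d) ^ (2 * d) ≤ 2 * N k ^ 2 :=
        (two_add_inv_wt_pow_le_two_mul d).trans (by gcongr; exact four_pow_le_N hd)
      have h5 : wt d ^ T.card ≤ (2 * k + 1) ^ k :=
        (pow_le_pow_right₀ (one_le_wt d) (hTd.trans hd)).trans (wt_pow_le hd)
      have h6 : (4 : ℝ) ^ (d - T.card) ≤ N k ^ 2 := four_pow_le_N (by omega)
      calc _ ≤ 21 / 20 * ((2 + 1 / wt d) ^ (2 * d) * (wt d ^ T.card * (4 ^ (d - T.card) *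
            (2 * I T + 2 * N k ^ 8 * e)))) := by gcongr
        _ = 21 / 20 * ((2 + 1 / wt d) ^ (2 * d) * (wt d ^ T.card * (4 ^ (d - T.card) * 2))) * I T
            + 21 / 20 * ((2 + 1 / wt d) ^ (2 * d) * (wt d ^ T.card * (4 ^ (d - T.card) *
              (2 * N k ^ 8 * e)))) := by ring
        _ ≤ 20 ^ (d + 1) * (4 * (d : ℝ)) ^ T.card * I T
            + 21 / 20 * (2 * N k ^ 2 * ((2 * k + 1) ^ k * (N k ^ 2 * (2 * N k ^ 8 * e)))) := by
            gcongr
        _ = 20 ^ (d + 1) * ((4 * (d : ℝ)) ^ T.card * I T)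
            + 21 / 5 * (N k ^ 12 * (2 * k + 1) ^ k * e) := by ring
        _ ≤ 20 ^ (d + 1) * ((4 * (d : ℝ)) ^ T.card * I T)
            + 5 * (N k ^ 12 * (2 * k + 1) ^ k * e) := by gcongr; norm_num
        _ = _ := by ring
    have h7 := sum_le_sum hterm
    rw [sum_add_distrib, ← mul_sum, ← mul_sum, ← mul_sum, sum_const, nsmul_eq_mul] at h7
    have h8 : (#({T | T.card ≤ d} : Finset (Finset (Fin k))) : ℝ)
          * (5 * N k ^ 12 * (2 * k + 1) ^ k * e)
        ≤ N k * (5 * N k ^ 12 * (2 * k + 1) ^ k * e) := by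
      gcongr
      exact card_le_N _
    have h9 : 0 ≤ N k ^ 8 * thr k ^ 2 * e := by positivity
    rw [const₁]
    calc _ ≤ _ := h1
      _ ≤ 20 ^ (d + 1) * ∑ T : Finset (Fin k) with T.card ≤ d, (4 * (d : ℝ)) ^ T.card * I T
          + N k * (5 * N k ^ 12 * (2 * k + 1) ^ k * e) + 110 * N k ^ 11 * e := by linarith
      _ ≤ _ := by linarith
  · -- otherwise `1 ≤ (thr k * κ)²`
    have h1 := hf.E_low_pow_four_le_crude hδ
    have h2 : (1 : ℝ) ≤ (thr k * κ) ^ 2 := one_le_pow₀ (not_le.1 hsm).le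
    have h3 : N k ^ 8 * (δ * P.nrm f) ^ 2 ≤ N k ^ 8 * thr k ^ 2 * e := by
      calc _ = N k ^ 8 * (δ * P.nrm f) ^ 2 * 1 := by ring
        _ ≤ N k ^ 8 * (δ * P.nrm f) ^ 2 * (thr k * κ) ^ 2 := by gcongr
        _ = _ := by rw [he]; ring
    have h4 : 0 ≤ (5 * N k ^ 13 * (2 * k + 1) ^ k + 110 * N k ^ 11) * e := by positivity
    rw [const₁]
    have h5 : (0 : ℝ) ≤ 20 ^ (d + 1) * ∑ T : Finset (Fin k) with T.card ≤ d,
      (4 * (d : ℝ)) ^ T.card * I T := by positivity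
    linarith

end CoordSpace
end EpsProduct
end

/-! ### Energies of global functions -/

noncomputable section

namespace EpsProduct
namespace CoordSpace
open Finset

variable {k : ℕ} {Ω : Type*} [Fintype Ω] (P : CoordSpace k Ω)
variable {d : ℕ} {δ κ : ℝ} {f : Ω → ℝ}

/-- The component of `f` at `U`, computed as if the averaging operators multiplied: apply
inclusion-exclusion over the coordinates in `T` to the component relative to `T`. -/
def twoStep (T U : Finset (Fin k)) (f : Ω → ℝ) : Ω → ℝ :=
  ∑ S ∈ T.powerset, (-1 : ℝ) ^ (T \ S).card • P.A (S ∪ U \ T) (P.rcomp T U f)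

lemma comp_eq_sum_product {T U : Finset (Fin k)} (hT : T ⊆ U) (f : Ω → ℝ) :
    P.comp U f = ∑ p ∈ T.powerset ×ˢ Icc T U, (-1 : ℝ) ^ (T \ p.1).card •
      (-1 : ℝ) ^ (U \ p.2).card • P.A ((p.1 ∪ U \ T) ∩ p.2) f := by
  rw [comp, rcomp_apply]
  symm
  refine sum_bij' (fun p _ => (p.1 ∪ U \ T) ∩ p.2) (fun V _ => (V ∩ T, V ∪ T)) ?_ ?_ ?_ ?_ ?_
  · rintro ⟨S, V⟩ hp
    simp only [mem_product, mem_powerset, mem_Icc] at hp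
    exact mem_Icc.2 ⟨empty_subset _, inter_subset_right.trans hp.2.2⟩
  · intro V hV
    simp only [mem_product, mem_powerset, mem_Icc]
    exact ⟨inter_subset_right, subset_union_right, union_subset (mem_Icc.1 hV).2 hT⟩
  · rintro ⟨S, V⟩ hp
    simp only [mem_product, mem_powerset, mem_Icc] at hp
    simp only [Prod.mk.injEq]
    constructor <;>
    · ext x
      have h1 := @hp.1 x
      have h2 := @hp.2.1 x
      have h3 := @hp.2.2 x
      have h4 := @hT x
      simp only [mem_union, mem_inter, mem_sdiff]
      tauto
  · intro V hV
    have hV' := (mem_Icc.1 hV).2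
    ext x
    have h3 := @hV' x
    simp only [mem_union, mem_inter, mem_sdiff]
    tauto
  · rintro ⟨S, V⟩ hp
    simp only [mem_product, mem_powerset, mem_Icc] at hp
    have h0 : (U \ ((S ∪ U \ T) ∩ V)).card = (T \ S).card + (U \ V).card := by
      rw [← card_union_of_disjoint]
      · congr 1
        ext x
        have h1 := @hp.1 x
        have h2 := @hp.2.1 x
        have h3 := @hp.2.2 x
        have h4 := @hT x
        simp only [mem_union, mem_inter, mem_sdiff]
        tauto
      · exact disjoint_left.2 fun x => by
          have h2 := @hp.2.1 x
          simp only [mem_sdiff]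
          tauto
    rw [h0, pow_add, mul_smul]

variable {P}

lemma Near.nrm_comp_sub_twoStep_le (hP : P.Near κ) (hκ : 0 ≤ κ) {T U : Finset (Fin k)}
    (hT : T ⊆ U) (f : Ω → ℝ) :
    P.nrm (P.comp U f - P.twoStep T U f) ≤ N k ^ 2 * (κ * P.nrm f) := by
  have h1 : P.twoStep T U f = ∑ p ∈ T.powerset ×ˢ Icc T U, (-1 : ℝ) ^ (T \ p.1).card •
      (-1 : ℝ) ^ (U \ p.2).card • P.A (p.1 ∪ U \ T) (P.A p.2 f) := by
    rw [sum_product, twoStep]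
    refine sum_congr rfl fun S _ => ?_
    simp only [rcomp_apply, map_sum, map_smul, smul_sum]
  rw [h1, comp_eq_sum_product P hT, ← sum_sub_distrib]
  refine P.nrm_sum_le_card _ _ (mul_nonneg hκ (P.nrm_nonneg f)) ?_ fun p _ => ?_
  · rw [card_product, sq]
    push_cast
    exact mul_le_mul (card_le_N _) (card_le_N _) (Nat.cast_nonneg _) (N_pos k).le
  · rw [← smul_sub, ← smul_sub, nrm_sign_smul, nrm_sign_smul, ← nrm_neg, neg_sub]
    exact hP _ _ f

lemma Glob.abs_twoStep_le (hf : P.Glob d δ f) (hδ : 0 ≤ δ) {T U : Finset (Fin k)}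
    (hU : U.card ≤ d) (x : Ω) : |P.twoStep T U f x| ≤ N k ^ 2 * δ := by
  have hN := N_pos k
  rw [twoStep, Finset.sum_apply]
  refine (abs_sum_le_sum_abs _ _).trans ((sum_le_card_nsmul _ _ (N k * δ) fun S _ => ?_).trans ?_)
  · rw [Pi.smul_apply, smul_eq_mul, abs_mul, abs_pow, abs_neg, abs_one, one_pow, one_mul]
    exact P.abs_A_le_const _ (hf.abs_rcomp_le hδ T hU) x
  · rw [nsmul_eq_mul, sq, mul_assoc]
    exact mul_le_mul_of_nonneg_right (card_le_N _) (by positivity)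

variable (P) in
lemma twoStep_sq_le (T U : Finset (Fin k)) (f : Ω → ℝ) :
    P.twoStep T U f ^ 2 ≤
      (2 : ℝ) ^ T.card • ∑ S ∈ T.powerset, P.A (S ∪ U \ T) (P.rcomp T U f ^ 2) := fun x => by
  have h1 := sq_sum_le_card_mul_sum_sq (s := T.powerset)
    (f := fun S => (-1 : ℝ) ^ (T \ S).card * P.A (S ∪ U \ T) (P.rcomp T U f) x)
  simp only [mul_pow, ← pow_mul, mul_comm _ 2, pow_mul _ 2, neg_one_sq, one_pow, one_mul,
    card_powerset] at h1
  simp only [twoStep, Pi.pow_apply, Finset.sum_apply, Pi.smul_apply, smul_eq_mul]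
  push_cast at h1
  refine h1.trans ?_
  gcongr with S _
  exact P.A_sq_le _ _ x

/-- The conditional energy of the low degree components of a global function is at most
`4^{|T|} δ²`, up to an error that is small in `L²`. -/
lemma Glob.exists_energy_le (hf : P.Glob d δ f) (hδ : 0 ≤ δ) (hP : P.Near κ) (hκ : 0 ≤ κ)
    {T : Finset (Fin k)} (hT : T.card ≤ d) :
    ∃ err : Ω → ℝ, P.nrm err ≤ 3 * N k ^ 5 * (κ * δ * P.nrm f) ∧
      ∀ x, P.energy (P.lowComp d f) T x ≤ 4 ^ T.card * ((1 + N k ^ 4 * κ) * δ ^ 2) + err x := by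
  have hN := N_pos k
  have hN1 := one_le_N k
  have hf0 := P.nrm_nonneg f
  set s : Finset (Finset (Fin k)) := {U ∈ Icc T univ | U.card ≤ d} with hs
  set F : Finset (Fin k) → Ω → ℝ := fun U => P.rcomp T U f with hF
  set e₁ : Finset (Fin k) → Ω → ℝ := fun U x => |(P.comp U f - P.twoStep T U f) x| with he₁
  set e₂ : Finset (Fin k) → Finset (Fin k) → Ω → ℝ := fun U S =>
    P.A T (P.A (S ∪ U \ T) (F U ^ 2)) - P.A S (F U ^ 2) with he₂
  have hpow : (2 : ℝ) ^ T.card ≤ N k := pow_le_pow_right₀ one_le_two (by simpa using card_le_univ T)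
  refine ⟨∑ U ∈ s, ((2 : ℝ) ^ T.card • ∑ S ∈ T.powerset, e₂ U S + (2 * N k ^ 2 * δ) • P.A T (e₁ U)),
    ?_, fun x => ?_⟩
  · refine (P.nrm_sum_le_card s _ (c := 3 * N k ^ 4 * (κ * δ * P.nrm f)) (by positivity)
      (card_le_N _) fun U hU => ?_).trans_eq (by ring)
    have hU' : T ⊆ U ∧ U.card ≤ d := by simpa [hs] using hU
    have h1 : P.nrm (∑ S ∈ T.powerset, e₂ U S) ≤ N k * (N k ^ 2 * (κ * δ * P.nrm f)) := by
      refine P.nrm_sum_le_card _ _ (by positivity) (card_le_N _) fun S hS => ?_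
      have h2 := hP T (S ∪ U \ T) (F U ^ 2)
      have h3 : T ∩ (S ∪ U \ T) = S := by
        have hS' := mem_powerset.1 hS
        ext x
        have := @hS' x
        simp only [mem_union, mem_inter, mem_sdiff]
        tauto
      rw [h3] at h2
      refine h2.trans ?_
      calc _ ≤ κ * (N k * δ * (N k * P.nrm f)) := by
            gcongr
            rw [sq]
            refine (P.nrm_mul_le (hf.abs_rcomp_le hδ T hU'.2) _).trans ?_
            gcongr
            exact P.nrm_rcomp_le T U f
        _ = _ := by ring
    have h2 : P.nrm (P.A T (e₁ U)) ≤ N k ^ 2 * (κ * P.nrm f) := by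
      refine (P.nrm_A_le T _).trans (le_trans (P.nrm_mono fun x => ?_)
        (hP.nrm_comp_sub_twoStep_le hκ hU'.1 f))
      rw [he₁, abs_abs]
    refine (P.nrm_add_le _ _).trans ?_
    have h3 := P.nrm_nonneg (∑ S ∈ T.powerset, e₂ U S)
    rw [nrm_smul, nrm_smul, abs_of_nonneg (by positivity), abs_of_nonneg (by positivity)]
    calc _ ≤ N k * (N k * (N k ^ 2 * (κ * δ * P.nrm f)))
          + 2 * N k ^ 2 * δ * (N k ^ 2 * (κ * P.nrm f)) := by gcongr
      _ = _ := by ring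
  · have h0 : P.energy (P.lowComp d f) T = ∑ U ∈ s, P.A T (P.comp U f ^ 2) := by
      rw [energy, map_sum, hs, sum_filter]
      refine sum_congr rfl fun U _ => ?_
      split_ifs with h
      · rw [lowComp_of_le h]
      · rw [lowComp_of_lt U (not_le.1 h)]; simp
    have h1 : ∀ U ∈ s, P.A T (P.comp U f ^ 2) ≤ (2 : ℝ) ^ T.card • ∑ S ∈ T.powerset,
        (P.A S (F U ^ 2) + e₂ U S) + (2 * N k ^ 2 * δ) • P.A T (e₁ U) := by
      intro U hU
      have hU' : T ⊆ U ∧ U.card ≤ d := by simpa [hs] using hU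
      have h2 : P.comp U f ^ 2 ≤ (2 : ℝ) ^ T.card • ∑ S ∈ T.powerset, P.A (S ∪ U \ T) (F U ^ 2)
          + (2 * N k ^ 2 * δ) • e₁ U := fun x => by
        have h3 := P.twoStep_sq_le T U f x
        have h4 := hf.abs_rcomp_le hδ ∅ hU'.2 x
        have h5 := hf.abs_twoStep_le hδ (T := T) hU'.2 x
        have h6 : N k * δ ≤ N k ^ 2 * δ := by
          gcongr
          exact le_self_pow₀ hN1 (by norm_num)
        have h7 : |P.comp U f x + P.twoStep T U f x| ≤ 2 * N k ^ 2 * δ :=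
          (abs_add_le _ _).trans (by linarith)
        have h8 : P.comp U f x ^ 2 - P.twoStep T U f x ^ 2 ≤ 2 * N k ^ 2 * δ * e₁ U x := by
          calc _ = (P.comp U f x + P.twoStep T U f x) * (P.comp U f x - P.twoStep T U f x) := by
                ring
            _ ≤ |P.comp U f x + P.twoStep T U f x| * |P.comp U f x - P.twoStep T U f x| := by
                rw [← abs_mul]; exact le_abs_self _
            _ ≤ _ := mul_le_mul_of_nonneg_right h7 (abs_nonneg _)
        simp only [Pi.pow_apply, Pi.add_apply, Pi.smul_apply, smul_eq_mul] at h3 ⊢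
        linarith
      have h3 := P.A_mono T h2
      rw [map_add, map_smul, map_smul, map_sum] at h3
      simpa only [he₂, add_sub_cancel] using h3
    -- the relative Bessel inequality
    have h2 : ∀ S ∈ T.powerset, ∑ U ∈ s, P.A S (F U ^ 2) x ≤ (1 + N k ^ 4 * κ) * δ ^ 2 := by
      intro S hS
      have hST := mem_powerset.1 hS
      have h3 : ∀ y, P.A T (∑ U ∈ s, F U ^ 2) y ≤ (1 + N k ^ 4 * κ) * δ ^ 2 := fun y => by
        have h4 := hP.sum_A_rcomp_sq_le hκ T f y
        have h5 : ∑ U ∈ s, P.A T (F U ^ 2) y ≤ ∑ U ∈ Icc T univ, P.A T (F U ^ 2) y :=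
          sum_le_sum_of_subset_of_nonneg (filter_subset _ _) fun U _ _ =>
            P.A_nonneg T (fun z => sq_nonneg _) y
        rw [map_sum, Finset.sum_apply]
        refine h5.trans (h4.trans ?_)
        gcongr
        exact hf T hT y
      have h6 := P.A_le_const S h3 x
      rwa [P.A_A_of_subset hST, map_sum, Finset.sum_apply] at h6
    have h3 := sum_le_sum h1 x
    rw [← h0] at h3
    have h4 : ∑ S ∈ T.powerset, ∑ U ∈ s, P.A S (F U ^ 2) x
        ≤ 2 ^ T.card * ((1 + N k ^ 4 * κ) * δ ^ 2) := by
      have := sum_le_card_nsmul _ _ _ h2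
      simpa using this
    have h5 : (2 : ℝ) ^ T.card * ∑ S ∈ T.powerset, ∑ U ∈ s, P.A S (F U ^ 2) x
        ≤ 4 ^ T.card * ((1 + N k ^ 4 * κ) * δ ^ 2) := by
      calc _ ≤ (2 : ℝ) ^ T.card * (2 ^ T.card * ((1 + N k ^ 4 * κ) * δ ^ 2)) := by gcongr
        _ = _ := by rw [← mul_assoc, ← mul_pow]; norm_num
    simp only [Finset.sum_apply, Pi.add_apply, Pi.smul_apply, smul_eq_mul, sum_add_distrib,
      mul_add, ← mul_sum] at h3 ⊢
    rw [sum_comm] at h5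
    linarith

/-- For a global function, the second moment of an energy is essentially bounded by its first. -/
lemma Glob.E_energy_sq_le_mul (hf : P.Glob d δ f) (hδ : 0 ≤ δ) (hP : P.Near κ) (hκ : 0 ≤ κ)
    (hsm : N k ^ 4 * κ ≤ 1 / 100) {T : Finset (Fin k)} (hT : T.card ≤ d) :
    P.E (P.energy (P.lowComp d f) T ^ 2) ≤
      103 / 100 * (4 ^ T.card * δ ^ 2 * P.E (P.energy (P.lowComp d f) T))
        + 228 * N k ^ 10 * (κ * δ * P.nrm f) ^ 2 := by
  obtain ⟨err, herr, hle⟩ := hf.exists_energy_le hδ hP hκ hT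
  set Z := P.energy (P.lowComp d f) T with hZ
  have hZ0 : 0 ≤ Z := energy_nonneg T
  set b := 4 ^ T.card * ((1 + N k ^ 4 * κ) * δ ^ 2) with hb
  have h1 : Z ^ 2 ≤ b • Z + Z * err := fun x => by
    have := mul_le_mul_of_nonneg_left (hle x) (hZ0 x)
    simp only [Pi.pow_apply, Pi.add_apply, Pi.smul_apply, Pi.mul_apply, smul_eq_mul]
    linarith [sq (Z x)]
  have h2 := P.E_mono h1
  rw [map_add, map_smul, smul_eq_mul] at h2
  have h3 := (le_abs_self _).trans (P.abs_E_mul_le Z err)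
  have h4 := pow_le_pow_left₀ (P.nrm_nonneg _) herr 2
  have h5 : (3 * N k ^ 5 * (κ * δ * P.nrm f)) ^ 2 = 9 * (N k ^ 10 * (κ * δ * P.nrm f) ^ 2) := by
    ring
  rw [h5] at h4
  have h6 := P.nrm_sq Z
  have hEZ : 0 ≤ P.E Z := P.E_nonneg hZ0
  have h7 : b * P.E Z ≤ 101 / 100 * (4 ^ T.card * δ ^ 2 * P.E Z) := by
    have h8 : 0 ≤ 4 ^ T.card * δ ^ 2 * P.E Z := by positivity
    calc b * P.E Z = (1 + N k ^ 4 * κ) * (4 ^ T.card * δ ^ 2 * P.E Z) := by rw [hb]; ring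
      _ ≤ _ := by gcongr; linarith
  have h8 : 0 ≤ 4 ^ T.card * δ ^ 2 * P.E Z := by positivity
  have h9 : 0 ≤ N k ^ 10 * (κ * δ * P.nrm f) ^ 2 := by have := N_pos k; positivity
  -- `a b ≤ a² / 100 + 25 b²`
  have h10 : P.nrm Z * P.nrm err ≤ 1 / 100 * P.nrm Z ^ 2 + 25 * P.nrm err ^ 2 := by
    nlinarith [sq_nonneg (P.nrm Z - 50 * P.nrm err)]
  rw [h6] at h10
  linarith

lemma sum_E_energy_le {q : ℝ} (hq : 1 ≤ q) :
    ∑ T : Finset (Fin k) with T.card ≤ d, q ^ T.card * P.E (P.energy (P.lowComp d f) T) ≤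
      (q + 1) ^ d * ∑ U : Finset (Fin k) with U.card ≤ d, P.nrm (P.comp U f) ^ 2 := by
  have hq0 : 0 < q := zero_lt_one.trans_le hq
  have h1 : ∀ T : Finset (Fin k), q ^ T.card * P.E (P.energy (P.lowComp d f) T)
      = ∑ U ∈ Icc T univ, q ^ T.card * P.nrm (P.lowComp d f U) ^ 2 := fun T => by
    rw [energy, P.E_A, map_sum, mul_sum]
    simp only [nrm_sq]
  calc _ ≤ ∑ T : Finset (Fin k), q ^ T.card * P.E (P.energy (P.lowComp d f) T) :=
        sum_le_sum_of_subset_of_nonneg (subset_univ _) fun T _ _ =>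
          mul_nonneg (by positivity) (P.E_nonneg (energy_nonneg T))
    _ = ∑ U : Finset (Fin k), ∑ T ∈ U.powerset, q ^ T.card * P.nrm (P.lowComp d f U) ^ 2 := by
        rw [sum_congr rfl fun T _ => h1 T]
        exact sum_comm' fun T U => by simp
    _ = ∑ U : Finset (Fin k), (q + 1) ^ U.card * P.nrm (P.lowComp d f U) ^ 2 := by
        refine sum_congr rfl fun U _ => ?_
        rw [← sum_mul]
        congr 1
        simpa using sum_pow_mul_eq_add_pow q 1 U
    _ = ∑ U : Finset (Fin k) with U.card ≤ d, (q + 1) ^ U.card * P.nrm (P.comp U f) ^ 2 := by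
        rw [sum_filter]
        refine sum_congr rfl fun U _ => ?_
        split_ifs with h
        · rw [lowComp_of_le h]
        · rw [lowComp_of_lt U (not_le.1 h), nrm_zero]; simp
    _ ≤ _ := by
        rw [mul_sum]
        refine sum_le_sum fun U hU => ?_
        gcongr
        · linarith
        · exact (mem_filter.1 hU).2

lemma Near.sum_nrm_comp_sq_le (hP : P.Near κ) (hκ : 0 ≤ κ) (hsm : N k ^ 4 * κ ≤ 1 / 100)
    (d : ℕ) (f : Ω → ℝ) :
    ∑ U : Finset (Fin k) with U.card ≤ d, P.nrm (P.comp U f) ^ 2 ≤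
      103 / 100 * P.nrm (P.low d f) ^ 2 + 101 * N k ^ 7 * (κ * P.nrm f) ^ 2 := by
  have hN := N_pos k
  set h := P.low d f with hh
  have h1 : ∀ U ∈ ({U | U.card ≤ d} : Finset (Finset (Fin k))), P.nrm (P.comp U f) ^ 2 ≤
      101 / 100 * P.nrm (P.comp U h) ^ 2 + 101 * (N k ^ 6 * (κ * P.nrm f) ^ 2) := by
    intro U hU
    have h2 := P.nrm_add_sq_le (P.comp U h) (-(P.comp U h - P.comp U f))
    have h3 := pow_le_pow_left₀ (P.nrm_nonneg _)
      (hP.nrm_comp_low_sub_le hκ (mem_filter.1 hU).2 f) 2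
    have h4 : (N k ^ 3 * κ * P.nrm f) ^ 2 = N k ^ 6 * (κ * P.nrm f) ^ 2 := by ring
    rw [h4] at h3
    rw [nrm_neg] at h2
    have h5 : P.comp U h + -(P.comp U h - P.comp U f) = P.comp U f := by abel
    rw [h5] at h2
    linarith
  have h2 := sum_le_sum h1
  rw [sum_add_distrib, ← mul_sum, sum_const, nsmul_eq_mul] at h2
  have h3 : (#({U | U.card ≤ d} : Finset (Finset (Fin k))) : ℝ)
      * (101 * (N k ^ 6 * (κ * P.nrm f) ^ 2)) ≤ N k * (101 * (N k ^ 6 * (κ * P.nrm f) ^ 2)) := by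
    gcongr
    exact card_le_N _
  have h4 : ∑ U : Finset (Fin k) with U.card ≤ d, P.nrm (P.comp U h) ^ 2
      ≤ ∑ U, P.nrm (P.comp U h) ^ 2 :=
    sum_le_sum_of_subset_of_nonneg (subset_univ _) fun U _ _ => sq_nonneg _
  have h5 := (abs_le.1 (hP.abs_nrm_sq_sub_sum_comp_le hκ h)).1
  have h6 : N k ^ 4 * κ * P.nrm h ^ 2 ≤ 1 / 100 * P.nrm h ^ 2 := by gcongr
  have h7 := sq_nonneg (P.nrm h)
  linarith

lemma le_of_thr (hκ : 0 ≤ κ) (h : thr k * κ ≤ 1) : N k ^ 4 * κ ≤ 1 / 100 := by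
  have hN := N_pos k
  have h1 : N k ^ 4 * κ ≤ N k ^ 10 * (2 * k + 1) ^ k * κ := by
    gcongr
    calc N k ^ 4 ≤ N k ^ 10 := pow_le_pow_right₀ (one_le_N k) (by norm_num)
      _ = N k ^ 10 * 1 := by ring
      _ ≤ _ := by
        gcongr
        exact one_le_pow₀ (by linarith [(Nat.cast_nonneg k : (0 : ℝ) ≤ k)])
  have h2 : thr k * κ = 4800 * (N k ^ 10 * (2 * k + 1) ^ k * κ) := by rw [thr]; ring
  linarith

/-- The numerical inequality behind the constant `(100 d)^d`. -/
lemma wt_const_le (hd : 1 ≤ d) :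
    21 / 20 * (103 / 100) * (103 / 100) *
      ((2 + 1 / wt d) ^ (2 * d) * 4 ^ d * (wt d + 1) ^ d) ≤ (100 * (d : ℝ)) ^ d := by
  have hd' : (0 : ℝ) < d := by exact_mod_cast hd
  have hw : 0 < wt d := zero_lt_one.trans_le (one_le_wt d)
  have h1 : (wt d + 1) ^ d ≤ (2 * (d : ℝ)) ^ d * Real.exp (1 / 2) := by
    have e1 : wt d + 1 = 2 * d * (1 / (2 * d) + 1) := by rw [wt_eq hd]; field_simp; ring
    have e2 : (1 / (2 * (d : ℝ)) + 1) ^ d ≤ Real.exp (1 / 2) := by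
      calc _ ≤ Real.exp (1 / (2 * d)) ^ d := by
            gcongr
            exact Real.add_one_le_exp _
        _ = Real.exp (1 / 2) := by
            rw [← Real.exp_nat_mul]
            congr 1
            field_simp
    rw [e1, mul_pow]
    gcongr
  have h2 := two_add_inv_wt_pow_le hd
  have h3 : Real.exp (1 / 2) * Real.exp (1 / 2) ≤ 2.7182818286 := by
    rw [← Real.exp_add]
    norm_num
    have := Real.exp_one_lt_d9
    norm_num at this
    exact this.le
  have h4 : (4 : ℝ) ^ d * 4 ^ d * 2 ^ d = 32 ^ d := by rw [← mul_pow, ← mul_pow]; norm_num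
  have h5 : (100 : ℝ) / 32 * 32 ^ d ≤ 100 ^ d := by
    obtain ⟨n, rfl⟩ : ∃ n, d = n + 1 := ⟨d - 1, by omega⟩
    have : (32 : ℝ) ^ n ≤ 100 ^ n := by gcongr; norm_num
    rw [pow_succ, pow_succ]
    linarith
  calc _ ≤ 21 / 20 * (103 / 100) * (103 / 100) *
        (4 ^ d * Real.exp (1 / 2) * 4 ^ d * ((2 * (d : ℝ)) ^ d * Real.exp (1 / 2))) := by gcongr
    _ = 21 / 20 * (103 / 100) * (103 / 100) * (Real.exp (1 / 2) * Real.exp (1 / 2)) *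
        (32 ^ d * (d : ℝ) ^ d) := by rw [mul_pow, ← h4]; ring
    _ ≤ 21 / 20 * (103 / 100) * (103 / 100) * 2.7182818286 * (32 ^ d * (d : ℝ) ^ d) := by gcongr
    _ ≤ 100 / 32 * (32 ^ d * (d : ℝ) ^ d) := by gcongr; norm_num
    _ = 100 / 32 * 32 ^ d * (d : ℝ) ^ d := by ring
    _ ≤ 100 ^ d * (d : ℝ) ^ d := by gcongr
    _ = _ := by rw [mul_pow]

/-- The constant in front of the error term in the bound for global functions. -/
def const₂ (k : ℕ) : ℝ :=
  101 * N k ^ 7 * (100 * k) ^ k + 479 * N k ^ 15 * (2 * k + 1) ^ k + 110 * N k ^ 11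

lemma const₂_nonneg (k : ℕ) : 0 ≤ const₂ k := by
  have := N_pos k
  unfold const₂
  positivity

/-- Globalness makes the fourth moment of the low degree part small. -/
theorem Glob.E_low_pow_four_le_global_of_le (hf : P.Glob d δ f) (hδ : 0 ≤ δ) (hP : P.Near κ)
    (hκ : 0 ≤ κ) (hd1 : 1 ≤ d) (hd : d ≤ k) (hsm : thr k * κ ≤ 1) :
    P.E (P.low d f ^ 4) ≤ (100 * (d : ℝ)) ^ d * δ ^ 2 * P.nrm (P.low d f) ^ 2
      + const₂ k * (κ * δ * P.nrm f) ^ 2 := by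
  have hN := N_pos k
  have hf0 := P.nrm_nonneg f
  have hw1 := one_le_wt d
  have hw : 0 < wt d := zero_lt_one.trans_le hw1
  have hd0 : (1 : ℝ) ≤ d := by exact_mod_cast hd1
  have hdk : (d : ℝ) ≤ k := by exact_mod_cast hd
  have h1 := hf.E_low_pow_four_le hδ hP hκ hw1 (small_of_thr hκ hd hsm)
  set e := (κ * δ * P.nrm f) ^ 2 with he
  have he0 : 0 ≤ e := sq_nonneg _
  set M := (2 + 1 / wt d) ^ (2 * d) with hM
  have hM0 : 0 ≤ M := by positivity
  have hM2 : M ≤ 2 * N k ^ 2 :=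
    (two_add_inv_wt_pow_le_two_mul d).trans (by gcongr; exact four_pow_le_N hd)
  have hsm' := le_of_thr hκ hsm
  have hterm : ∀ T ∈ ({T | T.card ≤ d} : Finset (Finset (Fin k))),
      wt d ^ T.card * (4 ^ (d - T.card) * P.E (P.energy (P.lowComp d f) T ^ 2)) ≤
        103 / 100 * 4 ^ d * δ ^ 2 * (wt d ^ T.card * P.E (P.energy (P.lowComp d f) T))
          + 228 * N k ^ 12 * (2 * k + 1) ^ k * e := by
    intro T hT
    have hTd : T.card ≤ d := (mem_filter.1 hT).2
    have h2 := hf.E_energy_sq_le_mul hδ hP hκ hsm' hTd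
    have h5 : wt d ^ T.card ≤ (2 * k + 1) ^ k :=
      (pow_le_pow_right₀ hw1 (hTd.trans hd)).trans (wt_pow_le hd)
    have h6 : (4 : ℝ) ^ (d - T.card) ≤ N k ^ 2 := four_pow_le_N (by omega)
    have h7 : (4 : ℝ) ^ (d - T.card) * 4 ^ T.card = 4 ^ d := by
      rw [← pow_add]; congr 1; omega
    calc _ ≤ wt d ^ T.card * (4 ^ (d - T.card) *
          (103 / 100 * (4 ^ T.card * δ ^ 2 * P.E (P.energy (P.lowComp d f) T))
            + 228 * N k ^ 10 * e)) := by gcongr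
      _ = 103 / 100 * (4 ^ (d - T.card) * 4 ^ T.card) * δ ^ 2 *
            (wt d ^ T.card * P.E (P.energy (P.lowComp d f) T))
          + wt d ^ T.card * (4 ^ (d - T.card) * (228 * N k ^ 10 * e)) := by ring
      _ ≤ 103 / 100 * 4 ^ d * δ ^ 2 * (wt d ^ T.card * P.E (P.energy (P.lowComp d f) T))
          + (2 * k + 1) ^ k * (N k ^ 2 * (228 * N k ^ 10 * e)) := by
          rw [h7]
          gcongr
      _ = _ := by ring
  have h2 := sum_le_sum hterm
  rw [sum_add_distrib, ← mul_sum, sum_const, nsmul_eq_mul] at h2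
  have h3 : (#({T | T.card ≤ d} : Finset (Finset (Fin k))) : ℝ)
        * (228 * N k ^ 12 * (2 * k + 1) ^ k * e)
      ≤ N k * (228 * N k ^ 12 * (2 * k + 1) ^ k * e) := by
    gcongr
    exact card_le_N _
  have h4 := (sum_E_energy_le (P := P) (d := d) (f := f) hw1).trans
    (mul_le_mul_of_nonneg_left (hP.sum_nrm_comp_sq_le hκ hsm' d f) (by positivity))
  set Y := ∑ T : Finset (Fin k) with T.card ≤ d, wt d ^ T.card *
    (4 ^ (d - T.card) * P.E (P.energy (P.lowComp d f) T ^ 2)) with hY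
  set h := P.nrm (P.low d f) ^ 2 with hh
  have hh0 : 0 ≤ h := sq_nonneg _
  have h5 : Y ≤ 103 / 100 * 4 ^ d * δ ^ 2 * ((wt d + 1) ^ d *
      (103 / 100 * h + 101 * N k ^ 7 * (κ * P.nrm f) ^ 2))
      + N k * (228 * N k ^ 12 * (2 * k + 1) ^ k * e) := by
    refine h2.trans (add_le_add ?_ h3)
    exact mul_le_mul_of_nonneg_left h4 (by positivity)
  have h6 := wt_const_le hd1
  rw [← hM] at h6
  set G := M * 4 ^ d * (wt d + 1) ^ d with hG
  have hG0 : 0 ≤ G := by positivity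
  have h7 : (100 * (d : ℝ)) ^ d ≤ (100 * k) ^ k :=
    (pow_le_pow_left₀ (by positivity) (by linarith) d).trans
      (pow_le_pow_right₀ (by linarith) hd)
  have h8 : 21 / 20 * (M * Y) ≤ 21 / 20 * (103 / 100) * (103 / 100) * G * (δ ^ 2 * h)
      + 21 / 20 * (103 / 100) * G * (101 * N k ^ 7 * e)
      + 21 / 20 * M * (228 * N k ^ 13 * (2 * k + 1) ^ k * e) := by
    calc _ ≤ 21 / 20 * (M * (103 / 100 * 4 ^ d * δ ^ 2 * ((wt d + 1) ^ d *
          (103 / 100 * h + 101 * N k ^ 7 * (κ * P.nrm f) ^ 2))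
          + N k * (228 * N k ^ 12 * (2 * k + 1) ^ k * e))) := by gcongr
      _ = _ := by rw [hG, he]; ring
  have h9 : 21 / 20 * (103 / 100) * G ≤ (100 * k) ^ k := by linarith
  calc P.E (P.low d f ^ 4) ≤ _ := h1
    _ ≤ (100 * (d : ℝ)) ^ d * (δ ^ 2 * h) + (100 * k) ^ k * (101 * N k ^ 7 * e)
      + 21 / 20 * (2 * N k ^ 2) * (228 * N k ^ 13 * (2 * k + 1) ^ k * e) + 110 * N k ^ 11 * e := by
        refine add_le_add (h8.trans ?_) le_rfl
        gcongr
    _ = (100 * (d : ℝ)) ^ d * (δ ^ 2 * h) + (100 * k) ^ k * (101 * N k ^ 7 * e)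
      + 4788 / 10 * (N k ^ 15 * (2 * k + 1) ^ k * e) + 110 * N k ^ 11 * e := by ring
    _ ≤ (100 * (d : ℝ)) ^ d * (δ ^ 2 * h) + (100 * k) ^ k * (101 * N k ^ 7 * e)
      + 479 * (N k ^ 15 * (2 * k + 1) ^ k * e) + 110 * N k ^ 11 * e := by gcongr; norm_num
    _ = _ := by rw [const₂]; ring

end CoordSpace
end EpsProduct
end

/-! ### Arbitrary degrees, and passage to the support of a measure -/

noncomputable section

namespace EpsProduct
namespace CoordSpace
open Finset

section
variable {k : ℕ} {Ω : Type*} [Fintype Ω] {P : CoordSpace k Ω}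
variable {d : ℕ} {δ κ : ℝ} {f : Ω → ℝ}

lemma Glob.mono {d' : ℕ} (hf : P.Glob d δ f) (h : d' ≤ d) : P.Glob d' δ f :=
  fun S hS => hf S (hS.trans h)

lemma card_le_min_iff (U : Finset (Fin k)) : U.card ≤ min d k ↔ U.card ≤ d := by
  have : U.card ≤ k := by simpa using card_le_univ U
  omega

lemma low_min : P.low (min d k) f = P.low d f := by
  simp only [low, card_le_min_iff]

lemma lowComp_min : P.lowComp (min d k) f = P.lowComp d f := by
  funext U
  simp only [lowComp, card_le_min_iff]

lemma Glob.E_low_pow_four_le_influence (hf : P.Glob d δ f) (hδ : 0 ≤ δ) (hP : P.Near κ)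
    (hκ : 0 ≤ κ) :
    P.E (P.low d f ^ 4) ≤ 20 ^ (d + 1) * ∑ T : Finset (Fin k) with T.card ≤ d,
      (4 * (d : ℝ)) ^ T.card * P.E (P.A T ((∑ U ∈ Icc T univ, P.lowComp d f U) ^ 2) ^ 2)
      + const₁ k * (κ * δ * P.nrm f) ^ 2 := by
  have h1 := (hf.mono (min_le_left d k)).E_low_pow_four_le_influence_of_le hδ hP hκ
    (min_le_right d k)
  simp only [low_min, lowComp_min, card_le_min_iff] at h1
  have hd : ((min d k : ℕ) : ℝ) ≤ d := by exact_mod_cast min_le_left d k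
  refine h1.trans ?_
  gcongr with T _
  · exact sum_nonneg fun T _ => mul_nonneg (by positivity) (P.E_sq_nonneg _)
  · norm_num
  · exact min_le_left d k
  · exact P.E_sq_nonneg _

lemma low_zero : P.low 0 f = P.A ∅ f := by
  rw [low, show ({U | U.card ≤ 0} : Finset (Finset (Fin k))) = {∅} by ext; simp, sum_singleton,
    comp, rcomp_apply]
  simp

lemma Glob.E_low_zero_pow_four_le (hf : P.Glob 0 δ f) (hδ : 0 ≤ δ) :
    P.E (P.low 0 f ^ 4) ≤ δ ^ 2 * P.nrm (P.low 0 f) ^ 2 := by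
  rw [P.nrm_sq, ← smul_eq_mul, ← map_smul]
  refine P.E_mono fun x => ?_
  have h1 : (P.low 0 f x) ^ 2 ≤ δ ^ 2 := by
    rw [low_zero]
    have := abs_le.1 (hf.abs_A_le hδ (S := ∅) (by simp) x)
    exact sq_le_sq' this.1 this.2
  simp only [Pi.pow_apply, Pi.smul_apply, smul_eq_mul]
  calc (P.low 0 f x) ^ 4 = (P.low 0 f x) ^ 2 * (P.low 0 f x) ^ 2 := by ring
    _ ≤ _ := by gcongr

lemma Glob.E_low_pow_four_le_global (hf : P.Glob d δ f) (hδ : 0 ≤ δ) (hP : P.Near κ)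
    (hκ : 0 ≤ κ) (hsm : thr k * κ ≤ 1) :
    P.E (P.low d f ^ 4) ≤ (100 * (d : ℝ)) ^ d * δ ^ 2 * P.nrm (P.low d f) ^ 2
      + const₂ k * (κ * δ * P.nrm f) ^ 2 := by
  have hc : 0 ≤ const₂ k * (κ * δ * P.nrm f) ^ 2 := mul_nonneg (const₂_nonneg k) (sq_nonneg _)
  have hf' := hf.mono (min_le_left d k)
  have hpow : (100 * ((min d k : ℕ) : ℝ)) ^ min d k ≤ (100 * (d : ℝ)) ^ d := by
    rcases Nat.eq_zero_or_pos d with rfl | hd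
    · simp
    · have hd1 : (1 : ℝ) ≤ d := by exact_mod_cast hd
      have hd2 : ((min d k : ℕ) : ℝ) ≤ d := by exact_mod_cast min_le_left d k
      exact (pow_le_pow_left₀ (by positivity) (by linarith) _).trans
        (pow_le_pow_right₀ (by linarith) (min_le_left d k))
  have h1 : P.E (P.low (min d k) f ^ 4) ≤ (100 * ((min d k : ℕ) : ℝ)) ^ min d k * δ ^ 2 *
      P.nrm (P.low (min d k) f) ^ 2 + const₂ k * (κ * δ * P.nrm f) ^ 2 := by
    rcases Nat.eq_zero_or_pos (min d k) with h0 | h0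
    · rw [h0] at hf' ⊢
      have := hf'.E_low_zero_pow_four_le hδ
      simpa using this.trans (le_add_of_nonneg_right hc)
    · exact hf'.E_low_pow_four_le_global_of_le hδ hP hκ h0 (min_le_right d k) hsm
  rw [low_min] at h1
  refine h1.trans ?_
  gcongr

lemma A_congr {S : Finset (Fin k)} {x : Ω} {F G : Ω → ℝ} (h : ∀ y, P.Rel S x y → F y = G y) :
    P.A S F x = P.A S G x := by
  simp only [A_apply]
  refine sum_congr rfl fun y _ => ?_
  by_cases hy : P.Rel S x y
  · rw [h y hy]
  · rw [P.ker_eq_zero hy, zero_mul, zero_mul]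

end

lemma indicator_eq_zero {α : Type*} {ν : α → ℝ} (s : Set α) {x : α} (h : ν x = 0) :
    s.indicator ν x = 0 := by
  classical
  rw [Set.indicator_apply, h, ite_self]

section
variable {k : ℕ} {V : Fin k → Type*} [∀ i, Fintype (V i)] {μ : (∀ i, V i) → ℝ}

/-- The support of `μ`. -/
abbrev Supp (μ : (∀ i, V i) → ℝ) := {x : ∀ i, V i // 0 < μ x}

instance : Fintype (Supp μ) := by
  classical
  infer_instance

lemma sum_supp (hμ : μ ∈ stdSimplex ℝ (∀ i, V i)) (F : (∀ i, V i) → ℝ)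
    (hF : ∀ x, μ x = 0 → F x = 0) : ∑ x, F x = ∑ x : Supp μ, F x := by
  classical
  rw [← sum_subset (subset_univ {x | 0 < μ x}),
    sum_subtype (p := fun x => 0 < μ x) _ (by simp)]
  intro x _ hx
  refine hF x (le_antisymm ?_ (hμ.1 x))
  simpa using hx

/-- The support of `μ`, as a space with coordinates. -/
def ofMeasure (hμ : μ ∈ stdSimplex ℝ (∀ i, V i)) : CoordSpace k (Supp μ) where
  w x := μ x
  pos x := x.2
  sum_one := by rw [← sum_supp hμ μ fun _ h => h]; exact hμ.2
  same i x y := x.1 i = y.1 i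
  equiv i := ⟨fun _ => rfl, Eq.symm, Eq.trans⟩
  sep x y h := Subtype.ext (funext h)

/-- The restriction of a function to the support of `μ`. -/
def res (f : (∀ i, V i) → ℝ) : Supp μ → ℝ := fun x => f x

variable (hμ : μ ∈ stdSimplex ℝ (∀ i, V i))

lemma expect_eq (f : (∀ i, V i) → ℝ) : expect μ f = (ofMeasure hμ).E (res f) := by
  rw [expect, sum_supp hμ _ fun x h => by rw [h, zero_mul]]
  rfl

lemma indicator_eq (S : Finset (Fin k)) (x : Supp μ) (y : Supp μ) [Decidable
    ((ofMeasure hμ).Rel S x y)] :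
    {y : ∀ i, V i | ∀ i ∈ S, y i = x.1 i}.indicator μ y
      = if (ofMeasure hμ).Rel S x y then μ y else 0 := by
  have h : (ofMeasure hμ).Rel S x y ↔ y.1 ∈ {y : ∀ i, V i | ∀ i ∈ S, y i = x.1 i} :=
    ⟨fun h i hi => (h i hi).symm, fun h i hi => (h i hi).symm⟩
  split_ifs with h'
  · exact Set.indicator_of_mem (h.1 h') μ
  · exact Set.indicator_of_notMem (fun h'' => h' (h.2 h'')) μ

lemma marginal_eq (S : Finset (Fin k)) (x : Supp μ) :
    marginal μ S x = (ofMeasure hμ).mass S x := by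
  classical
  rw [marginal, sum_supp hμ _ fun x h => indicator_eq_zero _ h]
  exact sum_congr rfl fun y _ => indicator_eq hμ S x y

lemma expect_link_eq (S : Finset (Fin k)) (x : Supp μ) (f : (∀ i, V i) → ℝ) :
    expect (link μ S x) f = (ofMeasure hμ).A S (res f) x := by
  classical
  rw [expect, sum_supp hμ _ fun y h => by
    rw [link, indicator_eq_zero _ h, zero_div, zero_mul], A_apply]
  refine sum_congr rfl fun y _ => ?_
  rw [link, indicator_eq hμ S x y, marginal_eq hμ]
  rfl

lemma res_avg (S : Finset (Fin k)) (f : (∀ i, V i) → ℝ) :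
    res (avg μ S f) = (ofMeasure hμ).A S (res f) :=
  funext fun x => expect_link_eq hμ S x f

lemma res_component (S : Finset (Fin k)) (f : (∀ i, V i) → ℝ) :
    res (component μ S f) = (ofMeasure hμ).comp S (res f) := by
  rw [comp, rcomp_apply]
  funext x
  rw [Finset.sum_apply, show Icc (∅ : Finset (Fin k)) S = S.powerset by ext; simp]
  refine sum_congr rfl fun T _ => ?_
  rw [← res_avg]
  rfl

lemma res_lowDegree (d : ℕ) (f : (∀ i, V i) → ℝ) :
    res (lowDegree μ d f) = (ofMeasure hμ).low d (res f) := by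
  rw [low]
  simp only [← res_component]
  funext x
  rw [Finset.sum_apply]
  rfl

lemma res_lowLaplacian (d : ℕ) (T : Finset (Fin k)) (f : (∀ i, V i) → ℝ) :
    res (lowLaplacian μ d T f) = ∑ U ∈ Icc T univ, (ofMeasure hμ).lowComp d (res f) U := by
  simp only [lowComp, ← sum_filter, ← res_component]
  have h : (Icc T univ).filter (fun U => U.card ≤ d)
      = univ.filter fun U : Finset (Fin k) => T ⊆ U ∧ U.card ≤ d := by
    ext; simp
  rw [h]
  funext x
  rw [Finset.sum_apply]
  rfl

lemma lpNorm_four_pow (f : (∀ i, V i) → ℝ) :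
    lpNorm 4 μ f ^ 4 = (ofMeasure hμ).E (res f ^ 4) := by
  have e : (res (μ := μ) fun x => |f x| ^ 4) = res f ^ 4 := by
    funext x
    exact Even.pow_abs (by decide) (f x)
  rw [lpNorm, expect_eq hμ, e, one_div]
  refine Real.rpow_inv_natCast_pow ?_ (by norm_num)
  exact (ofMeasure hμ).E_nonneg fun x => by simp only [Pi.pow_apply]; positivity

lemma lpNorm_two_sq (f : (∀ i, V i) → ℝ) :
    lpNorm 2 μ f ^ 2 = (ofMeasure hμ).nrm (res f) ^ 2 := by
  have e : (res (μ := μ) fun x => |f x| ^ 2) = res f ^ 2 := by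
    funext x
    simp [res]
  rw [lpNorm, expect_eq hμ, e, one_div, nrm_sq]
  exact Real.rpow_inv_natCast_pow ((ofMeasure hμ).E_sq_nonneg _) (by norm_num)

lemma lpNorm_two_link_sq (S : Finset (Fin k)) (x : Supp μ) (f : (∀ i, V i) → ℝ) :
    lpNorm 2 (link μ S x) f ^ 2 = (ofMeasure hμ).A S (res f ^ 2) x := by
  have e : (res (μ := μ) fun x => |f x| ^ 2) = res f ^ 2 := by
    funext x
    simp [res]
  rw [lpNorm, expect_link_eq hμ, e, one_div]
  exact Real.rpow_inv_natCast_pow ((ofMeasure hμ).A_nonneg S (fun y => sq_nonneg _) x)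
    (by norm_num)

lemma lpNorm_nonneg {Ω : Type*} [Fintype Ω] (p : ℕ) {ν : Ω → ℝ} (hν : 0 ≤ ν) (f : Ω → ℝ) :
    0 ≤ lpNorm p ν f :=
  Real.rpow_nonneg (sum_nonneg fun x _ => mul_nonneg (hν x) (by positivity)) _

lemma link_nonneg (hμ : μ ∈ stdSimplex ℝ (∀ i, V i)) (S : Finset (Fin k)) (x : ∀ i, V i) :
    0 ≤ link μ S x := fun y =>
  div_nonneg (Set.indicator_nonneg (fun z _ => hμ.1 z) y)
    (sum_nonneg fun z _ => Set.indicator_nonneg (fun z _ => hμ.1 z) z)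

lemma expect_lowInfluence_sq (d : ℕ) (T : Finset (Fin k)) (f : (∀ i, V i) → ℝ) :
    expect μ (fun x => lowInfluence μ d T f x ^ 2) = (ofMeasure hμ).E ((ofMeasure hμ).A T
      ((∑ U ∈ Icc T univ, (ofMeasure hμ).lowComp d (res f) U) ^ 2) ^ 2) := by
  rw [expect_eq hμ]
  congr 1
  funext x
  simp only [res, Pi.pow_apply, lowInfluence]
  rw [lpNorm_two_link_sq hμ, res_lowLaplacian]

lemma glob_of_isGlobal {d : ℕ} {δ : ℝ} {f : (∀ i, V i) → ℝ} (hf : IsGlobal μ d δ f) :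
    0 ≤ δ ∧ (ofMeasure hμ).Glob d δ (res f) := by
  have hpos : ∀ (S : Finset (Fin k)) (x : Supp μ), 0 < marginal μ S x := fun S x => by
    rw [marginal_eq hμ]
    exact (ofMeasure hμ).mass_pos S x
  constructor
  · obtain ⟨x, hx⟩ : ∃ x, 0 < μ x := by
      by_contra h
      push Not at h
      have h1 := hμ.2
      rw [sum_eq_zero fun x _ => le_antisymm (h x) (hμ.1 x)] at h1
      exact zero_ne_one h1
    exact (lpNorm_nonneg 2 (link_nonneg hμ ∅ x) f).trans
      (hf ∅ (by simp) x (hpos ∅ ⟨x, hx⟩))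
  · intro S hS x
    rw [← lpNorm_two_link_sq hμ]
    exact pow_le_pow_left₀ (lpNorm_nonneg 2 (link_nonneg hμ S x) f) (hf S hS x (hpos S x)) 2

/-- On the fibre of `x` over `S`, a function of the coordinates in `S ∪ {i}` is a function of the
`i`-th coordinate. -/
lemma exists_factor {S : Finset (Fin k)} {i : Fin k} {u : Supp μ → ℝ}
    (hu : (ofMeasure hμ).Meas (insert i S) u) (x : Supp μ) :
    ∃ g : V i → ℝ, ∀ y, (ofMeasure hμ).Rel S x y → g (y.1 i) = u y := by
  classical
  refine ⟨fun a => if h : ∃ y : Supp μ, (ofMeasure hμ).Rel S x y ∧ y.1 i = a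
    then u h.choose else 0, fun y hy => ?_⟩
  have h : ∃ z : Supp μ, (ofMeasure hμ).Rel S x z ∧ z.1 i = y.1 i := ⟨y, hy, rfl⟩
  dsimp only
  rw [dif_pos h]
  refine hu _ _ fun j hj => ?_
  rcases mem_insert.1 hj with rfl | hj
  · exact h.choose_spec.2
  · exact (h.choose_spec.1.symm.trans hy) j hj

lemma pseudo_of_isEpsProduct {ε : ℝ} (h : IsEpsProduct ε μ) : (ofMeasure hμ).Pseudo ε := by
  intro S i j hi hj hij u v hu hv x
  have hcard : S.card + 2 ≤ k := by
    have h1 : (insert i (insert j S)).card = S.card + 2 := by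
      rw [card_insert_of_notMem (by simp [hij, hi]), card_insert_of_notMem hj]
    have h2 := card_le_univ (insert i (insert j S))
    simpa [h1] using h2
  have hpos : 0 < marginal μ S x := by
    rw [marginal_eq hμ]
    exact (ofMeasure hμ).mass_pos S x
  obtain ⟨a, ha⟩ := exists_factor hμ hu x
  obtain ⟨b, hb⟩ := exists_factor hμ hv x
  have key := h S hcard x hpos i j hi hj hij a b
  set P := ofMeasure hμ with hP
  have e1 : ∀ (i : Fin k) (g : V i → ℝ) (w : Supp μ → ℝ),
      (∀ y, P.Rel S x y → g (y.1 i) = w y) →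
      expect (link μ S x) (fun y => g (y i)) = P.A S w x := fun i g w hw => by
    rw [expect_link_eq hμ]
    exact A_congr hw
  have e2 : ∀ (i : Fin k) (g : V i → ℝ) (w : Supp μ → ℝ),
      (∀ y, P.Rel S x y → g (y.1 i) = w y) →
      variance (link μ S x) (fun y => g (y i)) = P.A S ((w - P.A S w) ^ 2) x :=
    fun i g w hw => by
      rw [variance, e1 i g w hw, expect_link_eq hμ]
      refine A_congr fun y hy => ?_
      simp only [res, Pi.pow_apply, Pi.sub_apply]
      rw [hw y hy, P.meas_A S w x y hy]
  have e3 : expect (link μ S x) (fun y => a (y i) * b (y j)) = P.A S (u * v) x := by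
    rw [expect_link_eq hμ]
    refine A_congr fun y hy => ?_
    simp only [res, Pi.mul_apply]
    rw [ha y hy, hb y hy]
  rwa [e1 i a u ha, e1 j b v hb, e2 i a u ha, e2 j b v hb, e3] at key

end
end CoordSpace

section
open CoordSpace
variable {k : ℕ} {V : Fin k → Type*} [∀ i, Fintype (V i)] {μ : (∀ i, V i) → ℝ}
  {ε δ : ℝ} {d : ℕ} {f : (∀ i, V i) → ℝ}

lemma lpNorm_lowDegree_pow_le_influence (hμ : μ ∈ stdSimplex ℝ (∀ i, V i)) (hε : 0 ≤ ε)
    (h : IsEpsProduct ε μ) (hf : IsGlobal μ d δ f) :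
    lpNorm 4 μ (lowDegree μ d f) ^ 4 ≤
      20 ^ (d + 1) * ∑ S : Finset (Fin k) with S.card ≤ d, (4 * (d : ℝ)) ^ S.card *
          expect μ (fun x => lowInfluence μ d S f x ^ 2)
        + const₁ k * k ^ 4 * (ε ^ 2 * δ ^ 2) * lpNorm 2 μ f ^ 2 := by
  obtain ⟨hδ, hg⟩ := glob_of_isGlobal hμ hf
  have key := hg.E_low_pow_four_le_influence hδ ((pseudo_of_isEpsProduct hμ h).near hε)
    (by positivity)
  simp only [expect_lowInfluence_sq hμ]
  rw [lpNorm_four_pow hμ, res_lowDegree, lpNorm_two_sq hμ]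
  refine key.trans_eq ?_
  ring

lemma lpNorm_lowDegree_pow_le_global (hμ : μ ∈ stdSimplex ℝ (∀ i, V i)) (hε : 0 ≤ ε)
    (hsm : thr k * ((k : ℝ) ^ 2 * ε) ≤ 1) (h : IsEpsProduct ε μ) (hf : IsGlobal μ d δ f) :
    lpNorm 4 μ (lowDegree μ d f) ^ 4 ≤
      (100 * (d : ℝ)) ^ d * δ ^ 2 * lpNorm 2 μ (lowDegree μ d f) ^ 2
        + const₂ k * k ^ 4 * (δ ^ 2 * ε ^ 2 * lpNorm 2 μ f ^ 2) := by
  obtain ⟨hδ, hg⟩ := glob_of_isGlobal hμ hf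
  have key := hg.E_low_pow_four_le_global hδ ((pseudo_of_isEpsProduct hμ h).near hε)
    (by positivity) hsm
  rw [lpNorm_four_pow hμ, lpNorm_two_sq hμ, lpNorm_two_sq hμ, res_lowDegree]
  refine key.trans_eq ?_
  ring

lemma lpNorm_two_lowDegree_sq_le (hμ : μ ∈ stdSimplex ℝ (∀ i, V i)) (hε : 0 ≤ ε)
    (hsm : thr k * ((k : ℝ) ^ 2 * ε) ≤ 1) (h : IsEpsProduct ε μ) :
    lpNorm 2 μ (lowDegree μ d f) ^ 2 ≤ 2 * lpNorm 2 μ f ^ 2 := by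
  have hκ : 0 ≤ (k : ℝ) ^ 2 * ε := by positivity
  rw [lpNorm_two_sq hμ, lpNorm_two_sq hμ, res_lowDegree]
  refine (((pseudo_of_isEpsProduct hμ h).near hε).nrm_low_sq_le hκ d _).trans ?_
  gcongr
  linarith [le_of_thr hκ hsm]

/-- The threshold for `ε` below which the error terms can be absorbed. -/
def epsThr (k : ℕ) : ℝ := 1 / (thr k * k ^ 2 + 1)

lemma epsThr_pos (k : ℕ) : 0 < epsThr k := by
  have := thr_pos k
  unfold epsThr
  positivity

lemma thr_mul_le (h : ε ≤ epsThr k) : thr k * ((k : ℝ) ^ 2 * ε) ≤ 1 := by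
  have ht := thr_pos k
  have h0 : 0 < thr k * k ^ 2 + 1 := by positivity
  calc _ = (thr k * k ^ 2) * ε := by ring
    _ ≤ (thr k * k ^ 2) * epsThr k := by gcongr
    _ ≤ (thr k * k ^ 2 + 1) * epsThr k := by
      have := (epsThr_pos k).le
      gcongr
      linarith
    _ = 1 := mul_one_div_cancel h0.ne'

end
end EpsProduct

end

theorem mainTheorem2 :
    -- the hypercontractive inequality for global functions
    (∀ k : ℕ, ∃ C : ℝ, 0 ≤ C ∧
      ∀ (V : Fin k → Type u) [∀ i, Fintype (V i)] (μ : (∀ i, V i) → ℝ),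
        μ ∈ stdSimplex ℝ (∀ i, V i) →
      ∀ ε : ℝ, 0 ≤ ε → EpsProduct.IsEpsProduct ε μ →
      ∀ (d : ℕ) (δ : ℝ) (f : (∀ i, V i) → ℝ), EpsProduct.IsGlobal μ d δ f →
        EpsProduct.lpNorm 4 μ (EpsProduct.lowDegree μ d f) ^ 4 ≤
          20 ^ (d + 1) * ∑ S : Finset (Fin k) with S.card ≤ d,
              (4 * (d : ℝ)) ^ S.card *
                EpsProduct.expect μ (fun x => EpsProduct.lowInfluence μ d S f x ^ 2)
            + C * (ε ^ 2 * δ ^ 2) * EpsProduct.lpNorm 2 μ f ^ 2) ∧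
    -- globalness implies a small 4-norm of the low degree part
    (∀ k : ℕ, ∃ ε₀ : ℝ, 0 < ε₀ ∧ ∃ C : ℝ, 0 ≤ C ∧
      ∀ (V : Fin k → Type u) [∀ i, Fintype (V i)] (μ : (∀ i, V i) → ℝ),
        μ ∈ stdSimplex ℝ (∀ i, V i) →
      ∀ ε : ℝ, 0 ≤ ε → ε ≤ ε₀ → EpsProduct.IsEpsProduct ε μ →
      ∀ (d : ℕ) (δ : ℝ) (f : (∀ i, V i) → ℝ), EpsProduct.IsGlobal μ d δ f →
        EpsProduct.lpNorm 4 μ (EpsProduct.lowDegree μ d f) ^ 4 ≤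
          (100 * (d : ℝ)) ^ d * δ ^ 2 * EpsProduct.lpNorm 2 μ (EpsProduct.lowDegree μ d f) ^ 2
            + C * (δ ^ 2 * ε ^ 2 * EpsProduct.lpNorm 2 μ f ^ 2)) ∧
    -- the consequence; here `δ₀` does not depend on `k`
    (∀ (ζ : ℝ) (d : ℕ), 0 < ζ → ∃ δ₀ : ℝ, 0 < δ₀ ∧ ∀ k : ℕ, ∃ ε₀ : ℝ, 0 < ε₀ ∧
      ∀ (V : Fin k → Type u) [∀ i, Fintype (V i)] (μ : (∀ i, V i) → ℝ),
        μ ∈ stdSimplex ℝ (∀ i, V i) →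
      ∀ ε : ℝ, 0 ≤ ε → ε ≤ ε₀ → EpsProduct.IsEpsProduct ε μ →
      ∀ (δ : ℝ) (f : (∀ i, V i) → ℝ), δ ≤ δ₀ → EpsProduct.IsGlobal μ d δ f →
        EpsProduct.lpNorm 4 μ (EpsProduct.lowDegree μ d f) ^ 4 ≤
          ζ * EpsProduct.lpNorm 2 μ f ^ 2) := by
  open EpsProduct EpsProduct.CoordSpace in
  refine ⟨fun k => ⟨const₁ k * k ^ 4, mul_nonneg (const₁_nonneg k) (by positivity), ?_⟩,
    fun k => ⟨epsThr k, epsThr_pos k, const₂ k * k ^ 4,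
      mul_nonneg (const₂_nonneg k) (by positivity), ?_⟩, fun ζ d hζ => ?_⟩
  · intro V _ μ hμ ε hε h d δ f hf
    exact lpNorm_lowDegree_pow_le_influence hμ hε h hf
  · intro V _ μ hμ ε hε hε₀ h d δ f hf
    exact lpNorm_lowDegree_pow_le_global hμ hε (thr_mul_le hε₀) h hf
  -- `δ₀` is chosen with `2 (100 d)^d δ₀² ≤ ζ / 2` and `δ₀ ≤ 1`, and `ε₀` with `C ε₀² ≤ ζ / 2`
  have hB : (0 : ℝ) ≤ (100 * d) ^ d := by positivity
  refine ⟨min 1 (ζ / (4 * ((100 * d) ^ d + 1))), by positivity, fun k => ?_⟩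
  set C := const₂ k * k ^ 4 with hC
  have hC0 : 0 ≤ C := mul_nonneg (const₂_nonneg k) (by positivity)
  have hthr := epsThr_pos k
  refine ⟨min (epsThr k) (min 1 (ζ / (2 * (C + 1)))), by positivity, ?_⟩
  intro V _ μ hμ ε hε hε₀ h δ f hδ₀ hf
  have hsm := thr_mul_le (hε₀.trans (min_le_left _ _))
  have hε₁ : ε ≤ 1 := hε₀.trans ((min_le_right _ _).trans (min_le_left _ _))
  have hε₂ : ε ≤ ζ / (2 * (C + 1)) := hε₀.trans ((min_le_right _ _).trans (min_le_right _ _))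
  have hδ := (glob_of_isGlobal hμ hf).1
  have hδ₁ : δ ≤ 1 := hδ₀.trans (min_le_left _ _)
  have hδ₂ : δ ≤ ζ / (4 * ((100 * d) ^ d + 1)) := hδ₀.trans (min_le_right _ _)
  rw [le_div_iff₀ (by positivity)] at hδ₂ hε₂
  have h1 := lpNorm_lowDegree_pow_le_global hμ hε hsm h hf
  have h2 := lpNorm_two_lowDegree_sq_le (d := d) (f := f) hμ hε hsm h
  rw [← hC] at h1
  set X := lpNorm 2 μ f ^ 2 with hX
  have hX0 : 0 ≤ X := sq_nonneg _
  have hδsq : δ ^ 2 ≤ δ := by nlinarith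
  have hεsq : ε ^ 2 ≤ ε := by nlinarith
  have h3 : (100 * (d : ℝ)) ^ d * δ ^ 2 * 2 ≤ ζ / 2 := by
    have : (100 * (d : ℝ)) ^ d * δ ^ 2 ≤ (100 * (d : ℝ)) ^ d * δ := by gcongr
    linarith
  have h4 : C * (δ ^ 2 * ε ^ 2) ≤ ζ / 2 := by
    have : C * (δ ^ 2 * ε ^ 2) ≤ C * (1 * ε) := by
      gcongr
      linarith
    linarith
  calc _ ≤ _ := h1
    _ ≤ (100 * (d : ℝ)) ^ d * δ ^ 2 * (2 * X) + C * (δ ^ 2 * ε ^ 2 * X) := by gcongr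
    _ = ((100 * (d : ℝ)) ^ d * δ ^ 2 * 2) * X + (C * (δ ^ 2 * ε ^ 2)) * X := by ring
    _ ≤ ζ / 2 * X + ζ / 2 * X := by gcongr
    _ = ζ * X := by ring
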